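/- **Setting.** Let $A$ be a commutative $\mathbb Q$-algebra ("functions of $(t,\bar t)$") with two infinite families of derivations $\partial_{t_n},\partial_{\bar t_n}$ ($n\ge 1$), all of which commute; $\partial=\partial_{t_1}$, $\bar\partial=\partial_{\bar t_1}$. Let $D,\bar D$ be the symbols of $\partial,\bar\partial$ in the algebras of pseudo-differential operators $\sum_{n\le N}a_nD^n$, resp. $\sum_{n\le N}a_n\bar D^n$; the subscripts $+$ and $-$ denote the differential part and the part with negative powers, ${}^*$ the formal adjoint, and $P(f)$ the action of a differential operator $P$ on $f\in A$. A *scalar KP system with ghost flows* in $(t;\bar t)$ consists of $L=D+\sum_{i\ge1}u_iD^{-i}$, a dressing operator $W=1+\sum_{i\ge1}w_iD^{-i}$ and $\Phi_j,\Psi_j\in A$ $(j\ge1)$ such that, for all $n,s,k\ge 1$: * $L=WDW^{-1}$, $\ \partial_{t_n}L=[(L^n)_+,L]$, $\ \partial_{t_n}W=-(L^n)_-W$; * $\partial_{t_n}\Phi_k=(L^n)_+(\Phi_k)$, $\ \partial_{t_n}\Psi_k=-((L^*)^n)_+(\Psi_k)$; * with $M_s=\sum_{j=1}^s\Phi_{s-j+1}D^{-1}\Psi_j$: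 $\ \partial_{\bar t_s}L=[M_s,L]$, $\ \partial_{\bar t_s}W=M_sW$; * there are potentials $S_{jk}=\partial^{-1}(\Phi_j\Psi_k)$, i.e. $\partial S_{jk}=\Phi_j\Psi_k$, with $\partial_{\bar t_s}\Phi_k=\sum_{j=1}^s\Phi_{s-j+1}S_{kj}-\Phi_{k+s}$ and $\partial_{\bar t_s}\Psi_k=\sum_{j=1}^s\Psi_jS_{s-j+1,k}+\Psi_{k+s}$; * (independence) the Wronskians $W_k=\det(\partial^{\alpha-1}\Phi_\beta)_{\alpha,\beta\le k}$ and $\mathcal W_k=\det(\partial^{\alpha-1}\Psi_\beta)_{\alpha,\beta\le k}$ are invertible for all $k\ge0$ ($W_0=\mathcal W_0=1$). Put $\mathcal W_{j-1}(\Psi_k)=$ Wronskian of $\Psi_1,\dots,\Psi_{j-1},\Psi_k$, and $$\bar M_s=\sum_{j=1}^s\Bigl(\sum_{k=j}^s\tfrac{\Phi_{s-k+1}}{\Phi_1}\tfrac{\mathcal W_{j-1}(\Psi_k)}{\mathcal W_j}\Bigr)\bigl(\bar D-\bar\partial\ln\tfrac{\mathcal W_{j-1}}{\mathcal W_{j-2}}\bigr)\cdots\bigl(\bar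 D-\bar\partial\ln\Psi_1\bigr)\bigl(\bar D-\bar\partial\ln\tfrac1{\Phi_1}\bigr)-\partial_{\bar t_s}\ln\Phi_1,$$ where the $j$-th term contains $j$ first-order factors and $\bar\partial\ln f$ means $f^{-1}\bar\partial f$. A scalar KP system with ghost flows $(\bar L,\bar W,\bar\Phi_j,\bar\Psi_j)$ in $(\bar t;t)$ (the same definition with the two families of times exchanged) is called *a ghost system of* $(L,W,\Phi_j,\Psi_j)$ if 1. $(\bar L^s)_+=\bar M_s$ for all $s\ge1$; 2. $\bar\Phi_1=1/\Phi_1$ and, for suitable choices of the antiderivatives $\bar\partial^{-1}$, $$\bar\Phi_l=(-1)^l\frac1{\Phi_1}\bar\partial^{-1}\Phi_1\Psi_1\bar\partial^{-1}\frac{\mathcal W_2}{\Psi_1^2}\bar\partial^{-1}\cdots\bar\partial^{-1}\frac{\mathcal W_{l-1}\mathcal W_{l-3}}{\mathcal W_{l-2}^2}\quad(l\ge2),$$ $$\bar\Psi_j=(-1)^{j-1}\frac{W_2}{\Phi_1}\bar\partial^{-1}\frac{W_3\Phi_1}{W_2^2}\bar\partial^{-1}\cdots\bar\partial^{-1}\frac{W_{j+1}W_{j-1}}{W_j^2}\quad(j\ge1)$$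 (for $l=2$ the first formula reads $\bar\Phi_2=\frac1{\Phi_1}\bar\partial^{-1}(\Phi_1\Psi_1)$, for $j=1$ the second reads $\bar\Psi_1=W_2/\Phi_1$); 3. the constants of integration are those fixed by the dressing operator: $W=1+\sum_{s\ge1}\frac{\bar\Phi_{s+1}}{\bar\Phi_1}D^{-s}$. **Statement (duality).** There is a bijection $\mathfrak D$ from the scalar KP systems with ghost flows in $(t;\bar t)$ onto those in $(\bar t;t)$, such that for all $X$ in $(t;\bar t)$ and $Y$ in $(\bar t;t)$: $\ \mathfrak D(X)=Y$ if and only if $Y$ is a ghost system of $X$ and $X$ is a ghost system of $Y$ (the latter by the same formulas with $(t)\leftrightarrow(\bar t)$, $\Phi_j\leftrightarrow\bar\Phi_j$, $\Psi_j\leftrightarrow\bar\Psi_j$). In particular $L$ and $\bar L$ form a double-KP system: $\partial_{t_r}L=[(L^r)_+,L]$, $\partial_{\bar t_s}L=[M_s,L]$, $\partial_{\bar t_s}\bar L=[(\bar L^s)_+,\bar L]$, $\partial_{t_r}\bar L=[\sum_{i=1}^r\bar\Phi_{r-i+1}\bar D^{-1}\bar\Psi_i,\bar L]$, and this double system is mapped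 to itself by the exchange $(t)\leftrightarrow(\bar t)$, $L\leftrightarrow\bar L$, $\Phi_j\leftrightarrow\bar\Phi_j$, $\Psi_j\leftrightarrow\bar\Psi_j$. -/

import Mathlib

universe u

/-- The two-sided sequences of coefficients that vanish above some degree. -/
def boundedCoeffs (A : Type u) [CommRing A] : AddSubgroup (ℤ → A) where
  carrier := {f | ∃ N : ℤ, ∀ n, N < n → f n = 0}
  zero_mem' := ⟨0, fun _ _ => rfl⟩
  add_mem' := by
    rintro f g ⟨M, hM⟩ ⟨N, hN⟩
    refine ⟨max M N, fun n hn => ?_⟩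
    simp [hM n (lt_of_le_of_lt (le_max_left _ _) hn),
      hN n (lt_of_le_of_lt (le_max_right _ _) hn)]
  neg_mem' := by
    rintro f ⟨M, hM⟩
    exact ⟨M, fun n hn => by simp [hM n hn]⟩

/-- Pseudo-differential operators `∑_{n ≤ N} a_n D ^ n` over the differential ring `(A, d)`, where
`D` stands for `d` as an operator. -/
def PDO {A : Type u} [CommRing A] [Algebra ℚ A] (_d : Derivation ℚ A A) : Type u :=
  boundedCoeffs A

namespace PDO

variable {A : Type u} [CommRing A] [Algebra ℚ A] {d : Derivation ℚ A A}

instance : AddCommGroup (PDO d) := inferInstanceAs (AddCommGroup (boundedCoeffs A))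

/-- The coefficient of `D ^ n`. -/
def coeff (P : PDO d) (n : ℤ) : A := P.1 n

theorem exists_bound (P : PDO d) : ∃ N : ℤ, ∀ n, N < n → P.coeff n = 0 := P.2

/-- The operator `a D ^ n`. -/
def monomial (n : ℤ) (a : A) : PDO d :=
  ⟨fun m => if m = n then a else 0, n, fun _ hm => if_neg (ne_of_gt hm)⟩

/-- The operator of multiplication by the function `a`. -/
def const (a : A) : PDO d := monomial 0 a

/-- The operator `D`. -/
def D : PDO d := monomial 1 1

/-- The operator `D ^ (-1)`. -/
def Dinv : PDO d := monomial (-1) 1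

instance : One (PDO d) := ⟨const 1⟩

/-- Composition: `(a D ^ i) (b D ^ j) = ∑_k (i choose k) a b^{(k)} D ^ (i + j - k)`, for all integers
`i`, `j`. Below, `j = m - i + k`, and only finitely many pairs `(i, k)` contribute for given `m`. -/
noncomputable instance : Mul (PDO d) where
  mul P Q :=
    ⟨fun m => ∑ᶠ p : ℤ × ℕ,
        Ring.choose p.1 p.2 • (P.coeff p.1 * (⇑d)^[p.2] (Q.coeff (m - p.1 + p.2))), by
      obtain ⟨M, hM⟩ := P.exists_bound
      obtain ⟨N, hN⟩ := Q.exists_bound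
      refine ⟨M + N, fun m hm => ?_⟩
      refine finsum_eq_zero_of_forall_eq_zero fun p => ?_
      by_cases h : M < p.1
      · simp [hM _ h]
      · have h0 : (0 : ℤ) ≤ p.2 := Int.natCast_nonneg _
        rw [hN _ (by omega), iterate_map_zero]
        simp⟩

/-- Powers, `P ^ (n + 1) = P ^ n * P`. -/
noncomputable instance : Pow (PDO d) ℕ := ⟨fun P n => npowRec n P⟩

/-- The differential part. -/
def pos (P : PDO d) : PDO d :=
  ⟨fun n => if 0 ≤ n then P.coeff n else 0, by
    obtain ⟨N, hN⟩ := P.exists_bound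
    exact ⟨N, fun n hn => by simp [hN n hn]⟩⟩

/-- The purely pseudo-differential part. -/
def neg (P : PDO d) : PDO d :=
  ⟨fun n => if n < 0 then P.coeff n else 0, by
    obtain ⟨N, hN⟩ := P.exists_bound
    exact ⟨N, fun n hn => by simp [hN n hn]⟩⟩

/-- The formal adjoint: `(a D ^ i)^* = (-D) ^ i a = (-1) ^ i ∑_k (i choose k) a^{(k)} D ^ (i - k)`;
below, `i = m + k`. -/
noncomputable def adjoint (P : PDO d) : PDO d :=
  ⟨fun m => ∑ᶠ k : ℕ,
      ((Int.negOnePow (m + k) : ℤ) * Ring.choose (m + k : ℤ) k) • (⇑d)^[k] (P.coeff (m + k)), by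
    obtain ⟨N, hN⟩ := P.exists_bound
    refine ⟨N, fun m hm => finsum_eq_zero_of_forall_eq_zero fun k => ?_⟩
    have h0 : (0 : ℤ) ≤ k := Int.natCast_nonneg _
    rw [hN _ (by omega), iterate_map_zero, smul_zero]⟩

/-- The action `P(f) = ∑_{k ≥ 0} a_k f^{(k)}` of a differential operator on a function. It is only
used for operators `P` without negative part. -/
noncomputable def apply (P : PDO d) (f : A) : A :=
  ∑ᶠ k : ℕ, P.coeff k * (⇑d)^[k] f

/-- Another derivation `δ` acting on the coefficients of an operator. -/
def der (δ : Derivation ℚ A A) (P : PDO d) : PDO d :=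
  ⟨fun n => δ (P.coeff n), by
    obtain ⟨N, hN⟩ := P.exists_bound
    exact ⟨N, fun n hn => by simp [hN n hn]⟩⟩

end PDO

section Wronskians

variable {A : Type u} [CommRing A]

/-- The Wronskian determinant of `f 0, …, f (k - 1)` with respect to the derivation `d`. -/
def wronskianDet [Algebra ℚ A] (d : Derivation ℚ A A) {k : ℕ} (f : Fin k → A) : A :=
  Matrix.det (Matrix.of fun α β : Fin k => (⇑d)^[(α : ℕ)] (f β))

/-- The Wronskian of the first `k` members of a sequence of functions. -/
def Wr [Algebra ℚ A] (d : Derivation ℚ A A) (f : ℕ → A) (k : ℕ) : A :=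
  wronskianDet d fun i : Fin k => f i

/-- The Wronskian of the first `k` members of a sequence and one further function `g`. -/
def WrWith [Algebra ℚ A] (d : Derivation ℚ A A) (f : ℕ → A) (k : ℕ) (g : A) : A :=
  wronskianDet d (Fin.snoc (fun i : Fin k => f i) g : Fin (k + 1) → A)

/-- `f` is a value of the iterated integral `δ⁻¹ c₀ δ⁻¹ c₁ ⋯ δ⁻¹ cₘ` for some choice of
antiderivatives with respect to `δ`. -/
def IsIteratedIntegral [Algebra ℚ A] (δ : Derivation ℚ A A) : List A → A → Prop
  | [], f => f = 1
  | c :: cs, f => ∃ g, IsIteratedIntegral δ cs g ∧ δ f = c * g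

end Wronskians

/-- The operator `∑_{j=1}^{s} Φ_{s-j+1} D⁻¹ Ψ_j`, with sequences numbered from `0`: the index `s` here
is `s - 1` in the usual numbering from `1`. -/
noncomputable def ghostGen {A : Type u} [CommRing A] [Algebra ℚ A] (d : Derivation ℚ A A)
    (Φ Ψ : ℕ → A) (s : ℕ) : PDO d :=
  ∑ p ∈ Finset.HasAntidiagonal.antidiagonal s, PDO.const (Φ p.1) * PDO.Dinv * PDO.const (Ψ p.2)

/-- A scalar KP system in the times `t` together with the ghost symmetry flows in the times `t̄`
generated by an independent infinite system of eigenfunctions and adjoint eigenfunctions.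

`d n` is the derivation along `t_{n+1}` and `e n` the one along `t̄_{n+1}`; in particular `d 0` is
the derivation with respect to `x = t₁`, and the operators are pseudo-differential operators in `x`.
All sequences are numbered from `0`, so that `Φ k` is `Φ_{k+1}`. -/
structure GhostKP {A : Type u} [CommRing A] [Algebra ℚ A] (d e : ℕ → Derivation ℚ A A) where
  /-- Lax operator -/
  L : PDO (d 0)
  /-- dressing operator -/
  W : PDO (d 0)
  /-- eigenfunctions generating the ghost flows -/
  Φ : ℕ → A
  /-- adjoint eigenfunctions generating the ghost flows -/
  Ψ : ℕ → A
  /-- `L = D + u₁ D⁻¹ + u₂ D⁻² + ⋯` -/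
  lax_form : L.coeff 1 = 1 ∧ L.coeff 0 = 0 ∧ ∀ n, 1 < n → L.coeff n = 0
  /-- `W = 1 + w₁ D⁻¹ + w₂ D⁻² + ⋯` -/
  dressing_form : W.coeff 0 = 1 ∧ ∀ n, 0 < n → W.coeff n = 0
  /-- `L = W D W⁻¹` -/
  dressing : L * W = W * PDO.D
  /-- KP flows of the Lax operator -/
  lax_flow : ∀ n, L.der (d n) = (L ^ (n + 1)).pos * L - L * (L ^ (n + 1)).pos
  /-- KP flows of the dressing operator -/
  dressing_flow : ∀ n, W.der (d n) = -((L ^ (n + 1)).neg * W)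
  /-- `Φ k` is an eigenfunction -/
  eigen : ∀ n k, d n (Φ k) = (L ^ (n + 1)).pos.apply (Φ k)
  /-- `Ψ k` is an adjoint eigenfunction -/
  adj_eigen : ∀ n k, d n (Ψ k) = -(L.adjoint ^ (n + 1)).pos.apply (Ψ k)
  /-- ghost flows of the Lax operator -/
  lax_ghost : ∀ s, L.der (e s) = ghostGen (d 0) Φ Ψ s * L - L * ghostGen (d 0) Φ Ψ s
  /-- ghost flows of the dressing operator -/
  dressing_ghost : ∀ s, W.der (e s) = ghostGen (d 0) Φ Ψ s * W
  /-- ghost flows of the generating (adjoint) eigenfunctions, `S j k` being the squared eigenfunction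
  potential `∂⁻¹ (Φ_j Ψ_k)` -/
  ghost : ∃ S : ℕ → ℕ → A,
    (∀ j k, d 0 (S j k) = Φ j * Ψ k) ∧
    (∀ s k, e s (Φ k) = ∑ p ∈ Finset.HasAntidiagonal.antidiagonal s, Φ p.1 * S k p.2 - Φ (k + s + 1)) ∧
    (∀ s k, e s (Ψ k) = ∑ p ∈ Finset.HasAntidiagonal.antidiagonal s, Ψ p.2 * S p.1 k + Ψ (k + s + 1))
  /-- independence -/
  indep : ∀ k, IsUnit (Wr (d 0) Φ k)
  /-- independence -/
  adj_indep : ∀ k, IsUnit (Wr (d 0) Ψ k)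

namespace GhostKP

variable {A : Type u} [CommRing A] [Algebra ℚ A] {d e : ℕ → Derivation ℚ A A}

/-- `1 / Φ₁`, then `𝒲_i / 𝒲_{i-1}` for `i ≥ 1`, where `𝒲_i` is the Wronskian of
`Ψ₁, …, Ψ_i`. -/
noncomputable def ratio (X : GhostKP d e) : ℕ → A
  | 0 => Ring.inverse (X.Φ 0)
  | i + 1 => Wr (d 0) X.Ψ (i + 1) * Ring.inverse (Wr (d 0) X.Ψ i)

/-- The `t̄₁`-differential operators
`(D̄ - ∂̄ ln (𝒲_{j-1}/𝒲_{j-2})) ⋯ (D̄ - ∂̄ ln Ψ₁) (D̄ - ∂̄ ln (1/Φ₁))`, with `j` factors. -/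
noncomputable def factors (X : GhostKP d e) : ℕ → PDO (e 0)
  | 0 => 1
  | j + 1 => (PDO.D - PDO.const (e 0 (X.ratio j) * Ring.inverse (X.ratio j))) * X.factors j

/-- The ghost Zakharov-Shabat operator `M̄_{s+1}`: the `t̄₁`-differential operator by which the ghost
flow along `t̄_{s+1}` acts on `F / Φ₁` for generic eigenfunctions `F`. -/
noncomputable def ghostZS (X : GhostKP d e) (s : ℕ) : PDO (e 0) :=
  ∑ j ∈ Finset.range (s + 1),
      PDO.const (∑ k ∈ Finset.Icc j s, X.Φ (s - k) * Ring.inverse (X.Φ 0) *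
        (WrWith (d 0) X.Ψ j (X.Ψ k) * Ring.inverse (Wr (d 0) X.Ψ (j + 1)))) * X.factors (j + 1)
    - PDO.const (e s (X.Φ 0) * Ring.inverse (X.Φ 0))

/-- `Φ₁ Ψ₁`, then `𝒲_{i+1} 𝒲_{i-1} / 𝒲_i²` for `i ≥ 1`, Wronskians of the `Ψ_j`. -/
noncomputable def kernelΦ (X : GhostKP d e) : ℕ → A
  | 0 => X.Φ 0 * X.Ψ 0
  | i + 1 => Wr (d 0) X.Ψ (i + 2) * Wr (d 0) X.Ψ i * Ring.inverse (Wr (d 0) X.Ψ (i + 1)) ^ 2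

/-- `W_{i+3} W_{i+1} / W_{i+2}²`, Wronskians of the `Φ_j`. -/
noncomputable def kernelΨ (X : GhostKP d e) (i : ℕ) : A :=
  Wr (d 0) X.Φ (i + 3) * Wr (d 0) X.Φ (i + 1) * Ring.inverse (Wr (d 0) X.Φ (i + 2)) ^ 2

/-- The KP system `Y`, with Lax operator `L̄` in `t̄₁` and generating functions `Φ̄_j`, `Ψ̄_j`, arises
from `X` by the ghost construction. -/
structure IsGhostOf (X : GhostKP d e) (Y : GhostKP e d) : Prop where
  /-- `(L̄ ^ s)₊ = M̄_s` for all `s ≥ 1` -/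
  lax : ∀ s, (Y.L ^ (s + 1)).pos = X.ghostZS s
  /-- `Φ̄₁ = 1 / Φ₁` -/
  Φ_one : Y.Φ 0 = Ring.inverse (X.Φ 0)
  /-- `Φ̄_l = (-1)^l (1/Φ₁) ∂̄⁻¹ Φ₁Ψ₁ ∂̄⁻¹ (𝒲₂/Ψ₁²) ⋯ ∂̄⁻¹ (𝒲_{l-1} 𝒲_{l-3} / 𝒲_{l-2}²)`,
  for `l = m + 2` -/
  Φ_int : ∀ m, ∃ I, IsIteratedIntegral (e 0) ((List.range (m + 1)).map X.kernelΦ) I ∧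
    Y.Φ (m + 1) = (-1) ^ (m + 2) * Ring.inverse (X.Φ 0) * I
  /-- `Ψ̄_j = (-1)^(j-1) (W₂/Φ₁) ∂̄⁻¹ (W₃Φ₁/W₂²) ⋯ ∂̄⁻¹ (W_{j+1} W_{j-1} / W_j²)`, for `j = m + 1` -/
  Ψ_int : ∀ m, ∃ I, IsIteratedIntegral (e 0) ((List.range m).map X.kernelΨ) I ∧
    Y.Ψ m = (-1) ^ m * (Wr (d 0) X.Φ 2 * Ring.inverse (X.Φ 0)) * I
  /-- the constants of integration are those given by the dressing operator:
  `W = 1 + ∑_{m ≥ 1} (Φ̄_{m+1} / Φ̄₁) D⁻ᵐ` -/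
  normal : ∀ m : ℕ, Y.Φ m = Y.Φ 0 * X.W.coeff (-(m : ℤ))

end GhostKP

/-! ### The ring of pseudo-differential operators. -/

namespace PDO

variable {A : Type u} [CommRing A] [Algebra ℚ A] {d : Derivation ℚ A A}

/-! Number all sequences from 0 and let `w_m` be the coefficients of `W`, with `w_0 = 1`. The
duality exchanges the sequences `Φ_m` and `w_m`: it puts `Φ̄_m = w_m/Φ_0` and `w̄_m = Φ_m/Φ_0`, an
operation which visibly undoes itself. For two systems that are ghosts of each other, the conditions
`Φ_one` and `normal` say exactly this. Moreover `Φ` and `W` determine the whole system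
(`ext_of_Φ_of_W`): `L = W D W⁻¹`, and `Ψ_s` is found recursively from the ghost flows of `w_1`. So a
mutual ghost is unique if it exists. Since the relation is symmetric, its existence, proved by
`dual` and `isGhostOf_of_dualΦ`, already yields the bijection.

For existence, put `W̄ = Φ_0⁻¹ ∑ Φ_m D̄⁻ᵐ`. Along `t̄`, the ghost law of the `Φ_m` becomes an
operator identity whose right side is built from `D̄ᵏ⁺¹ + ∑ S_{mk} D̄⁻ᵐ`. The potentials themselves
flow in a definite way (`potential_flow`, a consequence of commutativity and independence), which
makes each of these a differential operator `B_k` times `W̄` (`ghostOp_mul_ofSeq`). This is the Sato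
equation for `W̄`, so `(L̄ˢ)₊` is a combination of the `B_k`. Gaussian elimination in the array of
derivatives of the `Ψ_k` identifies this combination with `M̄_s` (`ghostZS_eq`). The same `B_k` send
`w_m/Φ_0` to the coefficients of `D⁻¹ Ψ_k W`, so the `Φ̄_m` are eigenfunctions.

Along `t`, everything is expressed through the differential operators `P_k = (Dᵏ W⁻¹)₊`, which
expand all `(Lⁿ)₊`. The values `P_{k+1}(Φ_m)`, corrected by a multiple of `Φ_m` so as to vanish at
`m = 0`, are the coefficients of `D̄⁻¹ Ψ̄_k W̄`. The same correction of the coefficients of `P_{k+1}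
W` gives the dual potentials.

Finally, `Wr_dual` relates Wronskians in `x` to Wronskians in `t̄₁` up to signs. This transfers
independence, and combined with the classical factorisation of a function through Wronskians it
gives the iterated integrals for `Φ̄` and `Ψ̄`. -/

@[ext]
theorem ext {P Q : PDO d} (h : ∀ n, P.coeff n = Q.coeff n) : P = Q :=
  Subtype.ext (funext h)

@[simp] theorem coeff_zero (n : ℤ) : (0 : PDO d).coeff n = 0 := rfl
@[simp] theorem coeff_add (P Q : PDO d) (n : ℤ) : (P + Q).coeff n = P.coeff n + Q.coeff n := rfl
@[simp] theorem coeff_sub (P Q : PDO d) (n : ℤ) : (P - Q).coeff n = P.coeff n - Q.coeff n := rfl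
@[simp] theorem coeff_neg (P : PDO d) (n : ℤ) : (-P).coeff n = -P.coeff n := rfl

/-- Taking a coefficient, as an additive map. -/
def coeffHom (n : ℤ) : PDO d →+ A where
  toFun P := P.coeff n
  map_zero' := rfl
  map_add' _ _ := rfl

@[simp] theorem coeff_sum {ι : Type*} (s : Finset ι) (f : ι → PDO d) (n : ℤ) :
    (∑ i ∈ s, f i).coeff n = ∑ i ∈ s, (f i).coeff n :=
  map_sum (coeffHom n) f s

theorem coeff_monomial (i : ℤ) (a : A) (n : ℤ) :
    (monomial i a : PDO d).coeff n = if n = i then a else 0 := rfl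

theorem coeff_const (a : A) (n : ℤ) : (const a : PDO d).coeff n = if n = 0 then a else 0 := rfl

theorem coeff_one (n : ℤ) : (1 : PDO d).coeff n = if n = 0 then 1 else 0 := rfl

/-- `D ^ n` for an integer `n`. -/
def Dz (n : ℤ) : PDO d := monomial n 1

theorem coeff_Dz (i n : ℤ) : (Dz i : PDO d).coeff n = if n = i then 1 else 0 := rfl

theorem Dz_zero : (Dz 0 : PDO d) = 1 := rfl
theorem Dz_one : (Dz 1 : PDO d) = D := rfl
theorem Dz_neg_one : (Dz (-1) : PDO d) = Dinv := rfl
theorem const_one : (const 1 : PDO d) = 1 := rfl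

theorem const_add (a b : A) : (const (a + b) : PDO d) = const a + const b := by
  ext n; simp only [coeff_const, coeff_add]; split_ifs <;> simp

theorem const_neg (a : A) : (const (-a) : PDO d) = -const a := by
  ext n; simp only [coeff_const, coeff_neg]; split_ifs <;> simp

theorem const_sub (a b : A) : (const (a - b) : PDO d) = const a - const b := by
  ext n; simp only [coeff_const, coeff_sub]; split_ifs <;> simp

theorem const_zero : (const 0 : PDO d) = 0 := by
  ext n; simp [coeff_const]

theorem const_sum {ι : Type*} (s : Finset ι) (f : ι → A) :
    (const (∑ i ∈ s, f i) : PDO d) = ∑ i ∈ s, const (f i) := by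
  ext n; simp only [coeff_const, coeff_sum]; split_ifs <;> simp

/-- The order of `P` is at most `M`. -/
def OrdLE (P : PDO d) (M : ℤ) : Prop := ∀ n, M < n → P.coeff n = 0

theorem exists_ordLE (P : PDO d) : ∃ M, P.OrdLE M := P.exists_bound

theorem ordLE_monomial (i : ℤ) (a : A) : (monomial i a : PDO d).OrdLE i := fun n hn => by
  rw [coeff_monomial, if_neg (by omega)]

theorem ordLE_Dz (i : ℤ) : (Dz i : PDO d).OrdLE i := ordLE_monomial i 1

theorem OrdLE.mono {P : PDO d} {M N : ℤ} (h : P.OrdLE M) (hMN : M ≤ N) : P.OrdLE N :=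
  fun n hn => h n (by omega)

theorem coeff_mul (P Q : PDO d) (m : ℤ) : (P * Q).coeff m = ∑ᶠ p : ℤ × ℕ,
    Ring.choose p.1 p.2 • (P.coeff p.1 * (⇑d)^[p.2] (Q.coeff (m - p.1 + p.2))) := rfl

/-- A nonzero term has `i ≤ M` and `m - i + k ≤ N`, which bounds both indices. All identities of
products are verified on such finite sums. -/
theorem coeff_mul_eq_sum {P Q : PDO d} {M N : ℤ} (hP : P.OrdLE M) (hQ : Q.OrdLE N) (m : ℤ)
    (K : ℕ) (hK : M + N - m < K) (I : Finset ℤ) (hI : ∀ i, m - N ≤ i → i ≤ M → i ∈ I) :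
    (P * Q).coeff m = ∑ i ∈ I, ∑ k ∈ Finset.range K,
      Ring.choose i k • (P.coeff i * (⇑d)^[k] (Q.coeff (m - i + k))) := by
  rw [coeff_mul, finsum_eq_sum_of_support_subset (s := I ×ˢ Finset.range K), Finset.sum_product]
  intro p hp
  have h0 : (0 : ℤ) ≤ p.2 := Int.natCast_nonneg _
  have h1 : p.1 ≤ M := by
    by_contra h
    exact hp (by simp [hP p.1 (by omega)])
  have h2 : m - p.1 + p.2 ≤ N := by
    by_contra h
    exact hp (by simp [hQ (m - p.1 + p.2) (by omega), iterate_map_zero])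
  simp only [Finset.coe_product, Set.mem_prod, Finset.mem_coe, Finset.mem_range]
  exact ⟨hI _ (by omega) h1, by omega⟩

theorem OrdLE.mul {P Q : PDO d} {M N : ℤ} (hP : P.OrdLE M) (hQ : Q.OrdLE N) :
    (P * Q).OrdLE (M + N) := fun m hm => by
  rw [coeff_mul_eq_sum hP hQ m 0 (by push_cast; omega) ∅ (fun i _ _ => by omega)]
  simp

theorem coeff_mul_congr_left {P P' Q : PDO d} {N m : ℤ} (hQ : Q.OrdLE N)
    (h : ∀ n, m - N ≤ n → P.coeff n = P'.coeff n) : (P * Q).coeff m = (P' * Q).coeff m := by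
  rw [coeff_mul, coeff_mul]
  refine finsum_congr fun p => ?_
  have h0 : (0 : ℤ) ≤ p.2 := Int.natCast_nonneg _
  by_cases h1 : m - N ≤ p.1
  · rw [h _ h1]
  · rw [hQ _ (by omega)]; simp [iterate_map_zero]

theorem coeff_mul_congr_right {P Q Q' : PDO d} {M m : ℤ} (hP : P.OrdLE M)
    (h : ∀ n, m - M ≤ n → Q.coeff n = Q'.coeff n) : (P * Q).coeff m = (P * Q').coeff m := by
  rw [coeff_mul, coeff_mul]
  refine finsum_congr fun p => ?_
  have h0 : (0 : ℤ) ≤ p.2 := Int.natCast_nonneg _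
  by_cases h1 : p.1 ≤ M
  · rw [h _ (by omega)]
  · rw [hP _ (by omega)]; simp

theorem choose_one_of_two_le {k : ℕ} (hk : 2 ≤ k) : Ring.choose (1 : ℤ) k = 0 := by
  have := Ring.choose_natCast (R := ℤ) 1 k
  rw [Nat.choose_eq_zero_of_lt (by omega)] at this
  simpa using this

@[simp] theorem coeff_const_mul (a : A) (P : PDO d) (m : ℤ) :
    (const a * P).coeff m = a * P.coeff m := by
  rw [coeff_mul, finsum_eq_single _ (0, 0)]
  · simp [coeff_const]
  · rintro ⟨i, k⟩ h
    by_cases hi : i = 0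
    · subst hi
      have hk : 0 < k := Nat.pos_of_ne_zero (by rintro rfl; exact h rfl)
      simp [Ring.choose_zero_pos ℤ hk]
    · simp [coeff_const, hi]

@[simp] theorem coeff_D_mul (P : PDO d) (m : ℤ) :
    (D * P).coeff m = d (P.coeff m) + P.coeff (m - 1) := by
  rw [coeff_mul, finsum_eq_sum_of_support_subset (s := {((1 : ℤ), 0), ((1 : ℤ), 1)})]
  · rw [Finset.sum_pair (by simp)]
    simp [D, coeff_monomial, add_comm]
  · rintro ⟨i, k⟩ h
    have hi : i = 1 := by
      by_contra hi
      exact h (by simp [D, coeff_monomial, hi])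
    subst hi
    have hk : k < 2 := by
      by_contra hk
      exact h (by simp [choose_one_of_two_le (not_lt.1 hk)])
    interval_cases k <;> simp

@[simp] theorem coeff_mul_Dz (P : PDO d) (n m : ℤ) : (P * Dz n).coeff m = P.coeff (m - n) := by
  rw [coeff_mul, finsum_eq_single _ (m - n, 0)]
  · simp [coeff_Dz]
  · rintro ⟨i, k⟩ h
    rcases k with _ | k
    · have : m - i ≠ n := by rintro rfl; exact h (by simp)
      simp [coeff_Dz, this]
    · simp only [coeff_Dz, Function.iterate_succ_apply]
      have : d (if m - i + ((k + 1 : ℕ) : ℤ) = n then 1 else 0) = 0 := by split_ifs <;> simp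
      rw [this, iterate_map_zero]; simp

theorem monomial_eq (i : ℤ) (a : A) : (monomial i a : PDO d) = const a * Dz i := by
  ext n
  simp only [coeff_monomial, coeff_mul_Dz, coeff_const, sub_eq_zero]

theorem Dz_mul_Dz (m n : ℤ) : (Dz m * Dz n : PDO d) = Dz (m + n) := by
  ext i
  simp only [coeff_mul_Dz, coeff_Dz, sub_eq_iff_eq_add]

theorem const_mul_const (a b : A) : (const a * const b : PDO d) = const (a * b) := by
  ext i
  simp only [coeff_const_mul, coeff_const]; split_ifs <;> simp

protected theorem mul_add' (P Q R : PDO d) : P * (Q + R) = P * Q + P * R := by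
  obtain ⟨M, hM⟩ := P.exists_ordLE
  obtain ⟨N, hN⟩ := Q.exists_ordLE
  obtain ⟨N', hN'⟩ := R.exists_ordLE
  have h1 : Q.OrdLE (max N N') := hN.mono (le_max_left _ _)
  have h2 : R.OrdLE (max N N') := hN'.mono (le_max_right _ _)
  have h3 : (Q + R).OrdLE (max N N') := fun n hn => by simp [h1 n hn, h2 n hn]
  ext m
  obtain ⟨K, hK⟩ : ∃ K : ℕ, M + max N N' - m < K := ⟨(M + max N N' - m + 1).toNat, by omega⟩
  have hI : ∀ i, m - max N N' ≤ i → i ≤ M → i ∈ Finset.Icc (m - max N N') M := fun i h h' =>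
    Finset.mem_Icc.2 ⟨h, h'⟩
  rw [coeff_add, coeff_mul_eq_sum hM h1 m K hK _ hI, coeff_mul_eq_sum hM h2 m K hK _ hI,
    coeff_mul_eq_sum hM h3 m K hK _ hI]
  simp only [coeff_add, iterate_map_add, mul_add, smul_add, Finset.sum_add_distrib]

protected theorem add_mul' (P Q R : PDO d) : (P + Q) * R = P * R + Q * R := by
  obtain ⟨M, hM⟩ := R.exists_ordLE
  obtain ⟨N, hN⟩ := P.exists_ordLE
  obtain ⟨N', hN'⟩ := Q.exists_ordLE
  have h1 : P.OrdLE (max N N') := hN.mono (le_max_left _ _)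
  have h2 : Q.OrdLE (max N N') := hN'.mono (le_max_right _ _)
  have h3 : (P + Q).OrdLE (max N N') := fun n hn => by simp [h1 n hn, h2 n hn]
  ext m
  obtain ⟨K, hK⟩ : ∃ K : ℕ, max N N' + M - m < K := ⟨(max N N' + M - m + 1).toNat, by omega⟩
  have hI : ∀ i, m - M ≤ i → i ≤ max N N' → i ∈ Finset.Icc (m - M) (max N N') := fun i h h' =>
    Finset.mem_Icc.2 ⟨h, h'⟩
  rw [coeff_add, coeff_mul_eq_sum h1 hM m K hK _ hI, coeff_mul_eq_sum h2 hM m K hK _ hI,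
    coeff_mul_eq_sum h3 hM m K hK _ hI]
  simp only [coeff_add, add_mul, smul_add, Finset.sum_add_distrib]

@[simp] theorem coeff_der (δ : Derivation ℚ A A) (P : PDO d) (n : ℤ) :
    (P.der δ).coeff n = δ (P.coeff n) := rfl

theorem OrdLE.der {P : PDO d} {M : ℤ} (h : P.OrdLE M) (δ : Derivation ℚ A A) :
    (P.der δ).OrdLE M := fun n hn => by rw [coeff_der, h n hn, map_zero]

theorem der_mul {δ : Derivation ℚ A A} (hδ : ∀ a, δ (d a) = d (δ a)) (P Q : PDO d) :
    (P * Q).der δ = P.der δ * Q + P * Q.der δ := by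
  obtain ⟨M, hM⟩ := P.exists_ordLE
  obtain ⟨N, hN⟩ := Q.exists_ordLE
  ext m
  obtain ⟨K, hK⟩ : ∃ K : ℕ, M + N - m < K := ⟨(M + N - m + 1).toNat, by omega⟩
  have hI : ∀ i, m - N ≤ i → i ≤ M → i ∈ Finset.Icc (m - N) M := fun i h h' =>
    Finset.mem_Icc.2 ⟨h, h'⟩
  have hc : ∀ k a, δ ((⇑d)^[k] a) = (⇑d)^[k] (δ a) := fun k a =>
    (Function.Commute.iterate_right (f := ⇑δ) (g := ⇑d) hδ k) a
  rw [coeff_add, coeff_der, coeff_mul_eq_sum hM hN m K hK _ hI,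
    coeff_mul_eq_sum (hM.der δ) hN m K hK _ hI, coeff_mul_eq_sum hM (hN.der δ) m K hK _ hI]
  simp only [map_sum, coeff_der, ← Finset.sum_add_distrib]
  refine Finset.sum_congr rfl fun i _ => Finset.sum_congr rfl fun k _ => ?_
  rw [map_zsmul, Derivation.leibniz, hc, ← smul_add]
  congr 1
  simp only [smul_eq_mul]
  ring

theorem mul_mul_Dz (P Q : PDO d) (n : ℤ) : P * Q * Dz n = P * (Q * Dz n) := by
  ext m
  rw [coeff_mul_Dz, coeff_mul, coeff_mul]
  refine finsum_congr fun p => ?_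
  rw [coeff_mul_Dz, show m - n - p.1 + (p.2 : ℤ) = m - p.1 + p.2 - n by ring]

theorem D_mul (P : PDO d) : D * P = P.der d + P * Dz 1 := by
  ext m; simp

/-- After shifting `i` by one this is Pascal's rule for the generalised binomial coefficients,
combined with the Leibniz rule for `D * R`. -/
theorem mul_D_mul (Q R : PDO d) : Q * Dz 1 * R = Q * (D * R) := by
  obtain ⟨M, hM⟩ := Q.exists_ordLE
  obtain ⟨N, hN⟩ := R.exists_ordLE
  ext m
  obtain ⟨K, hK⟩ : ∃ K : ℕ, M + N + 1 - m < K := ⟨(M + N + 1 - m + 1).toNat, by omega⟩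
  have h1 : (Q * Dz 1).OrdLE (M + 1) := hM.mul (ordLE_Dz 1)
  have h2 : (D * R).OrdLE (1 + N) := (ordLE_Dz 1).mul hN
  rw [coeff_mul_eq_sum hM h2 m K (by omega) (Finset.Icc (m - (1 + N)) M)
      (fun i h h' => Finset.mem_Icc.2 ⟨h, h'⟩),
    coeff_mul_eq_sum h1 hN m (K + 1) (by push_cast; omega)
      ((Finset.Icc (m - (1 + N)) M).map (addRightEmbedding 1))
      (fun i h h' => Finset.mem_map.2 ⟨i - 1, Finset.mem_Icc.2 ⟨by omega, by omega⟩, by simp⟩),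
    Finset.sum_map]
  refine Finset.sum_congr rfl fun i hi => ?_
  rw [Finset.mem_Icc] at hi
  simp only [addRightEmbedding_apply, coeff_mul_Dz, add_sub_cancel_right, coeff_D_mul,
    iterate_map_add, ← mul_smul_comm, ← Finset.mul_sum, mul_add, smul_add,
    Finset.sum_add_distrib]
  rw [← mul_add]
  congr 1
  rw [Finset.sum_range_succ']
  have key : ∀ k : ℕ, m - (i + 1) + (k : ℤ) = m - i + k - 1 := fun k => by ring
  have key' : ∀ k : ℕ, m - (i + 1) + ((k + 1 : ℕ) : ℤ) = m - i + k := fun k => by push_cast; ring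
  simp only [Ring.choose_succ_succ, add_smul, Finset.sum_add_distrib, add_assoc]
  congr 1
  · refine Finset.sum_congr rfl fun k _ => ?_
    rw [key', Function.iterate_succ_apply]
  · have h3 : R.coeff (m - i + K - 1) = 0 := hN _ (by omega)
    have h4 := Finset.sum_range_succ' (fun k : ℕ =>
      Ring.choose i k • (⇑d)^[k] (R.coeff (m - i + k - 1))) K
    rw [Finset.sum_range_succ, h3, iterate_map_zero, smul_zero, add_zero] at h4
    rw [h4]
    have key'' : ∀ k : ℕ, m - i + ((k + 1 : ℕ) : ℤ) - 1 = m - i + k := fun k => by push_cast; ring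
    simp only [key', key'']
    simp [show m - (i + 1) = m - i - 1 by ring]

theorem D_mul_mul (Q R : PDO d) : D * Q * R = D * (Q * R) := by
  rw [D_mul Q, PDO.add_mul', mul_D_mul, D_mul (Q * R), der_mul (fun _ => rfl), mul_mul_Dz,
    D_mul R, PDO.mul_add', add_assoc]

protected theorem one_mul' (P : PDO d) : 1 * P = P := by
  ext n; rw [← const_one, coeff_const_mul, one_mul]

protected theorem mul_one' (P : PDO d) : P * 1 = P := by
  ext n; rw [← Dz_zero, coeff_mul_Dz, sub_zero]

/-- If `D * R = 0`, then each coefficient of `R` is minus the derivative of the next higher one. As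
the high coefficients vanish, all do. -/
theorem D_mul_injective {P Q : PDO d} (h : D * P = D * Q) : P = Q := by
  have key : ∀ R : PDO d, D * R = 0 → R = 0 := fun R hR => by
    obtain ⟨N, hN⟩ := R.exists_ordLE
    have : ∀ k : ℕ, R.OrdLE (N - k) := by
      intro k
      induction k with
      | zero => simpa using hN
      | succ k ih =>
        intro n hn
        by_cases h : N - k < n
        · exact ih n h
        · have h1 := congrArg (fun T => coeff T (n + 1)) hR
          simp only [coeff_D_mul, coeff_zero, add_sub_cancel_right] at h1
          rw [ih (n + 1) (by push_cast at hn; omega), map_zero, zero_add] at h1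
          exact h1
    ext n
    exact this (N - n + 1).toNat n (by omega)
  refine sub_eq_zero.1 (key _ ?_)
  have h1 := PDO.mul_add' D (P - Q) Q
  rw [sub_add_cancel, h] at h1
  exact right_eq_add.1 h1

theorem Dinv_mul_mul (Q R : PDO d) : Dinv * Q * R = Dinv * (Q * R) := by
  have key : ∀ T : PDO d, D * (Dinv * T) = T := fun T => by
    rw [← D_mul_mul, ← Dz_one, ← Dz_neg_one, Dz_mul_Dz, add_neg_cancel, Dz_zero, PDO.one_mul']
  apply D_mul_injective
  rw [← D_mul_mul, key, key]

theorem const_mul_mul (a : A) (Q R : PDO d) : const a * Q * R = const a * (Q * R) := by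
  ext m
  rw [coeff_const_mul, coeff_mul, coeff_mul, ← AddMonoidHom.coe_mulLeft, AddMonoidHom.map_finsum]
  · refine finsum_congr fun p => ?_
    rw [coeff_const_mul, AddMonoidHom.coe_mulLeft, mul_smul_comm, mul_assoc]
  · obtain ⟨M, hM⟩ := Q.exists_ordLE
    obtain ⟨N, hN⟩ := R.exists_ordLE
    refine ((Finset.Icc (m - N) M) ×ˢ Finset.range (M + N - m + 1).toNat).finite_toSet.subset ?_
    intro p hp
    have h0 : (0 : ℤ) ≤ p.2 := Int.natCast_nonneg _
    have h1 : p.1 ≤ M := by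
      by_contra h
      exact hp (by simp [hM p.1 (by omega)])
    have h2 : m - p.1 + p.2 ≤ N := by
      by_contra h
      exact hp (by simp [hN (m - p.1 + p.2) (by omega), iterate_map_zero])
    simp only [Finset.coe_product, Set.mem_prod, Finset.mem_coe, Finset.mem_range, Finset.mem_Icc]
    omega

/-- A property of operators holds for all of them if it holds for functions, `D` and `D⁻¹`, and is
preserved by products, sums, and limits in the topology given by the order. -/
theorem induction {p : PDO d → Prop} (hc : ∀ a, p (const a)) (hD : p D) (hDinv : p Dinv)
    (hmul : ∀ P Q, p P → p Q → p (P * Q)) (hadd : ∀ P Q, p P → p Q → p (P + Q))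
    (hlim : ∀ P : PDO d, (∀ K : ℤ, ∃ P', p P' ∧ ∀ n, K ≤ n → P.coeff n = P'.coeff n) → p P)
    (P : PDO d) : p P := by
  have hDz : ∀ n : ℤ, p (Dz n) := by
    intro n
    induction n using Int.induction_on with
    | zero => exact hc 1
    | succ n ih => rw [← Dz_mul_Dz]; exact hmul _ _ ih hD
    | pred n ih => rw [sub_eq_add_neg, ← Dz_mul_Dz]; exact hmul _ _ ih hDinv
  refine hlim P fun K => ?_
  obtain ⟨N, hN⟩ := P.exists_ordLE
  refine ⟨∑ i ∈ Finset.Icc K N, monomial i (P.coeff i), ?_, fun n hn => ?_⟩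
  · refine Finset.sum_induction _ p hadd ?_ fun i _ => ?_
    · rw [← const_zero]; exact hc 0
    · rw [monomial_eq]; exact hmul _ _ (hc _) (hDz i)
  · simp only [coeff_sum, coeff_monomial, Finset.sum_ite_eq, Finset.mem_Icc]
    split_ifs with h
    · rfl
    · exact hN n (by omega)

/-- Associativity holds with a function, `D` or `D⁻¹` as left factor, and it is stable under
products, sums and limits in that factor: a given coefficient of the product depends on only
finitely many coefficients of `P`. -/
protected theorem mul_assoc' (P Q R : PDO d) : P * Q * R = P * (Q * R) := by
  revert Q R
  refine induction (p := fun P => ∀ Q R, P * Q * R = P * (Q * R)) const_mul_mul D_mul_mul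
    Dinv_mul_mul ?_ ?_ ?_ P
  · intro P P' h h' Q R
    rw [h, h, h', h]
  · intro P P' h h' Q R
    rw [PDO.add_mul', PDO.add_mul', PDO.add_mul', h, h']
  · intro P h Q R
    obtain ⟨N, hN⟩ := Q.exists_ordLE
    obtain ⟨N', hN'⟩ := R.exists_ordLE
    ext m
    obtain ⟨P', h1, h2⟩ := h (m - N' - N)
    rw [coeff_mul_congr_left (P' := P' * Q) hN', h1,
      coeff_mul_congr_left (P := P) (P' := P') (hN.mul hN')]
    · intro n hn; exact h2 n (by omega)
    · intro n hn
      exact coeff_mul_congr_left hN fun k hk => h2 k (by omega)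

noncomputable instance : Ring (PDO d) where
  __ := (inferInstance : AddCommGroup (PDO d))
  mul := (· * ·)
  one := 1
  left_distrib := PDO.mul_add'
  right_distrib := PDO.add_mul'
  zero_mul P := by
    have := PDO.add_mul' 0 0 P
    rw [add_zero] at this; exact left_eq_add.1 this
  mul_zero P := by
    have := PDO.mul_add' P 0 0
    rw [add_zero] at this; exact left_eq_add.1 this
  mul_assoc := PDO.mul_assoc'
  one_mul := PDO.one_mul'
  mul_one := PDO.mul_one'
  -- The monoid power is thereby the same operation as the power in which the Lax equations are
  -- stated.
  npow n P := P ^ n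

end PDO

namespace PDO

variable {A : Type u} [CommRing A] [Algebra ℚ A] {d : Derivation ℚ A A}

/-! ### Differential operators and operators of negative order -/

/-- `P` is a differential operator. -/
def IsDiff (P : PDO d) : Prop := ∀ n, n < 0 → P.coeff n = 0

theorem isDiff_const (a : A) : (const a : PDO d).IsDiff := fun n hn => by
  rw [coeff_const, if_neg hn.ne]

theorem isDiff_Dz {i : ℤ} (hi : 0 ≤ i) : (Dz i : PDO d).IsDiff := fun n hn => by
  rw [coeff_Dz, if_neg (by omega)]

theorem isDiff_D : (D : PDO d).IsDiff := isDiff_Dz (by norm_num)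

theorem isDiff_zero : (0 : PDO d).IsDiff := fun _ _ => rfl

theorem IsDiff.add {P Q : PDO d} (hP : P.IsDiff) (hQ : Q.IsDiff) : (P + Q).IsDiff :=
  fun n hn => by rw [coeff_add, hP n hn, hQ n hn, add_zero]

theorem IsDiff.sub {P Q : PDO d} (hP : P.IsDiff) (hQ : Q.IsDiff) : (P - Q).IsDiff :=
  fun n hn => by rw [coeff_sub, hP n hn, hQ n hn, sub_zero]

theorem IsDiff.sum {ι : Type*} {s : Finset ι} {f : ι → PDO d} (h : ∀ i ∈ s, (f i).IsDiff) :
    (∑ i ∈ s, f i).IsDiff :=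
  Finset.sum_induction _ IsDiff (fun _ _ => IsDiff.add) isDiff_zero h

/-- In negative degree `n`, the terms with `i ≥ 0` and `n - i + k ≥ 0` have `k > i`, where the
binomial coefficient vanishes. -/
theorem IsDiff.mul {P Q : PDO d} (hP : P.IsDiff) (hQ : Q.IsDiff) : (P * Q).IsDiff := fun n hn => by
  rw [coeff_mul]
  refine finsum_eq_zero_of_forall_eq_zero fun p => ?_
  by_cases h1 : p.1 < 0
  · simp [hP _ h1]
  by_cases h2 : n - p.1 + p.2 < 0
  · simp [hQ _ h2, iterate_map_zero]
  · obtain ⟨i, hi⟩ := Int.eq_ofNat_of_zero_le (not_lt.1 h1)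
    have := Ring.choose_natCast (R := ℤ) i p.2
    rw [Nat.choose_eq_zero_of_lt (by omega)] at this
    rw [hi]
    simp only [Nat.cast_zero] at this
    rw [show Ring.choose (i : ℤ) p.2 = 0 from this, zero_smul]

theorem OrdLE.add {P Q : PDO d} {M : ℤ} (hP : P.OrdLE M) (hQ : Q.OrdLE M) : (P + Q).OrdLE M :=
  fun n hn => by rw [coeff_add, hP n hn, hQ n hn, add_zero]

theorem OrdLE.neg {P : PDO d} {M : ℤ} (hP : P.OrdLE M) : (-P).OrdLE M :=
  fun n hn => by rw [coeff_neg, hP n hn, neg_zero]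

theorem OrdLE.sum {ι : Type*} {s : Finset ι} {f : ι → PDO d} {M : ℤ}
    (h : ∀ i ∈ s, (f i).OrdLE M) : (∑ i ∈ s, f i).OrdLE M :=
  Finset.sum_induction _ (fun P => OrdLE P M) (fun _ _ => OrdLE.add) (fun _ _ => rfl) h

theorem ordLE_const (a : A) : (const a : PDO d).OrdLE 0 := ordLE_monomial 0 a

theorem ordLE_Dinv : (Dinv : PDO d).OrdLE (-1) := ordLE_Dz (-1)

theorem coeff_pos (P : PDO d) (n : ℤ) : P.pos.coeff n = if 0 ≤ n then P.coeff n else 0 := rfl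

theorem coeff_negPart (P : PDO d) (n : ℤ) : P.neg.coeff n = if n < 0 then P.coeff n else 0 := rfl

theorem isDiff_pos (P : PDO d) : P.pos.IsDiff := fun n hn => by
  rw [coeff_pos, if_neg (by omega)]

theorem ordLE_neg (P : PDO d) : P.neg.OrdLE (-1) := fun n hn => by
  rw [coeff_negPart, if_neg (by omega)]

theorem pos_add_neg (P : PDO d) : P.pos + P.neg = P := by
  ext n
  rw [coeff_add, coeff_pos, coeff_negPart]
  split_ifs <;> first | omega | simp

theorem pos_add (P Q : PDO d) : (P + Q).pos = P.pos + Q.pos := by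
  ext n; simp only [coeff_add, coeff_pos]; split_ifs <;> simp

theorem pos_neg (P : PDO d) : (-P).pos = -P.pos := by
  ext n; simp only [coeff_neg, coeff_pos]; split_ifs <;> simp

theorem pos_sub (P Q : PDO d) : (P - Q).pos = P.pos - Q.pos := by
  ext n; simp only [coeff_sub, coeff_pos]; split_ifs <;> simp

theorem pos_sum {ι : Type*} (s : Finset ι) (f : ι → PDO d) :
    (∑ i ∈ s, f i).pos = ∑ i ∈ s, (f i).pos := by
  ext n; simp only [coeff_sum, coeff_pos]; split_ifs <;> simp

theorem pos_const_mul (a : A) (P : PDO d) : (const a * P).pos = const a * P.pos := by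
  ext n; simp only [coeff_const_mul, coeff_pos]; split_ifs <;> simp

theorem pos_der (δ : Derivation ℚ A A) (P : PDO d) : P.pos.der δ = (P.der δ).pos := by
  ext n; simp only [coeff_der, coeff_pos]; split_ifs <;> simp

theorem IsDiff.pos_eq {P : PDO d} (h : P.IsDiff) : P.pos = P := by
  ext n
  rw [coeff_pos]
  split_ifs with hn
  · rfl
  · exact (h n (by omega)).symm

theorem OrdLE.pos_eq {P : PDO d} (h : P.OrdLE (-1)) : P.pos = 0 := by
  ext n
  rw [coeff_pos]
  split_ifs with hn
  · exact h n (by omega)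
  · rfl

theorem isDiff_one : (1 : PDO d).IsDiff := isDiff_const 1

/-! ### Derivations acting on coefficients -/

theorem der_sub (δ : Derivation ℚ A A) (P Q : PDO d) : (P - Q).der δ = P.der δ - Q.der δ := by
  ext n; simp

theorem der_const (δ : Derivation ℚ A A) (a : A) : (const a : PDO d).der δ = const (δ a) := by
  ext n; simp only [coeff_der, coeff_const]; split_ifs <;> simp

theorem der_Dz (δ : Derivation ℚ A A) (i : ℤ) : (Dz i : PDO d).der δ = 0 := by
  ext n; simp only [coeff_der, coeff_Dz]; split_ifs <;> simp

theorem D_mul_const (a : A) : (D * const a : PDO d) = const (d a) + const a * D := by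
  rw [D_mul, der_const]; rfl

/-! ### The action on functions -/

theorem D_mul_Dinv : (D * Dinv : PDO d) = 1 := by
  rw [← Dz_one, ← Dz_neg_one, Dz_mul_Dz, add_neg_cancel, Dz_zero]

theorem Dinv_mul_D : (Dinv * D : PDO d) = 1 := by
  rw [← Dz_one, ← Dz_neg_one, Dz_mul_Dz, neg_add_cancel, Dz_zero]

/-- In degree 0 of `P ∘ f` only the terms with `i = k` survive, with binomial coefficient 1. This
turns statements on actions into computations in the ring. -/
theorem apply_eq (P : PDO d) (f : A) : P.apply f = (P * const f).coeff 0 := by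
  obtain ⟨M, hM⟩ := P.exists_ordLE
  rw [coeff_mul_eq_sum hM (ordLE_const f) 0 (M + 1).toNat (by omega) (Finset.Icc 0 M)
    (fun i h h' => Finset.mem_Icc.2 ⟨by omega, h'⟩), Finset.sum_comm, apply,
    finsum_eq_sum_of_support_subset (s := Finset.range (M + 1).toNat)]
  · refine Finset.sum_congr rfl fun k hk => ?_
    rw [Finset.mem_range] at hk
    rw [Finset.sum_eq_single (k : ℤ)]
    · have := Ring.choose_natCast (R := ℤ) k k
      rw [Nat.choose_self] at this
      rw [show Ring.choose (k : ℤ) k = 1 by simpa using this]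
      simp [coeff_const]
    · intro i _ hi
      rw [coeff_const, if_neg (by omega), iterate_map_zero, mul_zero, smul_zero]
    · intro h
      rw [Finset.mem_Icc] at h
      omega
  · intro k hk
    by_contra h
    simp only [Finset.coe_range, Set.mem_Iio] at h
    exact hk (by simp [hM k (by omega)])

theorem add_apply (P Q : PDO d) (f : A) : (P + Q).apply f = P.apply f + Q.apply f := by
  simp only [apply_eq, add_mul, coeff_add]

theorem sub_apply (P Q : PDO d) (f : A) : (P - Q).apply f = P.apply f - Q.apply f := by
  simp only [apply_eq, sub_mul, coeff_sub]

theorem neg_apply (P : PDO d) (f : A) : (-P).apply f = -P.apply f := by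
  simp only [apply_eq, neg_mul, coeff_neg]

theorem sum_apply {ι : Type*} (s : Finset ι) (P : ι → PDO d) (f : A) :
    (∑ i ∈ s, P i).apply f = ∑ i ∈ s, (P i).apply f := by
  simp only [apply_eq, Finset.sum_mul, coeff_sum]

theorem apply_sub (P : PDO d) (f g : A) : P.apply (f - g) = P.apply f - P.apply g := by
  simp only [apply_eq, const_sub, mul_sub, coeff_sub]

theorem apply_sum (P : PDO d) {ι : Type*} (s : Finset ι) (f : ι → A) :
    P.apply (∑ i ∈ s, f i) = ∑ i ∈ s, P.apply (f i) := by
  simp only [apply_eq, const_sum, Finset.mul_sum, coeff_sum]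

theorem const_mul_apply (a : A) (P : PDO d) (f : A) : (const a * P).apply f = a * P.apply f := by
  simp only [apply_eq, mul_assoc, coeff_const_mul]

theorem const_apply (a f : A) : (const a : PDO d).apply f = a * f := by
  rw [apply_eq, const_mul_const, coeff_const, if_pos rfl]

theorem one_apply (f : A) : (1 : PDO d).apply f = f := by
  rw [← const_one, const_apply, one_mul]

theorem D_apply (f : A) : (D : PDO d).apply f = d f := by
  rw [apply_eq, coeff_D_mul, coeff_const, coeff_const]; simp

theorem der_apply {δ : Derivation ℚ A A} (hδ : ∀ a, δ (d a) = d (δ a)) (P : PDO d) (f : A) :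
    δ (P.apply f) = (P.der δ).apply f + P.apply (δ f) := by
  rw [apply_eq, apply_eq, apply_eq, ← coeff_der, der_mul hδ, coeff_add, der_const]

theorem IsDiff.exists_mul_const {P : PDO d} (hP : P.IsDiff) (f : A) :
    ∃ R : PDO d, R.IsDiff ∧ P * const f = const (P.apply f) + R * D := by
  refine ⟨(P * const f - const (P.apply f)) * Dz (-1), fun n hn => ?_, ?_⟩
  · rw [coeff_mul_Dz, coeff_sub]
    rcases eq_or_ne n (-1) with rfl | h
    · rw [apply_eq, coeff_const]; simp
    · rw [hP.mul (isDiff_const f) _ (by omega), isDiff_const _ _ (by omega), sub_zero]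
  · rw [mul_assoc, ← Dz_one, Dz_mul_Dz, neg_add_cancel, Dz_zero, mul_one]; abel

theorem IsDiff.mul_D_coeff_zero {R : PDO d} (hR : R.IsDiff) : (R * D).coeff 0 = 0 := by
  rw [← Dz_one, coeff_mul_Dz]
  exact hR _ (by norm_num)

/-- Since `Q f = Q(f) + R D` with `R` differential, `P Q f` differs from `P Q(f)` by `P R D`, which
has no term of degree 0. -/
theorem mul_apply {P Q : PDO d} (hP : P.IsDiff) (hQ : Q.IsDiff) (f : A) :
    (P * Q).apply f = P.apply (Q.apply f) := by
  obtain ⟨R, hR, h⟩ := hQ.exists_mul_const f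
  rw [apply_eq, apply_eq P, mul_assoc, h, mul_add, coeff_add, ← mul_assoc,
    (hP.mul hR).mul_D_coeff_zero, add_zero]

/-! ### The formal adjoint -/

theorem coeff_adjoint (P : PDO d) (m : ℤ) : P.adjoint.coeff m = ∑ᶠ k : ℕ,
    ((Int.negOnePow (m + k) : ℤ) * Ring.choose (m + k : ℤ) k) • (⇑d)^[k] (P.coeff (m + k)) := rfl

theorem coeff_adjoint_eq_sum {P : PDO d} {N : ℤ} (hP : P.OrdLE N) (m : ℤ) (K : ℕ)
    (hK : N - m < K) : P.adjoint.coeff m = ∑ k ∈ Finset.range K,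
      ((Int.negOnePow (m + k) : ℤ) * Ring.choose (m + k : ℤ) k) •
        (⇑d)^[k] (P.coeff (m + k)) := by
  rw [coeff_adjoint, finsum_eq_sum_of_support_subset]
  intro k hk
  by_contra h
  simp only [Finset.coe_range, Set.mem_Iio] at h
  exact hk (by simp [hP (m + k) (by omega), iterate_map_zero])

theorem OrdLE.adjoint {P : PDO d} {N : ℤ} (hP : P.OrdLE N) : P.adjoint.OrdLE N := fun m hm => by
  rw [coeff_adjoint_eq_sum hP m 0 (by push_cast; omega)]; simp

theorem coeff_adjoint_congr {P P' : PDO d} {m : ℤ} (h : ∀ n, m ≤ n → P.coeff n = P'.coeff n) :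
    P.adjoint.coeff m = P'.adjoint.coeff m := by
  rw [coeff_adjoint, coeff_adjoint]
  exact finsum_congr fun k => by rw [h _ (by omega)]

theorem adjoint_add (P Q : PDO d) : (P + Q).adjoint = P.adjoint + Q.adjoint := by
  obtain ⟨N, hN⟩ := P.exists_ordLE
  obtain ⟨N', hN'⟩ := Q.exists_ordLE
  have h1 : P.OrdLE (max N N') := hN.mono (le_max_left _ _)
  have h2 : Q.OrdLE (max N N') := hN'.mono (le_max_right _ _)
  ext m
  obtain ⟨K, hK⟩ : ∃ K : ℕ, max N N' - m < K := ⟨(max N N' - m + 1).toNat, by omega⟩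
  rw [coeff_add, coeff_adjoint_eq_sum h1 m K hK, coeff_adjoint_eq_sum h2 m K hK,
    coeff_adjoint_eq_sum (h1.add h2) m K hK, ← Finset.sum_add_distrib]
  simp only [coeff_add, iterate_map_add, smul_add]

theorem IsDiff.adjoint {P : PDO d} (hP : P.IsDiff) : P.adjoint.IsDiff := fun m hm => by
  rw [coeff_adjoint]
  refine finsum_eq_zero_of_forall_eq_zero fun k => ?_
  by_cases h : m + k < 0
  · rw [hP _ h, iterate_map_zero, smul_zero]
  · obtain ⟨i, hi⟩ := Int.eq_ofNat_of_zero_le (not_lt.1 h)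
    have := Ring.choose_natCast (R := ℤ) i k
    rw [Nat.choose_eq_zero_of_lt (by omega), Nat.cast_zero] at this
    rw [hi, this, mul_zero, zero_smul]

/-- The adjoint preserves differential operators as well as operators of negative order. The adjoint
eigenfunction equation can thus be stated with the adjoint of `(Lⁿ)₊`. -/
theorem pos_adjoint (P : PDO d) : P.adjoint.pos = P.pos.adjoint := by
  conv_lhs => rw [← pos_add_neg P]
  rw [adjoint_add, pos_add, P.isDiff_pos.adjoint.pos_eq, P.ordLE_neg.adjoint.pos_eq, add_zero]

/-- The defining series is the Leibniz expansion of `(-1)ⁱ Dⁱ ∘ b`; in this form adjoints are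
accessible to ring identities. -/
theorem adjoint_monomial (i : ℤ) (b : A) :
    (monomial i b : PDO d).adjoint = const ((Int.negOnePow i : ℤ) : A) * (Dz i * const b) := by
  ext m
  rw [coeff_const_mul, coeff_adjoint, coeff_mul]
  by_cases hm : m ≤ i
  · obtain ⟨k, hk⟩ := Int.eq_ofNat_of_zero_le (sub_nonneg.2 hm)
    rw [finsum_eq_single _ k, finsum_eq_single _ (i, k)]
    · have h1 : m + (k : ℤ) = i := by omega
      have h2 : m - i + (k : ℤ) = 0 := by omega
      simp only [h1, h2, coeff_monomial, coeff_const, coeff_Dz, if_true, one_mul, zsmul_eq_mul]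
      push_cast
      ring
    · rintro ⟨j, l⟩ h
      rcases eq_or_ne j i with rfl | hj
      · have : l ≠ k := by rintro rfl; exact h rfl
        rw [coeff_const, if_neg (by dsimp only; omega), iterate_map_zero, mul_zero, smul_zero]
      · rw [coeff_Dz, if_neg hj, zero_mul, smul_zero]
    · intro l hl
      rw [coeff_monomial, if_neg (by omega), iterate_map_zero, smul_zero]
  · rw [finsum_eq_zero_of_forall_eq_zero, finsum_eq_zero_of_forall_eq_zero, mul_zero]
    · rintro ⟨j, l⟩
      rcases eq_or_ne j i with rfl | hj
      · rw [coeff_const, if_neg (by dsimp only; omega), iterate_map_zero, mul_zero, smul_zero]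
      · rw [coeff_Dz, if_neg hj, zero_mul, smul_zero]
    · intro l
      rw [coeff_monomial, if_neg (by omega), iterate_map_zero, smul_zero]

theorem adjoint_const (a : A) : (const a : PDO d).adjoint = const a := by
  have := adjoint_monomial (d := d) 0 a
  rw [Dz_zero, one_mul] at this
  rw [Int.negOnePow_zero, Units.val_one, Int.cast_one, const_one, one_mul] at this
  exact this

theorem coeff_sum_monomial (P : PDO d) {K N : ℤ} (hN : P.OrdLE N) {n : ℤ} (hn : K ≤ n) :
    (∑ i ∈ Finset.Icc K N, monomial i (P.coeff i) : PDO d).coeff n = P.coeff n := by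
  simp only [coeff_sum, coeff_monomial, Finset.sum_ite_eq, Finset.mem_Icc]
  split_ifs with h
  · rfl
  · exact (hN n (by omega)).symm

theorem adjoint_const_mul (a : A) (Q : PDO d) : (const a * Q).adjoint = Q.adjoint * const a := by
  have hmon : ∀ i b, (const a * monomial i b : PDO d).adjoint =
      (monomial i b).adjoint * const a := fun i b => by
    rw [monomial_eq, ← mul_assoc, const_mul_const, ← monomial_eq, ← monomial_eq, adjoint_monomial,
      adjoint_monomial, mul_comm a b, ← const_mul_const]
    simp only [mul_assoc]
  have hsum : ∀ s : Finset ℤ, ∀ f : ℤ → A, (const a * ∑ i ∈ s, monomial i (f i) : PDO d).adjoint =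
      (∑ i ∈ s, monomial i (f i)).adjoint * const a := fun s f => by
    induction s using Finset.induction_on with
    | empty =>
      have : (0 : PDO d).adjoint = 0 := by
        rw [← const_zero, adjoint_const]
      simp [this]
    | insert i s hi ih =>
      rw [Finset.sum_insert hi, mul_add, adjoint_add, hmon, ih, adjoint_add, add_mul]
  ext m
  obtain ⟨N, hN⟩ := Q.exists_ordLE
  rw [coeff_adjoint_congr (P' := const a * ∑ i ∈ Finset.Icc m N, monomial i (Q.coeff i)), hsum]
  · refine coeff_mul_congr_left (ordLE_const a) fun n hn => coeff_adjoint_congr fun k hk => ?_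
    exact coeff_sum_monomial Q hN (by omega)
  · intro n hn
    rw [coeff_const_mul, coeff_const_mul, coeff_sum_monomial Q hN hn]

theorem adjoint_D_mul (Q : PDO d) : (D * Q).adjoint = -(Q.adjoint * D) := by
  obtain ⟨N, hN⟩ := Q.exists_ordLE
  ext m
  obtain ⟨K, hK⟩ : ∃ K : ℕ, N + 1 - m < K := ⟨(N + 1 - m + 1).toNat, by omega⟩
  have h1 : (D * Q).OrdLE (1 + N) := (ordLE_Dz 1).mul hN
  rw [coeff_neg, ← Dz_one, coeff_mul_Dz, Dz_one,
    coeff_adjoint_eq_sum h1 m (K + 1) (by push_cast; omega),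
    coeff_adjoint_eq_sum hN (m - 1) (K + 1) (by push_cast; omega)]
  have h3 : Q.coeff (m + K) = 0 := hN _ (by omega)
  simp only [coeff_D_mul, iterate_map_add, smul_add, Finset.sum_add_distrib]
  rw [Finset.sum_range_succ, h3, map_zero, iterate_map_zero, smul_zero, add_zero,
    Finset.sum_range_succ' _ K, Finset.sum_range_succ' _ K, neg_add, ← Finset.sum_neg_distrib,
    ← add_assoc, ← Finset.sum_add_distrib]
  have e1 : ∀ k : ℕ, m + ((k + 1 : ℕ) : ℤ) = m + k + 1 := fun k => by push_cast; ring
  have e2 : ∀ k : ℕ, m - 1 + ((k + 1 : ℕ) : ℤ) = m + k := fun k => by push_cast; ring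
  have e3 : ∀ k : ℕ, m + (k : ℤ) + 1 - 1 = m + k := fun k => by ring
  congr 1
  · refine Finset.sum_congr rfl fun k _ => ?_
    rw [e1, e2, e3, Int.negOnePow_succ, Ring.choose_succ_succ, Function.iterate_succ_apply,
      ← add_smul, ← neg_smul]
    congr 1
    push_cast
    ring
  · have : (m - 1).negOnePow = -m.negOnePow := by
      rw [← neg_eq_iff_eq_neg, ← Int.negOnePow_succ, sub_add_cancel]
    simp [this]

/-- Same principle as for associativity: the rule is checked for a left factor `a`, `D` or `D⁻¹`,
and extended by products, sums and limits. -/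
theorem adjoint_mul (P Q : PDO d) : (P * Q).adjoint = Q.adjoint * P.adjoint := by
  have hone : (1 : PDO d).adjoint = 1 := adjoint_const 1
  have hD : (D : PDO d).adjoint = -D := by
    have := adjoint_D_mul (1 : PDO d)
    rwa [hone, mul_one, one_mul] at this
  have hDinv : ∀ Q : PDO d, (Dinv * Q).adjoint = -(Q.adjoint * Dinv) := fun Q => by
    have := adjoint_D_mul (Dinv * Q)
    rw [← mul_assoc, D_mul_Dinv, one_mul] at this
    rw [this, neg_mul, mul_assoc, D_mul_Dinv, mul_one, neg_neg]
  revert Q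
  refine induction (p := fun P => ∀ Q, (P * Q).adjoint = Q.adjoint * P.adjoint) ?_ ?_ ?_ ?_ ?_ ?_ P
  · intro a Q
    rw [adjoint_const_mul, adjoint_const]
  · intro Q
    rw [adjoint_D_mul, hD, mul_neg]
  · intro Q
    have := hDinv 1
    rw [hone, mul_one, one_mul] at this
    rw [hDinv, this, mul_neg]
  · intro P P' h h' Q
    rw [mul_assoc, h, h', mul_assoc, ← h]
  · intro P P' h h' Q
    rw [add_mul, adjoint_add, h, h', adjoint_add, mul_add]
  · intro P h Q
    obtain ⟨N, hN⟩ := Q.exists_ordLE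
    ext m
    obtain ⟨P', h1, h2⟩ := h (m - N)
    rw [coeff_adjoint_congr (P' := P' * Q), h1]
    · exact coeff_mul_congr_right hN.adjoint fun n hn =>
        coeff_adjoint_congr fun k hk => (h2 k (by omega)).symm
    · intro n hn
      exact coeff_mul_congr_left hN fun k hk => h2 k (by omega)

theorem adjoint_pow (P : PDO d) (n : ℕ) : (P ^ n).adjoint = P.adjoint ^ n := by
  induction n with
  | zero => rw [pow_zero, pow_zero]; exact adjoint_const 1
  | succ n ih => rw [pow_succ, adjoint_mul, ih, pow_succ']

theorem adjoint_D : (D : PDO d).adjoint = -D := by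
  have := adjoint_D_mul (1 : PDO d)
  rwa [show (1 : PDO d).adjoint = 1 from adjoint_const 1, mul_one, one_mul] at this

/-! ### Inverses -/

theorem OrdLE.pow {P : PDO d} {M : ℤ} (h : P.OrdLE M) (k : ℕ) : (P ^ k).OrdLE (k * M) := by
  induction k with
  | zero => rw [pow_zero, Nat.cast_zero, zero_mul]; exact ordLE_Dz 0
  | succ k ih =>
    rw [pow_succ, Nat.cast_succ, add_mul, one_mul]
    exact ih.mul h

theorem exists_inverse {W : PDO d} (h0 : W.coeff 0 = 1) (h : W.OrdLE 0) :
    ∃ V : PDO d, V.OrdLE 0 ∧ V.coeff 0 = 1 ∧ V * W = 1 ∧ W * V = 1 := by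
  obtain ⟨N, hN⟩ : ∃ N, N = 1 - W := ⟨_, rfl⟩
  have hN1 : N.OrdLE (-1) := fun n hn => by
    rw [hN, coeff_sub, coeff_one]
    split_ifs with h1
    · rw [h1, h0, sub_self]
    · rw [h n (by omega), sub_zero]
  have hpow : ∀ k : ℕ, (N ^ k).OrdLE (-k) := fun k => (hN1.pow k).mono (by simp)
  -- The geometric series `∑ Nᵏ`. Since `Nᵏ` has order at most `-k`, only `k ≤ -n` contributes to
  -- degree `n`.
  let V : PDO d := ⟨fun n => (∑ k ∈ Finset.range ((-n).toNat + 1), N ^ k).coeff n, 0,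
    fun n hn => by
      beta_reduce
      rw [show (-n).toNat = 0 by omega]
      simp [coeff_one, hn.ne']⟩
  have hV : ∀ (K : ℕ) (n : ℤ), 0 < K → -(K : ℤ) < n → V.coeff n = (∑ k ∈ Finset.range K, N ^ k).coeff n := by
    intro K n hK hn
    show (∑ k ∈ Finset.range ((-n).toNat + 1), N ^ k).coeff n = _
    simp only [coeff_sum]
    refine Finset.sum_subset_zero_on_sdiff (fun k hk => ?_) (fun k hk => ?_) fun _ _ => rfl
    · simp only [Finset.mem_range] at hk ⊢
      omega
    · simp only [Finset.mem_sdiff, Finset.mem_range] at hk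
      exact hpow k n (by omega)
  have hV0 : V.OrdLE 0 := fun n hn => by
    show (∑ k ∈ Finset.range ((-n).toNat + 1), N ^ k).coeff n = 0
    rw [show (-n).toNat = 0 by omega]
    simp [coeff_one, hn.ne']
  have hW : W = 1 - N := by rw [hN, sub_sub_cancel]
  refine ⟨V, hV0, ?_, ?_, ?_⟩
  · rw [hV 1 0 one_pos (by norm_num)]; simp [coeff_one]
  · ext m
    obtain ⟨K, hK⟩ : ∃ K : ℕ, -(K : ℤ) < m := ⟨(-m).toNat + 1, by omega⟩
    rw [coeff_mul_congr_left h (P' := ∑ k ∈ Finset.range (K + 1), N ^ k) fun n hn => hV (K + 1) n K.succ_pos (by push_cast; omega),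
      hW, geom_sum_mul_neg, coeff_sub, hpow (K + 1) m (by push_cast; omega), sub_zero]
  · ext m
    obtain ⟨K, hK⟩ : ∃ K : ℕ, -(K : ℤ) < m := ⟨(-m).toNat + 1, by omega⟩
    rw [coeff_mul_congr_right h (Q' := ∑ k ∈ Finset.range (K + 1), N ^ k) fun n hn => hV (K + 1) n K.succ_pos (by push_cast; omega),
      hW, mul_neg_geom_sum, coeff_sub, hpow (K + 1) m (by push_cast; omega), sub_zero]

/-! ### Expansions -/

theorem coeff_mul_eq_sum_left {P Q : PDO d} {M N : ℤ} (hP : P.OrdLE M) (hQ : Q.OrdLE N) (n : ℤ) :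
    (P * Q).coeff n = ∑ i ∈ Finset.Icc (n - N) M, P.coeff i * (Dz i * Q).coeff n := by
  rw [coeff_mul_congr_left (P' := ∑ i ∈ Finset.Icc (n - N) M, monomial i (P.coeff i)) hQ
    fun k hk => (coeff_sum_monomial P hP hk).symm, Finset.sum_mul, coeff_sum]
  exact Finset.sum_congr rfl fun i _ => by rw [monomial_eq, mul_assoc, coeff_const_mul]

theorem coeff_mul_top {P Q : PDO d} {M N : ℤ} (hP : P.OrdLE M) (hQ : Q.OrdLE N) :
    (P * Q).coeff (M + N) = P.coeff M * Q.coeff N := by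
  rw [coeff_mul_eq_sum hP hQ (M + N) 1 (by push_cast; omega) {M}
    (fun i h h' => Finset.mem_singleton.2 (by omega))]
  simp

theorem pos_eq_sum {P : PDO d} {K : ℕ} (hP : P.OrdLE K) :
    P.pos = ∑ i ∈ Finset.range (K + 1), const (P.coeff i) * Dz i := by
  ext n
  simp only [coeff_pos, coeff_sum, coeff_const_mul, coeff_Dz]
  split_ifs with hn
  · lift n to ℕ using hn
    by_cases h : n < K + 1
    · rw [Finset.sum_eq_single n]
      · simp
      · intro b _ hb
        rw [if_neg (by exact_mod_cast hb.symm), mul_zero]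
      · intro h'
        exact absurd (Finset.mem_range.2 h) h'
    · rw [hP n (by omega), Finset.sum_eq_zero]
      intro i hi
      rw [Finset.mem_range] at hi
      rw [if_neg (by omega), mul_zero]
  · refine (Finset.sum_eq_zero fun i _ => ?_).symm
    rw [if_neg (by omega), mul_zero]

theorem pos_mul_eq_sum {R V : PDO d} {K : ℕ} (hR : R.OrdLE K) (hV : V.OrdLE 0) :
    (R * V).pos = ∑ i ∈ Finset.range (K + 1), const (R.coeff i) * (Dz i * V).pos := by
  conv_lhs => rw [← pos_add_neg R]
  rw [add_mul, pos_add, OrdLE.pos_eq ((R.ordLE_neg.mul hV).mono (by norm_num)), add_zero,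
    pos_eq_sum hR, Finset.sum_mul, pos_sum]
  exact Finset.sum_congr rfl fun i _ => by rw [mul_assoc, pos_const_mul]

/-- The operator `∑ₘ f m D ^ (-m)`. -/
def ofSeq (f : ℕ → A) : PDO d :=
  ⟨fun n => if n ≤ 0 then f (-n).toNat else 0, 0, fun _ hn => if_neg (by omega)⟩

theorem coeff_ofSeq (f : ℕ → A) (n : ℤ) :
    (ofSeq f : PDO d).coeff n = if n ≤ 0 then f (-n).toNat else 0 := rfl

@[simp] theorem coeff_ofSeq_neg (f : ℕ → A) (m : ℕ) : (ofSeq f : PDO d).coeff (-m) = f m := by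
  rw [coeff_ofSeq, if_pos (by omega)]; simp

theorem ordLE_ofSeq (f : ℕ → A) : (ofSeq f : PDO d).OrdLE 0 := fun n hn => by
  rw [coeff_ofSeq, if_neg (by omega)]

theorem eq_ofSeq {P : PDO d} (h : P.OrdLE 0) : P = ofSeq fun m : ℕ => P.coeff (-m) := by
  ext n
  rw [coeff_ofSeq]
  split_ifs with hn
  · congr 1; omega
  · exact h n (by omega)

theorem der_ofSeq (δ : Derivation ℚ A A) (f : ℕ → A) :
    (ofSeq f : PDO d).der δ = ofSeq fun m => δ (f m) := by
  ext n; simp only [coeff_der, coeff_ofSeq]; split_ifs <;> simp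

theorem ofSeq_add (f g : ℕ → A) : (ofSeq (fun m => f m + g m) : PDO d) = ofSeq f + ofSeq g := by
  ext n; simp only [coeff_add, coeff_ofSeq]; split_ifs <;> simp

theorem ofSeq_sub (f g : ℕ → A) : (ofSeq (fun m => f m - g m) : PDO d) = ofSeq f - ofSeq g := by
  ext n; simp only [coeff_sub, coeff_ofSeq]; split_ifs <;> simp

theorem ofSeq_sum {ι : Type*} (s : Finset ι) (f : ι → ℕ → A) :
    (ofSeq (fun m => ∑ i ∈ s, f i m) : PDO d) = ∑ i ∈ s, ofSeq (f i) := by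
  ext n; simp only [coeff_sum, coeff_ofSeq]; split_ifs <;> simp

theorem ofSeq_mul (a : A) (f : ℕ → A) :
    (ofSeq (fun m => a * f m) : PDO d) = const a * ofSeq f := by
  ext n; simp only [coeff_const_mul, coeff_ofSeq]; split_ifs <;> simp

/-- Splits the shifted series into its terms of degree at most 0 and those of positive degree. -/
theorem ofSeq_mul_Dz (f : ℕ → A) (s : ℕ) : (ofSeq f * Dz (s + 1) : PDO d) =
    ofSeq (fun m => f (m + s + 1)) +
      ∑ p ∈ Finset.HasAntidiagonal.antidiagonal s, const (f p.1) * Dz (p.2 + 1) := by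
  ext n
  simp only [coeff_mul_Dz, coeff_add, coeff_ofSeq, coeff_sum, coeff_const]
  by_cases hn : n ≤ 0
  · rw [if_pos (by omega), if_pos hn, Finset.sum_eq_zero, add_zero]
    · congr 1; omega
    · intro p _
      rw [if_neg (by omega)]
  · rw [if_neg hn, zero_add]
    split_ifs with h
    · rw [Finset.sum_eq_single ((-(n - (s + 1))).toNat, (n - 1).toNat)]
      · rw [if_pos (by dsimp only; omega)]
      · rintro ⟨a, b⟩ hp hne
        rw [Finset.HasAntidiagonal.mem_antidiagonal] at hp
        dsimp only at hp ⊢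
        rw [if_neg]
        intro h'
        exact hne (by ext <;> dsimp only <;> omega)
      · intro h'
        rw [Finset.HasAntidiagonal.mem_antidiagonal] at h'
        exact absurd (by dsimp only; omega) h'
    · refine (Finset.sum_eq_zero ?_).symm
      rintro ⟨a, b⟩ hp
      rw [Finset.HasAntidiagonal.mem_antidiagonal] at hp
      dsimp only at hp ⊢
      rw [if_neg (by omega)]

end PDO

/-! ### Gaussian elimination and derivations. -/

section Elimination

variable {A : Type u} [CommRing A]

/-- Gaussian elimination: `schur m n` is the array `m` after clearing the columns below `n` with the
rows below `n`. -/
noncomputable def schur (m : ℕ → ℕ → A) : ℕ → ℕ → ℕ → A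
  | 0 => m
  | n + 1 => fun k j => schur m n k j -
      schur m n k n * Ring.inverse (schur m n n n) * schur m n n j

/-- The multiple of the `n`-th pivot row which is subtracted from row `k` in the elimination. -/
noncomputable def schurCoeff (m : ℕ → ℕ → A) (n k : ℕ) : A :=
  schur m n k n * Ring.inverse (schur m n n n)

theorem schur_succ (m : ℕ → ℕ → A) (n k j : ℕ) :
    schur m (n + 1) k j = schur m n k j - schurCoeff m n k * schur m n n j := rfl

theorem schurCoeff_mul (m : ℕ → ℕ → A) {n : ℕ} (h : IsUnit (schur m n n n)) (k : ℕ) :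
    schurCoeff m n k * schur m n n n = schur m n k n := by
  rw [schurCoeff, mul_assoc, Ring.inverse_mul_cancel _ h, mul_one]

theorem schurCoeff_self (m : ℕ → ℕ → A) {n : ℕ} (h : IsUnit (schur m n n n)) :
    schurCoeff m n n = 1 := Ring.mul_inverse_cancel _ h

theorem schur_column (m : ℕ → ℕ → A) {n : ℕ} (h : ∀ l < n, IsUnit (schur m l l l)) (k : ℕ) {j : ℕ}
    (hj : j < n) : schur m n k j = 0 := by
  induction n generalizing k with
  | zero => omega
  | succ n ih =>
    rw [schur_succ]
    rcases Nat.lt_succ_iff_lt_or_eq.1 hj with h1 | rfl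
    · rw [ih (fun l hl => h l (by omega)) k h1, ih (fun l hl => h l (by omega)) n h1]; simp
    · rw [schurCoeff_mul m (h j hj), sub_self]

theorem schur_row (m : ℕ → ℕ → A) {n : ℕ} (h : ∀ l < n, IsUnit (schur m l l l)) {k : ℕ} (j : ℕ)
    (hk : k < n) : schur m n k j = 0 := by
  induction n generalizing j with
  | zero => omega
  | succ n ih =>
    rw [schur_succ]
    rcases Nat.lt_succ_iff_lt_or_eq.1 hk with h1 | rfl
    · have h2 := ih (fun l hl => h l (by omega))
      rw [schurCoeff, h2 _ h1, h2 _ h1]; simp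
    · rw [schurCoeff_self m (h k hk), one_mul, sub_self]

theorem eq_sum_schur (m : ℕ → ℕ → A) (n k j : ℕ) :
    m k j = ∑ l ∈ Finset.range n, schurCoeff m l k * schur m l l j + schur m n k j := by
  induction n with
  | zero => simp [schur]
  | succ n ih => rw [Finset.sum_range_succ, schur_succ]; linear_combination ih

/-- This is the LU factorisation: the columns of the lower triangular factor are the pivot rows, and
the multipliers form a unipotent upper triangular one. Row `k` takes the place of row `n`. -/
theorem det_schur (m : ℕ → ℕ → A) {n : ℕ} (h : ∀ l < n, IsUnit (schur m l l l)) (k : ℕ) :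
    Matrix.det (Matrix.of fun α β : Fin (n + 1) => m (if (β : ℕ) < n then β else k) α) =
      (∏ l ∈ Finset.range n, schur m l l l) * schur m n k n := by
  let U : Matrix (Fin (n + 1)) (Fin (n + 1)) A :=
    Matrix.of fun α l => schur m l (if (l : ℕ) < n then l else k) α
  let V : Matrix (Fin (n + 1)) (Fin (n + 1)) A :=
    Matrix.of fun l β => if (β : ℕ) < n then schurCoeff m l β else
      if (l : ℕ) < n then schurCoeff m l k else 1
  have hzero : ∀ l b : ℕ, l ≤ n → b < l → schurCoeff m l b = 0 := fun l b hl hb => by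
    rw [schurCoeff, schur_row m (fun i hi => h i (by omega)) l hb, zero_mul]
  have hM : (Matrix.of fun α β : Fin (n + 1) => m (if (β : ℕ) < n then β else k) α) = U * V := by
    ext α β
    rw [Matrix.mul_apply, Fin.sum_univ_castSucc]
    simp only [U, V, Matrix.of_apply, Fin.val_castSucc, Fin.is_lt, if_true, Fin.val_last, lt_irrefl,
      if_false]
    rw [Fin.sum_univ_eq_sum_range (fun l => schur m l l α *
      if (β : ℕ) < n then schurCoeff m l β else schurCoeff m l k)]
    split_ifs with hβ
    · rw [hzero n β le_rfl hβ, mul_zero, add_zero, eq_sum_schur m n β α, schur_row m h _ hβ, add_zero]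
      exact Finset.sum_congr rfl fun l _ => mul_comm _ _
    · rw [mul_one, eq_sum_schur m n k α]
      congr 1
      exact Finset.sum_congr rfl fun l _ => mul_comm _ _
  have hU : U.det = (∏ l ∈ Finset.range n, schur m l l l) * schur m n k n := by
    rw [Matrix.det_of_isLowerTriangular, Fin.prod_univ_castSucc]
    · simp only [U, Matrix.of_apply, Fin.val_castSucc, Fin.is_lt, if_true, Fin.val_last, lt_irrefl,
        if_false]
      rw [Fin.prod_univ_eq_prod_range (fun l => schur m l l l)]
    · intro i j hij
      have : i < j := hij
      exact schur_column m (fun l hl => h l (by omega)) _ this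
  have hV : V.det = 1 := by
    rw [Matrix.det_of_isUpperTriangular]
    · refine Finset.prod_eq_one fun i _ => ?_
      simp only [V, Matrix.of_apply]
      split_ifs with h1
      · exact schurCoeff_self m (h i h1)
      · rfl
    · intro i j hij
      have h1 : j < i := hij
      have h2 : (j : ℕ) < n := by omega
      simp only [V, Matrix.of_apply, if_pos h2]
      exact hzero i j (by omega) h1
  rw [hM, Matrix.det_mul, hU, hV, mul_one]

/-- Elimination commutes with upper triangular column operations. -/
theorem schur_mul_upper {m m' U : ℕ → ℕ → A} (hp : ∀ n, IsUnit (schur m n n n))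
    (hU : ∀ n, IsUnit (U n n))
    (hm : ∀ k j, m' k j = ∑ i ∈ Finset.range (j + 1), m k i * U i j) (n k j : ℕ) :
    schur m' n k j = ∑ i ∈ Finset.range (j + 1), schur m n k i * U i j := by
  induction n generalizing k j with
  | zero => exact hm k j
  | succ n ih =>
    have h1 : ∀ k, schur m' n k n = schur m n k n * U n n := fun k => by
      rw [ih, Finset.sum_range_succ, Finset.sum_eq_zero, zero_add]
      intro i hi
      rw [schur_column m (fun l _ => hp l) k (Finset.mem_range.1 hi), zero_mul]
    have h2 : schurCoeff m' n k = schurCoeff m n k := by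
      rw [schurCoeff, h1, h1, Ring.mul_inverse_rev, schurCoeff]
      linear_combination (schur m n k n * Ring.inverse (schur m n n n)) *
        Ring.mul_inverse_cancel _ (hU n)
    rw [schur_succ, ih, ih, h2, Finset.mul_sum, ← Finset.sum_sub_distrib]
    refine Finset.sum_congr rfl fun i _ => ?_
    rw [schur_succ]; ring

theorem schur_mul_upper_self {m m' U : ℕ → ℕ → A} (hp : ∀ n, IsUnit (schur m n n n))
    (hU : ∀ n, IsUnit (U n n))
    (hm : ∀ k j, m' k j = ∑ i ∈ Finset.range (j + 1), m k i * U i j) (n k : ℕ) :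
    schur m' n k n = schur m n k n * U n n := by
  rw [schur_mul_upper hp hU hm, Finset.sum_range_succ, Finset.sum_eq_zero, zero_add]
  intro i hi
  rw [schur_column m (fun l _ => hp l) k (Finset.mem_range.1 hi), zero_mul]

/-- The entry in column `n` and the pivot are both scaled by `U n n`, so the multiplier is
unchanged. -/
theorem schurCoeff_mul_upper {m m' U : ℕ → ℕ → A} (hp : ∀ n, IsUnit (schur m n n n))
    (hU : ∀ n, IsUnit (U n n))
    (hm : ∀ k j, m' k j = ∑ i ∈ Finset.range (j + 1), m k i * U i j) (n k : ℕ) :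
    schurCoeff m' n k = schurCoeff m n k := by
  rw [schurCoeff, schur_mul_upper_self hp hU hm, schur_mul_upper_self hp hU hm,
    Ring.mul_inverse_rev, schurCoeff]
  linear_combination (schur m n k n * Ring.inverse (schur m n n n)) *
    Ring.mul_inverse_cancel _ (hU n)

theorem sum_fin_ite_le (n : ℕ) (j : Fin n) (F : ℕ → A) :
    ∑ i : Fin n, (if (i : ℕ) ≤ j then F i else 0) = ∑ i ∈ Finset.range (j + 1), F i := by
  rw [Fin.sum_univ_eq_sum_range (fun i => if i ≤ (j : ℕ) then F i else 0), ← Finset.sum_filter]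
  refine Finset.sum_congr ?_ fun _ _ => rfl
  ext i
  simp only [Finset.mem_filter, Finset.mem_range]
  omega

theorem det_mul_upper {m m' U : ℕ → ℕ → A}
    (hm : ∀ k j, m' k j = ∑ i ∈ Finset.range (j + 1), m k i * U i j) (n : ℕ) :
    Matrix.det (Matrix.of fun k j : Fin n => m' k j) =
      Matrix.det (Matrix.of fun k j : Fin n => m k j) * ∏ i ∈ Finset.range n, U i i := by
  let V : Matrix (Fin n) (Fin n) A := Matrix.of fun i j => if (i : ℕ) ≤ j then U i j else 0
  have h1 : (Matrix.of fun k j : Fin n => m' k j) = (Matrix.of fun k j : Fin n => m k j) * V := by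
    ext k j
    simp only [V, Matrix.mul_apply, Matrix.of_apply, mul_ite, mul_zero]
    rw [hm, sum_fin_ite_le n j fun i => m k i * U i j]
  rw [h1, Matrix.det_mul, Matrix.det_of_isUpperTriangular (M := V)]
  · simp only [V, Matrix.of_apply, le_refl, if_true]
    rw [Fin.prod_univ_eq_prod_range (fun i => U i i)]
  · intro i j hij
    have : j < i := hij
    exact if_neg (by omega)

variable [Algebra ℚ A]

/-- Elimination in an array whose rows are shifted by a derivation, up to multiples of the first
row. -/
theorem derivation_schur_of_row {m : ℕ → ℕ → A} (hp : ∀ n, IsUnit (schur m n n n))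
    {δ : Derivation ℚ A A} {s : ℕ → A} (h : ∀ k j, δ (m k j) = m (k + 1) j + s k * m 0 j)
    (n k j : ℕ) : δ (schur m (n + 1) k j) =
      schur m (n + 1) (k + 1) j - schurCoeff m n k * schur m (n + 1) (n + 1) j := by
  have step : ∀ n, (∃ t : ℕ → A, ∀ k j, δ (schur m n k j) =
      schur m n (k + 1) j + t k * schur m n n j) → ∀ k j, δ (schur m (n + 1) k j) =
      schur m (n + 1) (k + 1) j - schurCoeff m n k * schur m (n + 1) (n + 1) j := by
    rintro n ⟨t, ht⟩ k j
    obtain ⟨z, hz⟩ : ∃ z, ∀ j, δ (schur m (n + 1) k j) = schur m (n + 1) (k + 1) j -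
        schurCoeff m n k * schur m (n + 1) (n + 1) j + z * schur m n n j := by
      refine ⟨schurCoeff m n (k + 1) + t k - δ (schurCoeff m n k) -
        schurCoeff m n k * (schurCoeff m n (n + 1) + t n), fun j => ?_⟩
      simp only [schur_succ, map_sub, Derivation.leibniz, ht, smul_eq_mul]
      ring
    -- The unknown `z` multiplies the pivot row `n`. In column `n`, which has been cleared, every
    -- other term vanishes, so `z` times an invertible pivot is 0.
    have h0 := hz n
    have hc : ∀ k, schur m (n + 1) k n = 0 := fun k =>
      schur_column m (fun l _ => hp l) k n.lt_succ_self
    simp only [hc, map_zero, mul_zero, sub_zero, zero_add] at h0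
    rw [hz, (hp n).mul_left_eq_zero.1 h0.symm, zero_mul, add_zero]
  refine step n ?_ k j
  clear k j
  induction n with
  | zero => exact ⟨s, h⟩
  | succ n ih => exact ⟨fun k => -schurCoeff m n k, fun k j => by rw [step n ih]; ring⟩

/-- Elimination in an array whose columns are shifted by a derivation. -/
theorem derivation_schurCoeff_of_column {m : ℕ → ℕ → A} (hp : ∀ n, IsUnit (schur m n n n))
    {δ : Derivation ℚ A A} (h : ∀ k j, δ (m k j) = m k (j + 1)) (n k : ℕ) :
    δ (schurCoeff m n k) = schur m (n + 1) (n + 1) (n + 1) * Ring.inverse (schur m n n n) *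
      schurCoeff m (n + 1) k := by
  have step : ∀ n, (∃ μ : ℕ → A, ∀ k j, δ (schur m n k j) =
      schur m n k (j + 1) - schur m n k n * μ j) →
      (∀ k, δ (schurCoeff m n k) = schur m (n + 1) k (n + 1) * Ring.inverse (schur m n n n)) ∧
      ∀ k j, δ (schur m (n + 1) k j) = schur m (n + 1) k (j + 1) -
        δ (schurCoeff m n k) * schur m n n j := by
    rintro n ⟨μ, hμ⟩
    have h1 : ∀ k j, δ (schur m (n + 1) k j) = schur m (n + 1) k (j + 1) -
        δ (schurCoeff m n k) * schur m n n j := fun k j => by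
      simp only [schur_succ, map_sub, Derivation.leibniz, hμ, smul_eq_mul]
      linear_combination μ j * schurCoeff_mul m (hp n) k
    refine ⟨fun k => ?_, h1⟩
    -- Column `n` is cleared after step `n`, so the left side is 0 there and the derivative of the
    -- multiplier can be solved for.
    have h2 := h1 k n
    rw [schur_column m (fun l _ => hp l) k n.lt_succ_self, map_zero] at h2
    linear_combination Ring.inverse (schur m n n n) * h2 -
      δ (schurCoeff m n k) * Ring.mul_inverse_cancel _ (hp n)
  have hall : ∀ n, ∃ μ : ℕ → A, ∀ k j, δ (schur m n k j) =
      schur m n k (j + 1) - schur m n k n * μ j := by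
    intro n
    induction n with
    | zero => exact ⟨0, fun k j => by simpa [schur] using h k j⟩
    | succ n ih =>
      refine ⟨fun j => Ring.inverse (schur m n n n) * schur m n n j, fun k j => ?_⟩
      rw [(step n ih).2, (step n ih).1]; ring
  rw [(step n (hall n)).1]
  linear_combination (-Ring.inverse (schur m n n n)) * schurCoeff_mul m (hp (n + 1)) k

end Elimination

/-! ### Wronskians as pivots, and iterated integrals. -/

section Wronskians

variable {A : Type u} [CommRing A] [Algebra ℚ A] {δ : Derivation ℚ A A}

/-- The array of derivatives of a sequence of functions. -/
def jets (δ : Derivation ℚ A A) (f : ℕ → A) (k j : ℕ) : A := (⇑δ)^[j] (f k)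

theorem derivation_jets (δ : Derivation ℚ A A) (f : ℕ → A) (k j : ℕ) :
    δ (jets δ f k j) = jets δ f k (j + 1) := (Function.iterate_succ_apply' _ _ _).symm

theorem Wr_zero (f : ℕ → A) : Wr δ f 0 = 1 := by
  rw [Wr, wronskianDet, Matrix.det_fin_zero]

theorem Wr_one (f : ℕ → A) : Wr δ f 1 = f 0 := by
  simp [Wr, wronskianDet]

theorem WrWith_eq {f : ℕ → A} {n : ℕ} (h : ∀ l < n, IsUnit (schur (jets δ f) l l l)) (k : ℕ) :
    WrWith δ f n (f k) =
      (∏ l ∈ Finset.range n, schur (jets δ f) l l l) * schur (jets δ f) n k n := by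
  rw [← det_schur _ h, WrWith, wronskianDet]
  congr 2
  ext α β
  induction β using Fin.lastCases with
  | last => simp [jets]
  | cast β => simp [jets]

theorem Wr_succ_eq {f : ℕ → A} {n : ℕ} (h : ∀ l < n, IsUnit (schur (jets δ f) l l l)) :
    Wr δ f (n + 1) = ∏ l ∈ Finset.range (n + 1), schur (jets δ f) l l l := by
  rw [Finset.prod_range_succ, ← det_schur _ h, Wr, wronskianDet]
  congr 2
  ext α β
  split_ifs with h1
  · rfl
  · rw [show (β : ℕ) = n by omega]; rfl

/-- By induction the Wronskian is the product of the pivots met so far, so the last pivot divides a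
unit. -/
theorem isUnit_schur {f : ℕ → A} (h : ∀ n, IsUnit (Wr δ f n)) (n : ℕ) :
    IsUnit (schur (jets δ f) n n n) := by
  induction n using Nat.strong_induction_on with
  | _ n ih =>
    have := h (n + 1)
    rw [Wr_succ_eq ih, Finset.prod_range_succ] at this
    exact isUnit_of_mul_isUnit_right this

theorem Wr_succ {f : ℕ → A} (h : ∀ n, IsUnit (Wr δ f n)) (n : ℕ) :
    Wr δ f (n + 1) = Wr δ f n * schur (jets δ f) n n n := by
  rcases n with _ | n
  · rw [Wr_zero, Wr_succ_eq fun l _ => isUnit_schur h l]; simp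
  · rw [Wr_succ_eq fun l _ => isUnit_schur h l, Wr_succ_eq fun l _ => isUnit_schur h l,
      Finset.prod_range_succ]

theorem Wr_succ_mul_inverse {f : ℕ → A} (h : ∀ n, IsUnit (Wr δ f n)) (n : ℕ) :
    Wr δ f (n + 1) * Ring.inverse (Wr δ f n) = schur (jets δ f) n n n := by
  rw [Wr_succ h]
  linear_combination schur (jets δ f) n n n * Ring.mul_inverse_cancel _ (h n)

/-- The two Wronskians share all pivots but the last. What remains is the entry of row `k` over the
pivot, that is, the elimination multiplier. -/
theorem WrWith_mul_inverse {f : ℕ → A} (h : ∀ n, IsUnit (Wr δ f n)) (n k : ℕ) :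
    WrWith δ f n (f k) * Ring.inverse (Wr δ f (n + 1)) = schurCoeff (jets δ f) n k := by
  have hp := isUnit_schur h
  have h1 : WrWith δ f n (f k) = schurCoeff (jets δ f) n k * Wr δ f (n + 1) := by
    rw [WrWith_eq fun l _ => hp l, Wr_succ_eq fun l _ => hp l, Finset.prod_range_succ,
      ← schurCoeff_mul _ (hp n) k]
    ring
  rw [h1, mul_assoc, Ring.mul_inverse_cancel _ (h _), mul_one]

theorem isIteratedIntegral_of_chain {m : ℕ} {c h : ℕ → A} (h1 : ∀ i < m, δ (h i) = c i * h (i + 1))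
    (hm : h m = 1) : IsIteratedIntegral δ ((List.range m).map c) (h 0) := by
  induction m generalizing c h with
  | zero => exact hm
  | succ m ih =>
    rw [List.range_succ_eq_map, List.map_cons, List.map_map]
    exact ⟨h 1, ih (c := c ∘ Nat.succ) (h := fun i => h (i + 1))
      (fun i hi => h1 (i + 1) (by omega)) hm, h1 0 (by omega)⟩

theorem IsIteratedIntegral.neg {cs : List A} {I : A} (h : IsIteratedIntegral δ cs I) :
    IsIteratedIntegral δ (cs.map Neg.neg) ((-1) ^ cs.length * I) := by
  induction cs generalizing I with
  | nil => simpa [IsIteratedIntegral] using h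
  | cons c cs ih =>
    obtain ⟨g, hg, hI⟩ := h
    refine ⟨_, ih hg, ?_⟩
    -- The sign is written as the image of a rational number, so that `ℚ`-linearity of `δ` takes it
    -- out.
    have : ((-1 : A) ^ (c :: cs).length) = algebraMap ℚ A ((-1) ^ (c :: cs).length) := by simp
    rw [this, ← Algebra.smul_def, Derivation.map_smul, hI, Algebra.smul_def, ← this, List.length_cons, pow_succ]
    ring

/-- The classical representation of a function by iterated integrals of Wronskians. -/
theorem exists_isIteratedIntegral_Wr {f : ℕ → A} (h : ∀ n, IsUnit (Wr δ f n)) (m : ℕ) :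
    ∃ I, IsIteratedIntegral δ ((List.range m).map fun i =>
      Wr δ f (i + 2) * Wr δ f i * Ring.inverse (Wr δ f (i + 1)) ^ 2) I ∧ f m = f 0 * I := by
  have hp := isUnit_schur h
  -- The chain of integrands consists of the successive multipliers of row `m`. Each one
  -- differentiates to a ratio of pivots times the next, and the last, of row `m` by itself, is 1.
  refine ⟨schurCoeff (jets δ f) 0 m, isIteratedIntegral_of_chain
    (h := fun i => schurCoeff (jets δ f) i m) (fun i _ => ?_) (schurCoeff_self _ (hp m)), ?_⟩
  · rw [derivation_schurCoeff_of_column hp (derivation_jets δ f), ← Wr_succ_mul_inverse h (i + 1),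
      Wr_succ h i, Ring.mul_inverse_rev]
    have h1 := Ring.mul_inverse_cancel _ (h i)
    linear_combination (-Wr δ f (i + 2) * Ring.inverse (Wr δ f i) *
      Ring.inverse (schur (jets δ f) i i i) ^ 2 * schurCoeff (jets δ f) (i + 1) m) * h1
  · have := schurCoeff_mul (jets δ f) (hp 0) m
    rw [mul_comm]
    exact this.symm

/-- The Wronskian of the first row of an array in which each row is the derivative of the previous one
up to multiples of the rows above. -/
theorem Wr_eq_det_of_rows {N : ℕ → ℕ → A} {b : ℕ → ℕ → A} (h : ∀ i k, δ (N i k) =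
    N (i + 1) k + ∑ l ∈ Finset.range (i + 1), b i l * N l k) (n : ℕ) :
    Wr δ (N 0) n = Matrix.det (Matrix.of fun i k : Fin n => N i k) := by
  have h1 : ∀ α, ∃ c : ℕ → A, c α = 1 ∧ ∀ k, (⇑δ)^[α] (N 0 k) =
      ∑ l ∈ Finset.range (α + 1), N l k * c l := by
    intro α
    induction α with
    | zero => exact ⟨fun _ => 1, rfl, fun k => by simp⟩
    | succ α ih =>
      obtain ⟨c, hc, hk⟩ := ih
      -- The three contributions are the passage from row `l - 1` to row `l`, the derivative of the
      -- old coefficient, and the multiples `b i l` of the rows above. The top coefficient stays 1.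
      refine ⟨fun l => (if l = 0 then 0 else c (l - 1)) + (if l = α + 1 then 0 else δ (c l)) +
        ∑ i ∈ Finset.range (α + 1), if l ≤ i then c i * b i l else 0, ?_, fun k => ?_⟩
      · have : ∑ i ∈ Finset.range (α + 1), (if α < i then c i * b i (α + 1) else 0) = 0 :=
          Finset.sum_eq_zero fun i hi => by
            rw [if_neg (by have := Finset.mem_range.1 hi; omega)]
        simp [this, hc]
      · rw [Function.iterate_succ_apply', hk, map_sum]
        simp only [Derivation.leibniz, smul_eq_mul, h, mul_add, Finset.sum_add_distrib]
        have e1 : ∑ l ∈ Finset.range (α + 1 + 1), N l k * (if l = 0 then 0 else c (l - 1)) =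
            ∑ l ∈ Finset.range (α + 1), c l * N (l + 1) k := by
          rw [Finset.sum_range_succ']; simp [mul_comm]
        have e2 : ∑ l ∈ Finset.range (α + 1 + 1), N l k * (if l = α + 1 then 0 else δ (c l)) =
            ∑ l ∈ Finset.range (α + 1), N l k * δ (c l) := by
          rw [Finset.sum_range_succ]
          simp only [if_true, mul_zero, add_zero]
          refine Finset.sum_congr rfl fun l hl => ?_
          rw [if_neg (by have := Finset.mem_range.1 hl; omega)]
        have e3 : ∑ l ∈ Finset.range (α + 1 + 1), N l k *
            (∑ i ∈ Finset.range (α + 1), if l ≤ i then c i * b i l else 0) =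
            ∑ i ∈ Finset.range (α + 1), c i * ∑ l ∈ Finset.range (i + 1), b i l * N l k := by
          simp only [Finset.mul_sum]
          rw [Finset.sum_comm]
          refine Finset.sum_congr rfl fun i hi => ?_
          have hi' := Finset.mem_range.1 hi
          symm
          refine Finset.sum_subset_zero_on_sdiff (fun l hl => ?_) (fun l hl => ?_) fun l hl => ?_
          · simp only [Finset.mem_range] at hl ⊢; omega
          · simp only [Finset.mem_sdiff, Finset.mem_range] at hl
            rw [if_neg (by omega), mul_zero]
          · rw [if_pos (by have := Finset.mem_range.1 hl; omega)]; ring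
        rw [e1, e2, e3]; ring
  choose c hc hk using h1
  rw [Wr, wronskianDet, ← Matrix.det_transpose, ← Matrix.det_transpose (Matrix.of fun i k : Fin n => N i k)]
  have h2 := det_mul_upper (m := fun k i => N i k) (U := fun l α => c α l)
    (m' := fun k α => (⇑δ)^[α] (N 0 k)) (fun k α => hk α k) n
  simp only [hc, Finset.prod_const_one, mul_one] at h2
  exact h2

/-- Functions with invertible Wronskians are linearly independent over the constants. -/
theorem eq_zero_of_sum_mul_eq_zero {f : ℕ → A} {n : ℕ} (h : IsUnit (Wr δ f n)) {a : ℕ → A}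
    (ha : ∀ i < n, δ (a i) = 0) (hs : ∑ i ∈ Finset.range n, a i * f i = 0) :
    ∀ i < n, a i = 0 := by
  -- As the `a i` are constants, differentiating the relation gives a linear system whose
  -- determinant is the Wronskian.
  have h1 : ∀ α, ∑ i ∈ Finset.range n, a i * (⇑δ)^[α] (f i) = 0 := by
    intro α
    induction α with
    | zero => exact hs
    | succ α ih =>
      have := congrArg δ ih
      rw [map_zero, map_sum] at this
      rw [← this]
      refine Finset.sum_congr rfl fun i hi => ?_
      rw [Derivation.leibniz, ha i (Finset.mem_range.1 hi), Function.iterate_succ_apply']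
      simp
  rw [Wr, wronskianDet, ← Matrix.isUnit_iff_isUnit_det] at h
  have h2 := Matrix.mulVec_injective_of_isUnit h
  have h3 : (fun i : Fin n => a i) = 0 := by
    apply h2
    ext α
    rw [Matrix.mulVec_zero, Matrix.mulVec, dotProduct, Pi.zero_apply, ← h1 α,
      Finset.sum_range]
    exact Finset.sum_congr rfl fun i _ => mul_comm _ _
  intro i hi
  exact congrFun h3 ⟨i, hi⟩

end Wronskians

/-! ### The operators `D⁻¹ Ψ_k W` under the first ghost flow. -/

section GhostRows

variable {A : Type u} [CommRing A] [Algebra ℚ A] {d δ : Derivation ℚ A A}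

namespace PDO

/-- From `D (D⁻¹ a) = a`, each coefficient below the leading one is minus the derivative of its
predecessor. -/
theorem coeff_Dinv_mul_const (a : A) (i : ℕ) :
    (Dinv * const a : PDO d).coeff (-1 - i) = (-1) ^ i * (⇑d)^[i] a := by
  have h : ∀ n, d ((Dinv * const a : PDO d).coeff n) + (Dinv * const a : PDO d).coeff (n - 1) =
      (const a : PDO d).coeff n := fun n => by
    rw [← coeff_D_mul, ← mul_assoc, D_mul_Dinv, one_mul]
  have h0 : (Dinv * const a : PDO d).OrdLE (-1) := (ordLE_Dinv.mul (ordLE_const a)).mono (by simp)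
  induction i with
  | zero =>
    have := h 0
    rw [h0 0 (by norm_num), map_zero, zero_add] at this
    simpa [coeff_const] using this
  | succ i ih =>
    have := h (-1 - i)
    rw [ih, coeff_const, if_neg (by omega)] at this
    rw [show (-1 : ℤ) - ((i + 1 : ℕ) : ℤ) = -1 - i - 1 by push_cast; ring,
      Function.iterate_succ_apply']
    have h1 : (-1 : A) ^ i = algebraMap ℚ A ((-1) ^ i) := by simp
    rw [h1, ← Algebra.smul_def, Derivation.map_smul, Algebra.smul_def, ← h1] at this
    rw [pow_succ]
    linear_combination this

/-- Integration by parts: the function `d s` is the commutator of `D` and `s`. -/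
theorem Dinv_mul_const_derivation_mul_Dinv (s : A) : (Dinv * const (d s) * Dinv : PDO d) =
    const s * Dinv - Dinv * const s := by
  have h : (const (d s) : PDO d) = D * const s - const s * D := by rw [D_mul_const]; abel
  rw [h, mul_sub, sub_mul, ← mul_assoc, Dinv_mul_D, one_mul, mul_assoc, mul_assoc, D_mul_Dinv,
    mul_one]

end PDO

open PDO

/-- The coefficients of the operator `D⁻¹ Ψ_k W`. -/
noncomputable def ghostRow (W : PDO d) (Ψ : ℕ → A) (k m : ℕ) : A :=
  (Dinv * const (Ψ k) * W).coeff (-m)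

theorem ordLE_ghostRow {W : PDO d} (hW : W.OrdLE 0) (a : A) : (Dinv * const a * W).OrdLE (-1) :=
  ((ordLE_Dinv.mul (ordLE_const a)).mul hW).mono (by simp)

theorem ghostRow_zero {W : PDO d} (hW : W.OrdLE 0) (Ψ : ℕ → A) (k : ℕ) : ghostRow W Ψ k 0 = 0 :=
  ordLE_ghostRow hW _ _ (by norm_num)

/-- The upper triangular array which relates `ghostRow` to the derivatives of the `Ψ_k`. -/
noncomputable def ghostUpper (W : PDO d) (i j : ℕ) : A :=
  (-1) ^ i * (Dz (-1 - i) * W).coeff (-((j + 1 : ℕ) : ℤ))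

theorem ghostUpper_self {W : PDO d} (hW0 : W.coeff 0 = 1) (hW : W.OrdLE 0) (i : ℕ) :
    ghostUpper W i i = (-1) ^ i := by
  have h := coeff_mul_top (ordLE_Dz (d := d) (-1 - i)) hW
  rw [hW0, coeff_Dz, if_pos rfl, mul_one] at h
  rw [ghostUpper, show -((i + 1 : ℕ) : ℤ) = -1 - i + 0 by push_cast; ring, h, mul_one]

/-- `D⁻¹ Ψ_k` is expanded in derivatives of `Ψ_k` times `D⁻¹⁻ⁱ`. Since `D⁻¹⁻ⁱ W` has order at most
`-1 - i`, only `i ≤ j` contributes in degree `-(j + 1)`. This is the triangular change of columns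
that ties these coefficients to Wronskians in `x`. -/
theorem ghostRow_succ {W : PDO d} (hW : W.OrdLE 0) (Ψ : ℕ → A) (k j : ℕ) :
    ghostRow W Ψ k (j + 1) = ∑ i ∈ Finset.range (j + 1), jets d Ψ k i * ghostUpper W i j := by
  have h0 : (Dinv * const (Ψ k) : PDO d).OrdLE (-1) :=
    (ordLE_Dinv.mul (ordLE_const (Ψ k))).mono (by simp)
  rw [ghostRow, coeff_mul_eq_sum_left h0 hW]
  refine Finset.sum_nbij' (fun i => (-1 - i).toNat) (fun i => -1 - (i : ℤ)) ?_ ?_ ?_ ?_ ?_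
  · intro i hi; simp only [Finset.mem_Icc, Finset.mem_range] at hi ⊢; omega
  · intro i hi; simp only [Finset.mem_Icc, Finset.mem_range] at hi ⊢; omega
  · intro i hi; simp only [Finset.mem_Icc] at hi ⊢; omega
  · intro i hi; simp only [Finset.mem_range] at hi ⊢; omega
  · intro i hi
    simp only [Finset.mem_Icc] at hi
    obtain ⟨l, rfl⟩ : ∃ l : ℕ, i = -1 - l := ⟨(-1 - i).toNat, by omega⟩
    rw [coeff_Dinv_mul_const, ghostUpper, jets, show (-1 - (-1 - (l : ℤ))).toNat = l by omega]
    ring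

/-- The first ghost flow of the operators `D⁻¹ Ψ_k W`. -/
theorem der_ghostRow (hδ : ∀ a, δ (d a) = d (δ a)) {W : PDO d} {φ : A} {Ψ S : ℕ → A}
    (hS : ∀ k, d (S k) = φ * Ψ k) (hW : W.der δ = const φ * Dinv * const (Ψ 0) * W)
    (hΨ : ∀ k, δ (Ψ k) = Ψ 0 * S k + Ψ (k + 1)) (k : ℕ) :
    (Dinv * const (Ψ k) * W).der δ =
      Dinv * const (Ψ (k + 1)) * W + const (S k) * (Dinv * const (Ψ 0) * W) := by
  have h1 : (const (Ψ k) * const φ : PDO d) = const (d (S k)) := by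
    rw [const_mul_const, hS, mul_comm]
  -- As `Ψ_k φ` is the derivative of `S k`, the product of two integrations collapses to single
  -- ones.
  have h2 : (Dinv * const (Ψ k) * (const φ * Dinv * const (Ψ 0) * W) : PDO d) =
      const (S k) * (Dinv * const (Ψ 0) * W) - Dinv * const (Ψ 0 * S k) * W := by
    have : (Dinv * const (Ψ k) * (const φ * Dinv * const (Ψ 0) * W) : PDO d) =
        Dinv * (const (Ψ k) * const φ) * Dinv * (const (Ψ 0) * W) := by simp only [mul_assoc]
    rw [this, h1, Dinv_mul_const_derivation_mul_Dinv, mul_comm (Ψ 0), ← const_mul_const]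
    noncomm_ring
  rw [der_mul hδ, der_mul hδ, ← Dz_neg_one, der_Dz, zero_mul, zero_add, Dz_neg_one, der_const, hΨ,
    const_add, hW, h2]
  noncomm_ring

theorem derivation_ghostRow (hδ : ∀ a, δ (d a) = d (δ a)) {W : PDO d} {φ : A} {Ψ S : ℕ → A}
    (hS : ∀ k, d (S k) = φ * Ψ k) (hW : W.der δ = const φ * Dinv * const (Ψ 0) * W)
    (hΨ : ∀ k, δ (Ψ k) = Ψ 0 * S k + Ψ (k + 1)) (k m : ℕ) :
    δ (ghostRow W Ψ k m) = ghostRow W Ψ (k + 1) m + S k * ghostRow W Ψ 0 m := by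
  rw [ghostRow, ← coeff_der, der_ghostRow hδ hS hW hΨ, coeff_add, coeff_const_mul]; rfl

theorem derivation_inverse_mul_coeff {W : PDO d} {φ : A} (hφ : IsUnit φ) {Ψ : ℕ → A}
    (hW : W.der δ = const φ * Dinv * const (Ψ 0) * W) (m : ℕ) :
    δ (Ring.inverse φ * W.coeff (-m)) = ghostRow W Ψ 0 m +
      δ (Ring.inverse φ) * φ * (Ring.inverse φ * W.coeff (-m)) := by
  have h1 : δ (W.coeff (-m)) = φ * ghostRow W Ψ 0 m := by
    rw [ghostRow, ← coeff_der, hW, mul_assoc, mul_assoc, coeff_const_mul, ← mul_assoc]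
  have h2 := Ring.mul_inverse_cancel _ hφ
  rw [Derivation.leibniz, h1, smul_eq_mul, smul_eq_mul]
  linear_combination (ghostRow W Ψ 0 m - δ (Ring.inverse φ) * W.coeff (-m)) * h2

/-- The Wronskians of the dual eigenfunctions along the first ghost flow. -/
theorem Wr_dual (hδ : ∀ a, δ (d a) = d (δ a)) {W : PDO d} (hW0 : W.coeff 0 = 1)
    (hWle : W.OrdLE 0) {φ : A} (hφ : IsUnit φ) {Ψ S : ℕ → A}
    (hS : ∀ k, d (S k) = φ * Ψ k) (hW : W.der δ = const φ * Dinv * const (Ψ 0) * W)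
    (hΨ : ∀ k, δ (Ψ k) = Ψ 0 * S k + Ψ (k + 1)) (n : ℕ) :
    Wr δ (fun m => Ring.inverse φ * W.coeff (-m)) (n + 1) =
      (∏ i ∈ Finset.range n, (-1) ^ i) * (Wr d Ψ n * Ring.inverse φ) := by
  -- Row 0 holds the functions themselves, row `i + 1` the coefficients of `D⁻¹ Ψ_i W`. The flow
  -- moves each row to the next, up to multiples of the rows already present.
  let N : ℕ → ℕ → A := fun i m => Nat.casesOn i (Ring.inverse φ * W.coeff (-m))
    fun i => ghostRow W Ψ i m
  let b : ℕ → ℕ → A := fun i l => Nat.casesOn i (δ (Ring.inverse φ) * φ)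
    fun i => if l = 1 then S i else 0
  have hN : ∀ i k, δ (N i k) = N (i + 1) k + ∑ l ∈ Finset.range (i + 1), b i l * N l k := by
    rintro (_ | i) k
    · rw [Finset.sum_range_one]
      exact derivation_inverse_mul_coeff hφ hW k
    · have : ∑ l ∈ Finset.range (i + 1 + 1), b (i + 1) l * N l k = S i * ghostRow W Ψ 0 k := by
        rw [Finset.sum_eq_single 1]
        · simp [b, N]
        · intro l _ hl
          simp [b, hl]
        · simp
      rw [this]
      exact derivation_ghostRow hδ hS hW hΨ i k
  have h1 := Wr_eq_det_of_rows hN (n + 1)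
  -- The column `m = 0` is `φ⁻¹` followed by zeros, because the operators `D⁻¹ Ψ_i W` have negative
  -- order. Expanding along it leaves the Wronskian of the `Ψ_i` with a sign.
  rw [show (fun m : ℕ => Ring.inverse φ * W.coeff (-m)) = N 0 from rfl, h1,
    Matrix.det_succ_column_zero, Fin.sum_univ_succ, Finset.sum_eq_zero, add_zero]
  · have h2 : ((Matrix.of fun i k : Fin (n + 1) => N i k).submatrix (Fin.succAbove 0) Fin.succ) =
        Matrix.of fun i k : Fin n => ghostRow W Ψ i (k + 1) := by
      ext i k
      simp [N]
    rw [h2, det_mul_upper (fun k j => ghostRow_succ hWle Ψ k j)]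
    have h3 : (Matrix.of fun k j : Fin n => jets d Ψ k j).det = Wr d Ψ n := by
      rw [Wr, wronskianDet, ← Matrix.det_transpose]; rfl
    rw [h3]
    simp only [ghostUpper_self hW0 hWle]
    simp [N, hW0]
    ring
  · intro i _
    simp [N, ghostRow_zero hWle]

end GhostRows

/-! ### Ghost flows of the squared eigenfunction potentials. -/

theorem sum_antidiagonal_add_add_one {M : Type*} [AddCommMonoid M] (r s : ℕ) (F : ℕ → ℕ → M) :
    ∑ p ∈ Finset.HasAntidiagonal.antidiagonal (r + s + 1), F p.1 p.2 =
      ∑ p ∈ Finset.HasAntidiagonal.antidiagonal r, F p.1 (p.2 + s + 1) +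
        ∑ p ∈ Finset.HasAntidiagonal.antidiagonal s, F (p.1 + r + 1) p.2 := by
  rw [Finset.Nat.sum_antidiagonal_eq_sum_range_succ (fun a b => F a b),
    Finset.Nat.sum_antidiagonal_eq_sum_range_succ (fun a b => F a (b + s + 1)),
    Finset.Nat.sum_antidiagonal_eq_sum_range_succ (fun a b => F (a + r + 1) b),
    show (r + s + 1).succ = r.succ + s.succ by omega, Finset.sum_range_add]
  congr 1
  · refine Finset.sum_congr rfl fun k hk => ?_
    have := Finset.mem_range.1 hk
    congr 1; omega
  · refine Finset.sum_congr rfl fun k hk => ?_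
    have := Finset.mem_range.1 hk
    congr 1 <;> omega

/-- The ghost flows of the squared eigenfunction potentials. -/
theorem potential_flow {A : Type u} [CommRing A] [Algebra ℚ A] {d : Derivation ℚ A A}
    {e : ℕ → Derivation ℚ A A} (hee : ∀ m n a, e m (e n a) = e n (e m a))
    (hde : ∀ n a, d (e n a) = e n (d a)) {Φ Ψ : ℕ → A} {S : ℕ → ℕ → A}
    (hind : ∀ k, IsUnit (Wr d Φ k)) (hS : ∀ j k, d (S j k) = Φ j * Ψ k)
    (hΦ : ∀ s k, e s (Φ k) =
      ∑ p ∈ Finset.HasAntidiagonal.antidiagonal s, Φ p.1 * S k p.2 - Φ (k + s + 1))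
    (hΨ : ∀ s k, e s (Ψ k) =
      ∑ p ∈ Finset.HasAntidiagonal.antidiagonal s, Ψ p.2 * S p.1 k + Ψ (k + s + 1)) (s j k : ℕ) :
    e s (S j k) = ∑ p ∈ Finset.HasAntidiagonal.antidiagonal s, S p.1 k * S j p.2 -
      S (j + s + 1) k + S j (k + s + 1) := by
  -- `c s j k` is the defect in the asserted law. Its derivative in `x` vanishes, so it is a
  -- constant of integration, which has to be shown to be 0.
  obtain ⟨c, hc⟩ : ∃ c : ℕ → ℕ → ℕ → A, ∀ s j k, c s j k = e s (S j k) -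
    (∑ p ∈ Finset.HasAntidiagonal.antidiagonal s, S p.1 k * S j p.2 -
      S (j + s + 1) k + S j (k + s + 1)) := ⟨_, fun _ _ _ => rfl⟩
  have hc0 : ∀ s j k, d (c s j k) = 0 := by
    intro s j k
    rw [hc, map_sub, hde, hS, map_add, map_sub, map_sum, hS, hS, Derivation.leibniz, hΦ, hΨ]
    simp only [Derivation.leibniz, hS, smul_eq_mul, Finset.sum_add_distrib, mul_add, mul_sub,
      Finset.mul_sum]
    have e1 : ∀ p : ℕ × ℕ, Φ j * (Ψ p.2 * S p.1 k) = S p.1 k * (Φ j * Ψ p.2) := fun p => by ring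
    have e2 : ∀ p : ℕ × ℕ, Ψ k * (Φ p.1 * S j p.2) = S j p.2 * (Φ p.1 * Ψ k) := fun p => by ring
    simp only [e1, e2]
    ring
  -- The flows `e r` and `e s` commute on `Φ k`. All terms without a defect cancel, after the sums
  -- are shifted along antidiagonals.
  have hcomm : ∀ r s k, ∑ p ∈ Finset.HasAntidiagonal.antidiagonal r, Φ p.1 * c s k p.2 =
      ∑ p ∈ Finset.HasAntidiagonal.antidiagonal s, Φ p.1 * c r k p.2 := by
    intro r s k
    have hes : ∀ s j k, e s (S j k) = c s j k +
      (∑ p ∈ Finset.HasAntidiagonal.antidiagonal s, S p.1 k * S j p.2 -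
        S (j + s + 1) k + S j (k + s + 1)) := fun s j k => by rw [hc]; ring
    have key : ∀ r s, e s (e r (Φ k)) =
        ∑ p ∈ Finset.HasAntidiagonal.antidiagonal r, Φ p.1 * c s k p.2 +
        ∑ p ∈ Finset.HasAntidiagonal.antidiagonal r,
          ∑ q ∈ Finset.HasAntidiagonal.antidiagonal s, Φ q.1 * S p.1 q.2 * S k p.2 +
        ∑ p ∈ Finset.HasAntidiagonal.antidiagonal r,
          ∑ q ∈ Finset.HasAntidiagonal.antidiagonal s, Φ p.1 * S q.1 p.2 * S k q.2 -
        ∑ p ∈ Finset.HasAntidiagonal.antidiagonal r, Φ (p.1 + s + 1) * S k p.2 +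
        ∑ p ∈ Finset.HasAntidiagonal.antidiagonal r, Φ p.1 * S k (p.2 + s + 1) -
        ∑ p ∈ Finset.HasAntidiagonal.antidiagonal r, Φ p.1 * S (k + s + 1) p.2 -
        ∑ p ∈ Finset.HasAntidiagonal.antidiagonal s, Φ p.1 * S (k + r + 1) p.2 +
        Φ (k + r + s + 2) := by
      intro r s
      rw [hΦ, map_sub, map_sum, hΦ s (k + r + 1)]
      simp only [← Finset.sum_add_distrib, ← Finset.sum_sub_distrib]
      rw [show k + r + 1 + s + 1 = k + r + s + 2 by ring, sub_sub_eq_add_sub, add_sub_right_comm]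
      congr 2
      refine Finset.sum_congr rfl fun p _ => ?_
      rw [Derivation.leibniz, hΦ, hes, smul_eq_mul, smul_eq_mul]
      simp only [mul_sub, mul_add, Finset.mul_sum]
      have e1 : ∀ q : ℕ × ℕ, S k p.2 * (Φ q.1 * S p.1 q.2) = Φ q.1 * S p.1 q.2 * S k p.2 :=
        fun q => by ring
      have e2 : ∀ q : ℕ × ℕ, Φ p.1 * (S q.1 p.2 * S k q.2) = Φ p.1 * S q.1 p.2 * S k q.2 :=
        fun q => by ring
      simp only [e1, e2]
      ring
    have h1 := hee s r (Φ k)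
    rw [key r s, key s r] at h1
    have h2 := sum_antidiagonal_add_add_one r s fun a b => Φ a * S k b
    have h3 := sum_antidiagonal_add_add_one s r fun a b => Φ a * S k b
    rw [show s + r + 1 = r + s + 1 by ring, h2] at h3
    have h4 : ∑ p ∈ Finset.HasAntidiagonal.antidiagonal r,
        ∑ q ∈ Finset.HasAntidiagonal.antidiagonal s, Φ q.1 * S p.1 q.2 * S k p.2 =
        ∑ p ∈ Finset.HasAntidiagonal.antidiagonal s,
          ∑ q ∈ Finset.HasAntidiagonal.antidiagonal r, Φ p.1 * S q.1 p.2 * S k q.2 :=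
      Finset.sum_comm
    have h5 : ∑ p ∈ Finset.HasAntidiagonal.antidiagonal s,
        ∑ q ∈ Finset.HasAntidiagonal.antidiagonal r, Φ q.1 * S p.1 q.2 * S k p.2 =
        ∑ p ∈ Finset.HasAntidiagonal.antidiagonal r,
          ∑ q ∈ Finset.HasAntidiagonal.antidiagonal s, Φ p.1 * S q.1 p.2 * S k q.2 :=
      Finset.sum_comm
    rw [h4, h5, show k + s + r + 2 = k + r + s + 2 by ring] at h1
    linear_combination h1 - h3
  have hzero : c s j k = 0 := by
    -- With this `r`, the function `Φ (s + 1)` occurs on the left of `hcomm` with coefficient `c s j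
    -- k`, and not at all on the right, where the indices are at most `s`. Independence over the
    -- constants gives 0.
    obtain ⟨r, hr⟩ : ∃ r, r = s + k + 1 := ⟨_, rfl⟩
    have h1 := hcomm r s j
    rw [Finset.Nat.sum_antidiagonal_eq_sum_range_succ (fun a b => Φ a * c s j b),
      Finset.Nat.sum_antidiagonal_eq_sum_range_succ (fun a b => Φ a * c r j b)] at h1
    have h2 : ∑ i ∈ Finset.range (s + 1), Φ i * c r j (s - i) =
        ∑ i ∈ Finset.range (r + 1), (if i ≤ s then c r j (s - i) else 0) * Φ i := by
      refine Finset.sum_subset_zero_on_sdiff (fun i hi => ?_) (fun i hi => ?_) fun i hi => ?_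
      · simp only [Finset.mem_range] at hi ⊢; omega
      · simp only [Finset.mem_sdiff, Finset.mem_range] at hi
        rw [if_neg (by omega), zero_mul]
      · rw [if_pos (by have := Finset.mem_range.1 hi; omega), mul_comm]
    have h3 : ∑ i ∈ Finset.range (r + 1), (c s j (r - i) -
        if i ≤ s then c r j (s - i) else 0) * Φ i = 0 := by
      simp only [sub_mul, Finset.sum_sub_distrib]
      rw [← h2, ← h1, sub_eq_zero]
      exact Finset.sum_congr rfl fun i _ => mul_comm _ _
    have h4 := eq_zero_of_sum_mul_eq_zero (hind (r + 1)) (fun i _ => by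
      rw [map_sub, hc0]; split_ifs <;> simp [hc0]) h3 (s + 1) (by omega)
    rw [if_neg (by omega), sub_zero, show r - (s + 1) = k by omega] at h4
    exact h4
  rw [hc, sub_eq_zero] at hzero
  exact hzero

/-! ### Differential operators generating the ghost flows. -/

section GhostOperators

open PDO

variable {A : Type u} [CommRing A] [Algebra ℚ A]

/-- A sequence which evolves along a ghost flow like the eigenfunctions does so by operators with
symbol `D ^ (k + 1) + ∑ₘ S m k D ^ (-m)`. -/
theorem der_ofSeq_add_mul_Dz {δ η : Derivation ℚ A A} {f : ℕ → A} {S : ℕ → ℕ → A} {s : ℕ}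
    (h : ∀ m, η (f m) =
      ∑ p ∈ Finset.HasAntidiagonal.antidiagonal s, f p.1 * S m p.2 - f (m + s + 1)) :
    (ofSeq f : PDO δ).der η + ofSeq f * Dz (s + 1) =
      ∑ p ∈ Finset.HasAntidiagonal.antidiagonal s,
        const (f p.1) * (Dz (p.2 + 1) + ofSeq fun m => S m p.2) := by
  simp only [mul_add, Finset.sum_add_distrib, ← ofSeq_mul, ← ofSeq_sum]
  rw [der_ofSeq, ofSeq_mul_Dz, ← add_assoc, ← ofSeq_add, add_comm]
  congr 2
  funext m
  rw [h]; ring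

/-- The operators by which the first ghost flow produces the `D⁻¹ Ψ_k W` from the dressing operator
divided by the first eigenfunction `φ`. -/
noncomputable def ghostOp (δ : Derivation ℚ A A) (φ : A) (σ : ℕ → A) : ℕ → PDO δ
  | 0 => const (Ring.inverse φ) * D * const φ
  | k + 1 => D * ghostOp δ φ σ k - const (σ k) * ghostOp δ φ σ 0

theorem isDiff_ghostOp (δ : Derivation ℚ A A) (φ : A) (σ : ℕ → A) (k : ℕ) :
    (ghostOp δ φ σ k).IsDiff := by
  have h0 : (ghostOp δ φ σ 0).IsDiff := by
    rw [ghostOp]; exact ((isDiff_const _).mul isDiff_D).mul (isDiff_const _)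
  induction k with
  | zero => exact h0
  | succ k ih => rw [ghostOp]; exact (isDiff_D.mul ih).sub ((isDiff_const _).mul h0)

/-- The case `k = 0` is the first ghost flow of `f`. Left multiplication by `D` followed by the
subtraction of a multiple of that case reproduces the flow of the potentials, which raises `k` by
one. -/
theorem ghostOp_mul_ofSeq {δ : Derivation ℚ A A} {φ : A} (hφ : IsUnit φ) {f : ℕ → A}
    {S : ℕ → ℕ → A} (hf : ∀ m, δ (f m) = φ * S m 0 - f (m + 1)) (hf0 : f 0 = φ)
    (hS : ∀ j k, δ (S j k) = S 0 k * S j 0 - S (j + 1) k + S j (k + 1)) (k : ℕ) :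
    ghostOp δ φ (S 0) k * (const (Ring.inverse φ) * ofSeq f) =
      Dz (k + 1) + ofSeq fun m => S m k := by
  have h0 : ghostOp δ φ (S 0) 0 * (const (Ring.inverse φ) * ofSeq f) =
      Dz 1 + ofSeq fun m => S m 0 := by
    have h1 : (ofSeq f : PDO δ).der δ + ofSeq f * Dz ((0 : ℕ) + 1) = _ :=
      der_ofSeq_add_mul_Dz (S := S) (fun m => by simp [hf, hf0])
    simp only [Finset.Nat.antidiagonal_zero, Finset.sum_singleton, Nat.cast_zero, zero_add, hf0,
      ← D_mul] at h1
    rw [ghostOp, mul_assoc, ← mul_assoc (const φ), const_mul_const, Ring.mul_inverse_cancel _ hφ,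
      const_one, one_mul, mul_assoc, h1, ← mul_assoc, const_mul_const,
      Ring.inverse_mul_cancel _ hφ, const_one, one_mul]
  induction k with
  | zero => rw [h0]; norm_num
  | succ k ih =>
    rw [ghostOp, sub_mul, mul_assoc, mul_assoc, ih, h0, mul_add, D_mul (ofSeq _), der_ofSeq]
    have h1 := ofSeq_mul_Dz (d := δ) (fun m => S m k) 0
    simp only [Finset.Nat.antidiagonal_zero, Finset.sum_singleton, Nat.cast_zero, zero_add,
      add_zero] at h1
    rw [h1, ← Dz_one, Dz_mul_Dz]
    have h2 : (ofSeq (fun m => δ (S m k)) : PDO δ) = const (S 0 k) * ofSeq (fun m => S m 0) -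
        ofSeq (fun m => S (m + 1) k) + ofSeq fun m => S m (k + 1) := by
      rw [← ofSeq_mul, ← ofSeq_sub, ← ofSeq_add]
      exact congrArg ofSeq (funext fun m => hS m k)
    rw [h2, show (1 : ℤ) + (k + 1) = ((k + 1 : ℕ) : ℤ) + 1 by push_cast; ring, mul_add]
    abel

/-- The recursion of the operators copies the flow of the rows `g k`. Thus the operators attached to
the `Φ_m` also govern the dressing coefficients. -/
theorem ghostOp_apply {δ : Derivation ℚ A A} {φ : A} (hφ : IsUnit φ) {σ w : ℕ → A}
    {g : ℕ → ℕ → A} (h0 : ∀ m, δ (w m) = φ * g 0 m)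
    (h : ∀ k m, δ (g k m) = g (k + 1) m + σ k * g 0 m) (k m : ℕ) :
    (ghostOp δ φ σ k).apply (Ring.inverse φ * w m) = g k m := by
  have hz : (ghostOp δ φ σ 0).apply (Ring.inverse φ * w m) = g 0 m := by
    rw [ghostOp, mul_assoc, const_mul_apply, mul_apply isDiff_D (isDiff_const _), const_apply,
      Ring.mul_inverse_cancel_left _ _ hφ, D_apply, h0, Ring.inverse_mul_cancel_left _ _ hφ]
  induction k with
  | zero => exact hz
  | succ k ih =>
    rw [ghostOp, PDO.sub_apply, mul_apply isDiff_D (isDiff_ghostOp _ _ _ _), const_mul_apply, ih, hz,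
      D_apply, h]
    ring

end GhostOperators

/-! ### The ghost Zakharov-Shabat operators and the dual dressing operator. -/

namespace GhostKP

open PDO

variable {A : Type u} [CommRing A] [Algebra ℚ A] {d e : ℕ → Derivation ℚ A A}

theorem isUnit_Φ (X : GhostKP d e) : IsUnit (X.Φ 0) := by
  have := X.indep 1
  rwa [Wr_one] at this

theorem W_ordLE (X : GhostKP d e) : X.W.OrdLE 0 := fun n hn => X.dressing_form.2 n hn

theorem ghostGen_zero (X : GhostKP d e) :
    ghostGen (d 0) X.Φ X.Ψ 0 = const (X.Φ 0) * Dinv * const (X.Ψ 0) := by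
  simp [ghostGen]

theorem der_W_zero (X : GhostKP d e) :
    X.W.der (e 0) = const (X.Φ 0) * Dinv * const (X.Ψ 0) * X.W := by
  rw [X.dressing_ghost, ghostGen_zero]

theorem derivation_W_coeff (X : GhostKP d e) (s m : ℕ) : e s (X.W.coeff (-m)) =
    ∑ p ∈ Finset.HasAntidiagonal.antidiagonal s, X.Φ p.1 * ghostRow X.W X.Ψ p.2 m := by
  rw [← coeff_der, X.dressing_ghost, ghostGen, Finset.sum_mul, coeff_sum]
  refine Finset.sum_congr rfl fun p _ => ?_
  rw [mul_assoc, mul_assoc, coeff_const_mul, ← mul_assoc]; rfl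

/-- The logarithmic derivatives in `factors` are compatible with the coefficients of `ghostZS`. -/
theorem derivation_schurCoeff (X : GhostKP d e) (hde : ∀ m n a, d m (e n a) = e n (d m a))
    {S : ℕ → ℕ → A} (hS : ∀ j k, d 0 (S j k) = X.Φ j * X.Ψ k)
    (hΨ : ∀ k, e 0 (X.Ψ k) = X.Ψ 0 * S 0 k + X.Ψ (k + 1)) (j k : ℕ) :
    e 0 (schurCoeff (jets (d 0) X.Ψ) j k) + schurCoeff (jets (d 0) X.Ψ) j k *
        (e 0 (X.ratio (j + 1)) * Ring.inverse (X.ratio (j + 1))) =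
      schurCoeff (jets (d 0) X.Ψ) j (k + 1) +
        Nat.casesOn j (S 0 k) fun j => -schurCoeff (jets (d 0) X.Ψ) j k := by
  have hp := isUnit_schur X.adj_indep
  have hU : ∀ n, IsUnit (ghostUpper X.W n n) := fun n => by
    rw [ghostUpper_self X.dressing_form.1 X.W_ordLE]; exact isUnit_one.neg.pow n
  -- On derivatives of `Ψ_k` the flow also produces derivatives of `S 0 k`; on the coefficients of
  -- `D⁻¹ Ψ_k W` it only shifts rows and adds multiples of row 0. The triangular change of columns
  -- preserves the multipliers and alters pivots by a sign only.
  have hrow := ghostRow_succ X.W_ordLE X.Ψ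
  have hself := schur_mul_upper_self (m' := fun k j => ghostRow X.W X.Ψ k (j + 1)) hp hU hrow
  have hcoef := schurCoeff_mul_upper (m' := fun k j => ghostRow X.W X.Ψ k (j + 1)) hp hU hrow
  have hp' : ∀ n, IsUnit (schur (fun k j => ghostRow X.W X.Ψ k (j + 1)) n n n) := fun n => by
    rw [hself]; exact (hp n).mul (hU n)
  have hδ : ∀ k j, e 0 (ghostRow X.W X.Ψ k (j + 1)) = ghostRow X.W X.Ψ (k + 1) (j + 1) +
      S 0 k * ghostRow X.W X.Ψ 0 (j + 1) := fun k j =>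
    derivation_ghostRow (fun a => (hde 0 0 a).symm) (hS 0) X.der_W_zero hΨ k (j + 1)
  have key : e 0 (schur (jets (d 0) X.Ψ) j k j) = schur (jets (d 0) X.Ψ) j (k + 1) j +
      (Nat.casesOn j (S 0 k) fun j => -schurCoeff (jets (d 0) X.Ψ) j k) *
        schur (jets (d 0) X.Ψ) j j j := by
    rcases j with _ | j
    · show e 0 (X.Ψ k) = X.Ψ (k + 1) + S 0 k * X.Ψ 0
      rw [hΨ]; ring
    · have h1 := derivation_schur_of_row hp' hδ j k (j + 1)
      rw [hself, hself, hself, hcoef, ghostUpper_self X.dressing_form.1 X.W_ordLE] at h1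
      have h2 : (-1 : A) ^ (j + 1) = algebraMap ℚ A ((-1) ^ (j + 1)) := by simp
      rw [h2, mul_comm, ← Algebra.smul_def, Derivation.map_smul, Algebra.smul_def, ← h2] at h1
      have h3 : (-1 : A) ^ (j + 1) * (-1) ^ (j + 1) = 1 := by rw [← mul_pow]; simp
      show _ = _ + -schurCoeff (jets (d 0) X.Ψ) j k * _
      linear_combination ((-1 : A) ^ (j + 1)) * h1 - (e 0 (schur (jets (d 0) X.Ψ) (j + 1) k (j + 1))
        - schur (jets (d 0) X.Ψ) (j + 1) (k + 1) (j + 1) + schurCoeff (jets (d 0) X.Ψ) j k *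
        schur (jets (d 0) X.Ψ) (j + 1) (j + 1) (j + 1)) * h3
  have hr : X.ratio (j + 1) = schur (jets (d 0) X.Ψ) j j j := Wr_succ_mul_inverse X.adj_indep j
  rw [hr]
  rw [← schurCoeff_mul _ (hp j) k, ← schurCoeff_mul _ (hp j) (k + 1), Derivation.leibniz,
    smul_eq_mul, smul_eq_mul] at key
  have h1 := Ring.mul_inverse_cancel _ (hp j)
  linear_combination Ring.inverse (schur (jets (d 0) X.Ψ) j j j) * key +
    (schurCoeff (jets (d 0) X.Ψ) j (k + 1) - e 0 (schurCoeff (jets (d 0) X.Ψ) j k) +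
      (Nat.casesOn j (S 0 k) fun j => -schurCoeff (jets (d 0) X.Ψ) j k)) * h1

/-- `D` minus the logarithmic derivative of `1/Φ_0` is the conjugate `Φ_0⁻¹ D Φ_0`. -/
theorem factors_one (X : GhostKP d e) (σ : ℕ → A) :
    X.factors 1 = ghostOp (e 0) (X.Φ 0) σ 0 := by
  have hu := Ring.mul_inverse_cancel _ X.isUnit_Φ
  rw [factors, factors, mul_one, ghostOp, mul_assoc, D_mul_const, mul_add, ← mul_assoc,
    const_mul_const, const_mul_const, Ring.inverse_mul_cancel _ X.isUnit_Φ, const_one, one_mul,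
    sub_eq_add_neg, ← const_neg, add_comm]
  congr 2
  have h2 : Ring.inverse (Ring.inverse (X.Φ 0)) = X.Φ 0 := by
    have := Ring.mul_inverse_cancel _ X.isUnit_Φ.ringInverse
    linear_combination X.Φ 0 * this - Ring.inverse (Ring.inverse (X.Φ 0)) * hu
  have h3 := congrArg (e 0) hu
  rw [Derivation.leibniz, Derivation.map_one_eq_zero, smul_eq_mul, smul_eq_mul] at h3
  rw [ratio, h2]
  linear_combination -h3

/-- Induction on `k`: moving `D` past a multiplier completes the next factor, and by
`derivation_schurCoeff` the remainder is the multiplier of row `k + 1` plus terms that telescope,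
apart from the one subtracted in the recursion for `ghostOp`. -/
theorem ghostOp_eq_sum_factors (X : GhostKP d e) (hde : ∀ m n a, d m (e n a) = e n (d m a))
    {S : ℕ → ℕ → A} (hS : ∀ j k, d 0 (S j k) = X.Φ j * X.Ψ k)
    (hΨ : ∀ k, e 0 (X.Ψ k) = X.Ψ 0 * S 0 k + X.Ψ (k + 1)) (k : ℕ) :
    ghostOp (e 0) (X.Φ 0) (S 0) k = ∑ j ∈ Finset.range (k + 1),
      const (schurCoeff (jets (d 0) X.Ψ) j k) * X.factors (j + 1) := by
  have hp := isUnit_schur X.adj_indep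
  induction k with
  | zero =>
    rw [Finset.sum_range_one, schurCoeff_self _ (hp 0), const_one, one_mul, X.factors_one (S 0)]
  | succ k ih =>
    have hf : ∀ j, D * (const (schurCoeff (jets (d 0) X.Ψ) j k) * X.factors (j + 1)) =
        const (schurCoeff (jets (d 0) X.Ψ) j k) * X.factors (j + 2) +
        const (schurCoeff (jets (d 0) X.Ψ) j (k + 1) +
          Nat.casesOn j (S 0 k) fun j => -schurCoeff (jets (d 0) X.Ψ) j k) * X.factors (j + 1) := by
      intro j
      rw [← X.derivation_schurCoeff hde hS hΨ, const_add, ← const_mul_const,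
        show X.factors (j + 2) = (D - const (e 0 (X.ratio (j + 1)) *
          Ring.inverse (X.ratio (j + 1)))) * X.factors (j + 1) from rfl, ← mul_assoc, D_mul_const]
      noncomm_ring
    have hs : ∑ j ∈ Finset.range (k + 1), const (Nat.casesOn j (S 0 k)
        fun j => -schurCoeff (jets (d 0) X.Ψ) j k) * X.factors (j + 1) =
        const (S 0 k) * X.factors 1 - ∑ j ∈ Finset.range k,
          const (schurCoeff (jets (d 0) X.Ψ) j k) * X.factors (j + 2) := by
      rw [Finset.sum_range_succ']
      simp only [const_neg, neg_mul, Finset.sum_neg_distrib]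
      abel
    rw [ghostOp, ih, Finset.mul_sum, ← X.factors_one (S 0)]
    simp only [hf, const_add, add_mul, Finset.sum_add_distrib]
    rw [hs, Finset.sum_range_succ _ k, Finset.sum_range_succ _ (k + 1), schurCoeff_self _ (hp _),
      schurCoeff_self _ (hp _)]
    abel

/-- The inner Wronskian quotients are elimination multipliers, so exchanging the sums over `j` and
`k` assembles the operators `ghostOp`. -/
theorem ghostZS_eq (X : GhostKP d e) (hde : ∀ m n a, d m (e n a) = e n (d m a))
    {S : ℕ → ℕ → A} (hS : ∀ j k, d 0 (S j k) = X.Φ j * X.Ψ k)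
    (hΨ : ∀ k, e 0 (X.Ψ k) = X.Ψ 0 * S 0 k + X.Ψ (k + 1)) (s : ℕ) :
    X.ghostZS s = ∑ p ∈ Finset.HasAntidiagonal.antidiagonal s,
      const (Ring.inverse (X.Φ 0) * X.Φ p.1) * ghostOp (e 0) (X.Φ 0) (S 0) p.2 -
        const (e s (X.Φ 0) * Ring.inverse (X.Φ 0)) := by
  rw [ghostZS]
  congr 1
  rw [← Finset.Nat.sum_antidiagonal_swap]
  simp only [Prod.fst_swap, Prod.snd_swap]
  rw [Finset.Nat.sum_antidiagonal_eq_sum_range_succ (fun a b =>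
    const (Ring.inverse (X.Φ 0) * X.Φ b) * ghostOp (e 0) (X.Φ 0) (S 0) a)]
  simp only [X.ghostOp_eq_sum_factors hde hS hΨ, WrWith_mul_inverse X.adj_indep, const_sum,
    Finset.sum_mul, Finset.mul_sum]
  rw [Finset.sum_comm' (t' := Finset.range s.succ) (s' := fun k => Finset.range (k + 1))]
  · refine Finset.sum_congr rfl fun k _ => Finset.sum_congr rfl fun j _ => ?_
    rw [← mul_assoc, const_mul_const, mul_comm (X.Φ (s - k))]
  · intro j k
    simp only [Finset.mem_range, Finset.mem_Icc]
    omega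

theorem isDiff_ghostZS (X : GhostKP d e) (s : ℕ) : (X.ghostZS s).IsDiff := by
  have hf : ∀ j, (X.factors j).IsDiff := fun j => by
    induction j with
    | zero => exact isDiff_one
    | succ j ih => exact (isDiff_D.sub (isDiff_const _)).mul ih
  exact (IsDiff.sum fun j _ => (isDiff_const _).mul (hf _)).sub (isDiff_const _)

/-- The dressing operator of the ghost system. -/
noncomputable def dualW (X : GhostKP d e) : PDO (e 0) :=
  const (Ring.inverse (X.Φ 0)) * ofSeq X.Φ

theorem dualW_coeff (X : GhostKP d e) (m : ℕ) :
    X.dualW.coeff (-m) = Ring.inverse (X.Φ 0) * X.Φ m := by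
  rw [dualW, coeff_const_mul, coeff_ofSeq_neg]

theorem dualW_ordLE (X : GhostKP d e) : X.dualW.OrdLE 0 :=
  ((ordLE_const _).mul (ordLE_ofSeq _)).mono (by simp)

theorem dualW_coeff_zero (X : GhostKP d e) : X.dualW.coeff 0 = 1 :=
  (X.dualW_coeff 0).trans (Ring.inverse_mul_cancel _ X.isUnit_Φ)

theorem derivation_inverse {δ : Derivation ℚ A A} {φ : A} (hφ : IsUnit φ) :
    δ (Ring.inverse φ) = -(δ φ * Ring.inverse φ * Ring.inverse φ) := by
  have hu := Ring.mul_inverse_cancel _ hφ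
  have h3 := congrArg δ hu
  rw [Derivation.leibniz, Derivation.map_one_eq_zero, smul_eq_mul, smul_eq_mul] at h3
  linear_combination Ring.inverse φ * h3 - δ (Ring.inverse φ) * hu

/-- The ghost flows of `X` are Sato flows of the dual dressing operator. -/
theorem der_dualW (X : GhostKP d e) (hee : ∀ m n a, e m (e n a) = e n (e m a))
    (hde : ∀ m n a, d m (e n a) = e n (d m a)) (s : ℕ) :
    X.dualW.der (e s) + X.dualW * Dz (s + 1) = X.ghostZS s * X.dualW := by
  obtain ⟨S, hS, hΦ, hΨ⟩ := X.ghost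
  have hflow := potential_flow hee (hde 0) X.indep hS hΦ hΨ
  have hΨ0 : ∀ k, e 0 (X.Ψ k) = X.Ψ 0 * S 0 k + X.Ψ (k + 1) := fun k => by simpa using hΨ 0 k
  have hop := ghostOp_mul_ofSeq X.isUnit_Φ (f := X.Φ) (S := S) (δ := e 0)
    (fun m => by simpa using hΦ 0 m) rfl (fun j k => by simpa using hflow 0 j k)
  have hgen := der_ofSeq_add_mul_Dz (δ := e 0) (hΦ s)
  rw [X.ghostZS_eq hde hS hΨ0, sub_mul, Finset.sum_mul]
  simp only [mul_assoc, dualW, hop]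
  rw [der_mul (hee s 0), der_const, derivation_inverse X.isUnit_Φ, add_assoc, ← mul_add, hgen,
    Finset.mul_sum]
  simp only [← mul_assoc, const_mul_const, const_neg]
  noncomm_ring

/-- The ghost flow of `W` is expressed by the rows `D⁻¹ Ψ_k W`, and `ghostOp` produces these from
`w_m/Φ_0`. The logarithmic term of `M̄_s` accounts for differentiating `1/Φ_0`. -/
theorem derivation_dualΦ (X : GhostKP d e) (hde : ∀ m n a, d m (e n a) = e n (d m a)) (s m : ℕ) :
    e s (Ring.inverse (X.Φ 0) * X.W.coeff (-m)) =
      (X.ghostZS s).apply (Ring.inverse (X.Φ 0) * X.W.coeff (-m)) := by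
  obtain ⟨S, hS, hΦ, hΨ⟩ := X.ghost
  have hΨ0 : ∀ k, e 0 (X.Ψ k) = X.Ψ 0 * S 0 k + X.Ψ (k + 1) := fun k => by simpa using hΨ 0 k
  have hop := ghostOp_apply X.isUnit_Φ (δ := e 0) (w := fun m : ℕ => X.W.coeff (-m))
    (fun m => by simpa using X.derivation_W_coeff 0 m)
    (derivation_ghostRow (fun a => (hde 0 0 a).symm) (hS 0) X.der_W_zero hΨ0)
  rw [X.ghostZS_eq hde hS hΨ0, PDO.sub_apply, PDO.sum_apply]
  simp only [const_mul_apply, hop, const_apply]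
  rw [Derivation.leibniz, derivation_W_coeff, derivation_inverse X.isUnit_Φ, smul_eq_mul,
    smul_eq_mul, Finset.mul_sum]
  simp only [mul_assoc]
  ring

end GhostKP

namespace PDO

variable {A : Type u} [CommRing A] [Algebra ℚ A] {d : Derivation ℚ A A}

/-! ### Dressing operators and Lax operators -/

theorem pow_mul_dressing {L W : PDO d} (h : L * W = W * D) (n : ℕ) : L ^ n * W = W * Dz n := by
  induction n with
  | zero => rw [pow_zero, one_mul, Nat.cast_zero, Dz_zero, mul_one]
  | succ n ih =>
    rw [pow_succ, mul_assoc, h, ← mul_assoc, ih, mul_assoc, ← Dz_one, Dz_mul_Dz, Nat.cast_succ]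

theorem eq_of_mul_right_eq {P Q W V : PDO d} (hWV : W * V = 1) (h : P * W = Q * W) : P = Q := by
  have := congrArg (· * V) h
  simpa only [mul_assoc, hWV, mul_one] using this

theorem ordLE_der {W : PDO d} (hW0 : W.coeff 0 = 1) (hW : W.OrdLE 0) (δ : Derivation ℚ A A) :
    (W.der δ).OrdLE (-1) := fun n hn => by
  rw [coeff_der]
  rcases eq_or_ne n 0 with rfl | h
  · rw [hW0, Derivation.map_one_eq_zero]
  · rw [hW n (by omega), map_zero]

theorem der_inverse {δ : Derivation ℚ A A} (hδ : ∀ a, δ (d a) = d (δ a)) {W V : PDO d}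
    (hVW : V * W = 1) (hWV : W * V = 1) : V.der δ = -(V * W.der δ * V) := by
  have h := der_mul hδ V W
  rw [hVW, show (1 : PDO d).der δ = 0 from der_Dz δ 0] at h
  have h2 := congrArg (· * V) h
  simp only [zero_mul, add_mul, mul_assoc, hWV, mul_one] at h2
  rw [mul_assoc]
  exact eq_neg_of_add_eq_zero_left h2.symm

/-- Because `D W = W' + W D`, one has `L - D = -W' W⁻¹`, where `W'` has negative order. -/
theorem lax_sub_D {L W V : PDO d} (hW0 : W.coeff 0 = 1) (hW : W.OrdLE 0) (hV : V.OrdLE 0)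
    (hWV : W * V = 1) (h : L * W = W * D) : (L - D).OrdLE (-1) := by
  have h1 : L - D = -(W.der d) * V := by
    refine eq_of_mul_right_eq (W := W) (V := V) hWV ?_
    have hVW : V * W = 1 := by
      obtain ⟨V', -, -, h3, h4⟩ := exists_inverse hW0 hW
      have : V = V' := by rw [← one_mul V, ← h3, mul_assoc, hWV, mul_one]
      rw [this, h3]
    rw [sub_mul, h, D_mul, mul_assoc, hVW, mul_one, ← Dz_one]
    abel
  rw [h1]
  exact ((ordLE_der hW0 hW d).neg.mul hV).mono (by simp)

/-- The differential part of a power of the Lax operator is determined by the Sato equation. -/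
theorem pow_pos_eq_of_sato {δ : Derivation ℚ A A} {L W V B : PDO d} (hW0 : W.coeff 0 = 1)
    (hW : W.OrdLE 0) (hV : V.OrdLE 0) (hWV : W * V = 1) (h : L * W = W * D) {n : ℕ}
    (hB : B.IsDiff) (hs : W.der δ + W * Dz (n + 1) = B * W) : (L ^ (n + 1)).pos = B := by
  have h1 := pow_mul_dressing h (n + 1)
  have h2 : L ^ (n + 1) = B - W.der δ * V := by
    have h3 : L ^ (n + 1) * W * V = (B * W - W.der δ) * V := by
      rw [h1, ← hs, Nat.cast_succ]; noncomm_ring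
    rwa [sub_mul, mul_assoc, mul_assoc, hWV, mul_one, mul_one] at h3
  rw [h2, pos_sub, hB.pos_eq, OrdLE.pos_eq (((ordLE_der hW0 hW δ).mul hV).mono (by simp)), sub_zero]

theorem der_eq_neg_mul_of_sato {δ : Derivation ℚ A A} {L W B : PDO d} (h : L * W = W * D) {n : ℕ}
    (hs : W.der δ + W * Dz (n + 1) = B * W) (hB : (L ^ (n + 1)).pos = B) :
    W.der δ = -((L ^ (n + 1)).neg * W) := by
  have h1 := pow_mul_dressing h (n + 1)
  have h2 := pos_add_neg (L ^ (n + 1))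
  rw [hB] at h2
  rw [← h2, add_mul, ← hs, Nat.cast_succ] at h1
  have h3 : W.der δ + (L ^ (n + 1)).neg * W = 0 := by
    have h4 := congrArg (· - W * Dz ((n : ℤ) + 1)) h1
    simp only [sub_self] at h4
    rw [← h4]; abel
  exact eq_neg_of_add_eq_zero_left h3

theorem sato_of_der_eq {δ : Derivation ℚ A A} {L W : PDO d} (h : L * W = W * D) {n : ℕ}
    (hs : W.der δ = -((L ^ (n + 1)).neg * W)) :
    W.der δ + W * Dz (n + 1) = (L ^ (n + 1)).pos * W := by
  have h1 := pow_mul_dressing h (n + 1)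
  rw [← pos_add_neg (L ^ (n + 1)), add_mul, Nat.cast_succ] at h1
  rw [hs, ← h1]; abel

/-- Differentiate `L W = W D`; the term `W Dⁱ` drops out because `L` acts on `W` as right
multiplication by `D`, which commutes with `Dⁱ`. -/
theorem der_lax_of_sato {δ : Derivation ℚ A A} (hδ : ∀ a, δ (d a) = d (δ a)) {L W V B : PDO d}
    (hWV : W * V = 1) (h : L * W = W * D) {i : ℤ} (hs : W.der δ + W * Dz i = B * W) :
    L.der δ = B * L - L * B := by
  refine eq_of_mul_right_eq (W := W) (V := V) hWV ?_
  have h1 := congrArg (der δ) h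
  rw [der_mul hδ, der_mul hδ, ← Dz_one, der_Dz, mul_zero, add_zero, Dz_one] at h1
  have h2 : W.der δ = B * W - W * Dz i := by rw [← hs]; abel
  rw [h2] at h1
  have h3 : L * (W * Dz i) = W * Dz i * D := by
    rw [← mul_assoc, h, mul_assoc, mul_assoc, ← Dz_one, Dz_mul_Dz, Dz_mul_Dz, add_comm]
  rw [mul_sub, sub_mul, h3] at h1
  rw [sub_mul, mul_assoc B, h, mul_assoc L, ← sub_eq_zero]
  rw [← sub_eq_zero] at h1
  rw [← h1, ← mul_assoc B]
  abel

theorem der_lax_of_der_eq {δ : Derivation ℚ A A} (hδ : ∀ a, δ (d a) = d (δ a)) {L W V M : PDO d}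
    (hWV : W * V = 1) (h : L * W = W * D) (hs : W.der δ = M * W) :
    L.der δ = M * L - L * M := by
  refine eq_of_mul_right_eq (W := W) (V := V) hWV ?_
  have h1 := congrArg (der δ) h
  rw [der_mul hδ, der_mul hδ, ← Dz_one, der_Dz, mul_zero, add_zero, Dz_one, hs] at h1
  rw [sub_mul, mul_assoc M, h, mul_assoc L, ← mul_assoc M, ← h1]
  abel

/-! ### Products with integral operators of rank one -/

/-- Write `P a = P(a) + R D`: the factor `D` cancels `D⁻¹`, leaving the differential operator `R b`.
Its value on `f` is `R(σ')`, that is, `R D` applied to `σ`. -/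
theorem IsDiff.mul_const_Dinv_const {P : PDO d} (hP : P.IsDiff) (a b : A) :
    ∃ R : PDO d, R.IsDiff ∧ P * (const a * Dinv * const b) = const (P.apply a) * Dinv * const b + R ∧
      ∀ f σ, d σ = b * f → R.apply f = P.apply (a * σ) - P.apply a * σ := by
  obtain ⟨R, hR, h⟩ := hP.exists_mul_const a
  refine ⟨R * const b, hR.mul (isDiff_const b), ?_, fun f σ hσ => ?_⟩
  · have : P * (const a * Dinv * const b) = P * const a * Dinv * const b := by
      simp only [mul_assoc]
    rw [this, h, add_mul, add_mul, mul_assoc R D Dinv, D_mul_Dinv, mul_one]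
  · rw [mul_apply hR (isDiff_const b), const_apply, ← hσ, ← D_apply σ, ← mul_apply hR isDiff_D]
    have h2 : R * D = P * const a - const (P.apply a) := by rw [h]; abel
    rw [h2, PDO.sub_apply, mul_apply hP (isDiff_const a), const_apply, const_apply]

theorem ordLE_const_Dinv_const (a b : A) : (const a * Dinv * const b : PDO d).OrdLE (-1) :=
  (((ordLE_const a).mul ordLE_Dinv).mul (ordLE_const b)).mono (by simp)

theorem pos_mul_const_Dinv_const {P : PDO d} (hP : P.IsDiff) (a b : A) :
    P * (const a * Dinv * const b) = const (P.apply a) * Dinv * const b +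
      (P * (const a * Dinv * const b)).pos := by
  obtain ⟨R, hR, h, -⟩ := hP.mul_const_Dinv_const a b
  rw [h, pos_add, hR.pos_eq, (ordLE_const_Dinv_const _ _).pos_eq, zero_add]

theorem pos_mul_const_Dinv_const_apply {P : PDO d} (hP : P.IsDiff) {a b f σ : A}
    (hσ : d σ = b * f) : (P * (const a * Dinv * const b)).pos.apply f =
      P.apply (a * σ) - P.apply a * σ := by
  obtain ⟨R, hR, h, h'⟩ := hP.mul_const_Dinv_const a b
  rw [h, pos_add, hR.pos_eq, (ordLE_const_Dinv_const _ _).pos_eq, zero_add, h' f σ hσ]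

end PDO

theorem ordLE_ghostGen {A : Type u} [CommRing A] [Algebra ℚ A] (d : Derivation ℚ A A)
    (Φ Ψ : ℕ → A) (s : ℕ) : (ghostGen d Φ Ψ s).OrdLE (-1) :=
  PDO.OrdLE.sum fun _ _ => PDO.ordLE_const_Dinv_const _ _

/-- Summation along an antidiagonal is insensitive to a shift of one index to the other. -/
theorem sum_antidiagonal_shift {A : Type u} [CommRing A] (G F : ℕ → A) (hF : F 0 = 0) (s : ℕ) :
    ∑ p ∈ Finset.HasAntidiagonal.antidiagonal s, G p.1 * F (p.2 + 1) =
      G 0 * F (s + 1) + ∑ p ∈ Finset.HasAntidiagonal.antidiagonal s, G (p.1 + 1) * F p.2 := by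
  have h1 := Finset.Nat.sum_antidiagonal_succ (n := s) (f := fun p => G p.1 * F p.2)
  have h2 := Finset.Nat.sum_antidiagonal_succ' (n := s) (f := fun p => G p.1 * F p.2)
  rw [h1] at h2
  simp only [hF, mul_zero, zero_add] at h2
  exact h2.symm

/-! ### The operators `(Dᵏ W⁻¹)₊` and their flows. -/

namespace GhostKP

open PDO

variable {A : Type u} [CommRing A] [Algebra ℚ A] {d e : ℕ → Derivation ℚ A A}

/-- The inverse of the dressing operator. -/
noncomputable def Winv (X : GhostKP d e) : PDO (d 0) :=
  (exists_inverse X.dressing_form.1 X.W_ordLE).choose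

theorem Winv_spec (X : GhostKP d e) :
    X.Winv.OrdLE 0 ∧ X.Winv.coeff 0 = 1 ∧ X.Winv * X.W = 1 ∧ X.W * X.Winv = 1 :=
  (exists_inverse X.dressing_form.1 X.W_ordLE).choose_spec

/-- The differential operators `(D ^ k W⁻¹)₊`. -/
noncomputable def satoOp (X : GhostKP d e) (k : ℕ) : PDO (d 0) := (Dz k * X.Winv).pos

theorem isDiff_satoOp (X : GhostKP d e) (k : ℕ) : (X.satoOp k).IsDiff := isDiff_pos _

theorem satoOp_zero (X : GhostKP d e) : X.satoOp 0 = 1 := by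
  ext n
  rw [satoOp, Nat.cast_zero, Dz_zero, one_mul, coeff_pos, coeff_one]
  split_ifs with h1 h2 h2
  · rw [h2, X.Winv_spec.2.1]
  · exact X.Winv_spec.1 n (by omega)
  · omega
  · rfl

/-- The coefficients of `(D ^ k W⁻¹)₊ W`. -/
noncomputable def satoCoeff (X : GhostKP d e) (k m : ℕ) : A := (X.satoOp k * X.W).coeff (-m)

/-- The values of `(D ^ k W⁻¹)₊` on the eigenfunctions. -/
noncomputable def satoValue (X : GhostKP d e) (k m : ℕ) : A := (X.satoOp k).apply (X.Φ m)

theorem satoCoeff_zero_left (X : GhostKP d e) (m : ℕ) : X.satoCoeff 0 m = X.W.coeff (-m) := by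
  rw [satoCoeff, satoOp_zero, one_mul]

theorem satoValue_zero_left (X : GhostKP d e) (m : ℕ) : X.satoValue 0 m = X.Φ m := by
  rw [satoValue, satoOp_zero, one_apply]

/-- The part of `Dᵏ W⁻¹` that is cut off has negative order, also after multiplication by `W`; hence
`(Dᵏ W⁻¹)₊ W = Dᵏ + O(D⁻¹)`. -/
theorem coeff_satoOp_mul_W (X : GhostKP d e) (k : ℕ) {n : ℤ} (hn : 0 ≤ n) :
    (X.satoOp k * X.W).coeff n = if n = k then 1 else 0 := by
  have h : X.satoOp k * X.W = Dz k - (Dz k * X.Winv).neg * X.W := by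
    rw [eq_sub_iff_add_eq, ← add_mul, satoOp, pos_add_neg, mul_assoc, X.Winv_spec.2.2.1, mul_one]
  rw [h, coeff_sub, ((ordLE_neg _).mul X.W_ordLE) n (by omega), sub_zero, coeff_Dz]

theorem satoCoeff_succ_zero (X : GhostKP d e) (k : ℕ) : X.satoCoeff (k + 1) 0 = 0 := by
  rw [satoCoeff, X.coeff_satoOp_mul_W _ (by simp), if_neg (by push_cast; omega)]

theorem ordLE_satoOp_mul_W (X : GhostKP d e) (k : ℕ) : (X.satoOp k * X.W).OrdLE k :=
  fun n hn => by rw [X.coeff_satoOp_mul_W k (by omega), if_neg (by omega)]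

/-- `L^{s+1} = W D^{s+1} W⁻¹`, so the product is `(P_k W) D^{s+1} W⁻¹` with `P_k W = Dᵏ + O(D⁻¹)`.
Each power `Dⁱ W⁻¹` has differential part `P_i`: the leading one gives `i = k + s + 1`, the tail
gives `i ≤ s`. -/
theorem pos_satoOp_mul_pow (X : GhostKP d e) (k s : ℕ) :
    (X.satoOp k * X.L ^ (s + 1)).pos = X.satoOp (k + s + 1) +
      ∑ p ∈ Finset.HasAntidiagonal.antidiagonal s,
        const (X.satoCoeff k (p.1 + 1)) * X.satoOp p.2 := by
  have h1 : X.satoOp k * X.L ^ (s + 1) = X.satoOp k * X.W * Dz (s + 1) * X.Winv := by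
    have h2 := pow_mul_dressing X.dressing (s + 1)
    rw [mul_assoc (X.satoOp k), ← Nat.cast_succ, ← h2, mul_assoc, mul_assoc, X.Winv_spec.2.2.2,
      mul_one]
  have h3 : (X.satoOp k * X.W * Dz (s + 1)).OrdLE ((s + 1 + k : ℕ) : ℤ) :=
    ((X.ordLE_satoOp_mul_W k).mul (ordLE_Dz _)).mono (by push_cast; omega)
  rw [h1, pos_mul_eq_sum h3 X.Winv_spec.1, add_assoc (s + 1) k, Finset.sum_range_add, add_comm]
  congr 1
  · rw [Finset.sum_range_succ, Finset.sum_eq_zero, zero_add]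
    · rw [coeff_mul_Dz, X.coeff_satoOp_mul_W k (by push_cast; omega), if_pos (by push_cast; ring),
        const_one, one_mul, satoOp]
      congr 3; push_cast; ring
    · intro i hi
      have := Finset.mem_range.1 hi
      rw [coeff_mul_Dz, X.coeff_satoOp_mul_W k (by push_cast; omega), if_neg (by push_cast; omega),
        const_zero, zero_mul]
  · rw [← Finset.Nat.sum_antidiagonal_swap]
    simp only [Prod.fst_swap, Prod.snd_swap]
    rw [Finset.Nat.sum_antidiagonal_eq_sum_range_succ (fun a b =>
      const (X.satoCoeff k (b + 1)) * X.satoOp a)]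
    refine Finset.sum_congr rfl fun i hi => ?_
    have := Finset.mem_range.1 hi
    rw [coeff_mul_Dz, satoCoeff, satoOp]
    congr 3; push_cast; omega

theorem pow_pos_eq (X : GhostKP d e) (s : ℕ) : (X.L ^ (s + 1)).pos = X.satoOp (s + 1) +
    ∑ p ∈ Finset.HasAntidiagonal.antidiagonal s,
      const (X.W.coeff (-((p.1 + 1 : ℕ) : ℤ))) * X.satoOp p.2 := by
  have := X.pos_satoOp_mul_pow 0 s
  simpa only [satoOp_zero, one_mul, zero_add, satoCoeff_zero_left] using this

/-- The inverse of `W` evolves by `-W⁻¹ M_s`. Truncating `Dᵏ W⁻¹` first changes nothing, since the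
negative part times `M_s` has negative order. -/
theorem der_satoOp_ghost (X : GhostKP d e) (hde : ∀ m n a, d m (e n a) = e n (d m a)) (s k : ℕ) :
    (X.satoOp k).der (e s) = -(X.satoOp k * ghostGen (d 0) X.Φ X.Ψ s).pos := by
  have h1 := der_inverse (fun a => (hde 0 s a).symm) X.Winv_spec.2.2.1 X.Winv_spec.2.2.2
  rw [X.dressing_ghost, mul_assoc, mul_assoc, X.Winv_spec.2.2.2, mul_one] at h1
  rw [satoOp, pos_der, der_mul (fun a => (hde 0 s a).symm), der_Dz, zero_mul, zero_add, h1, mul_neg,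
    pos_neg, ← mul_assoc]
  congr 1
  conv_lhs => rw [← pos_add_neg (Dz k * X.Winv)]
  rw [add_mul, pos_add, OrdLE.pos_eq (((ordLE_neg _).mul (ordLE_ghostGen _ _ _ s)).mono (by simp)),
    add_zero]

/-- The values obey the same law as the `Φ_m`: differentiating the operator produces `P_k(Φ_a
S_{mb}) - P_k(Φ_a) S_{mb}` with a minus sign, and its first part cancels against `P_k` applied to
the flow of `Φ_m`. -/
theorem derivation_satoValue_ghost (X : GhostKP d e) (hde : ∀ m n a, d m (e n a) = e n (d m a))
    {S : ℕ → ℕ → A} (hS : ∀ j k, d 0 (S j k) = X.Φ j * X.Ψ k)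
    (hΦ : ∀ s k, e s (X.Φ k) =
      ∑ p ∈ Finset.HasAntidiagonal.antidiagonal s, X.Φ p.1 * S k p.2 - X.Φ (k + s + 1))
    (s k m : ℕ) : e s (X.satoValue k m) =
      ∑ p ∈ Finset.HasAntidiagonal.antidiagonal s, X.satoValue k p.1 * S m p.2 -
        X.satoValue k (m + s + 1) := by
  have h1 : ∀ p : ℕ × ℕ, (X.satoOp k * (const (X.Φ p.1) * Dinv * const (X.Ψ p.2))).pos.apply
      (X.Φ m) = (X.satoOp k).apply (X.Φ p.1 * S m p.2) - X.satoValue k p.1 * S m p.2 := fun p =>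
    pos_mul_const_Dinv_const_apply (X.isDiff_satoOp k) (by rw [hS, mul_comm])
  rw [satoValue, der_apply (fun a => (hde 0 s a).symm), X.der_satoOp_ghost hde, hΦ, ghostGen,
    Finset.mul_sum, pos_sum, PDO.neg_apply, PDO.sum_apply, apply_sub, apply_sum]
  simp only [h1, Finset.sum_sub_distrib]
  rw [← satoValue]
  ring

theorem derivation_satoCoeff_ghost (X : GhostKP d e) (hde : ∀ m n a, d m (e n a) = e n (d m a))
    (k m : ℕ) : e 0 (X.satoCoeff k m) = X.satoValue k 0 * ghostRow X.W X.Ψ 0 m := by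
  have h1 := pos_mul_const_Dinv_const (X.isDiff_satoOp k) (X.Φ 0) (X.Ψ 0)
  have h2 : (X.satoOp k * X.W).der (e 0) =
      const (X.satoValue k 0) * (Dinv * const (X.Ψ 0) * X.W) := by
    rw [der_mul (fun a => (hde 0 0 a).symm), X.der_satoOp_ghost hde, X.der_W_zero, ghostGen_zero]
    have h3 : X.satoOp k * (const (X.Φ 0) * Dinv * const (X.Ψ 0) * X.W) =
        X.satoOp k * (const (X.Φ 0) * Dinv * const (X.Ψ 0)) * X.W := by simp only [mul_assoc]
    rw [h3, neg_mul, neg_add_eq_sub, ← sub_mul, sub_eq_of_eq_add h1, satoValue]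
    simp only [mul_assoc]
  rw [satoCoeff, ← coeff_der, h2, coeff_const_mul]; rfl

/-- The derivative of `P_k` plus `P_k (L^{s+1})₊` is `(P_k L^{s+1})₊`, whose expansion in the `P_i`
is known. -/
theorem derivation_satoValue (X : GhostKP d e) (hdd : ∀ m n a, d m (d n a) = d n (d m a))
    (s k m : ℕ) : d s (X.satoValue k m) = X.satoValue (k + s + 1) m +
      ∑ p ∈ Finset.HasAntidiagonal.antidiagonal s,
        X.satoCoeff k (p.1 + 1) * X.satoValue p.2 m := by
  have h1 := der_inverse (hdd s 0) X.Winv_spec.2.2.1 X.Winv_spec.2.2.2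
  rw [X.dressing_flow, mul_neg, neg_mul, neg_neg, mul_assoc, mul_assoc, X.Winv_spec.2.2.2,
    mul_one] at h1
  have h2 : (X.satoOp k).der (d s) = (X.satoOp k * (X.L ^ (s + 1)).neg).pos := by
    rw [satoOp, pos_der, der_mul (hdd s 0), der_Dz, zero_mul, zero_add, h1, ← mul_assoc]
    conv_lhs => rw [← pos_add_neg (Dz k * X.Winv)]
    rw [add_mul, pos_add, OrdLE.pos_eq (((ordLE_neg _).mul (ordLE_neg _)).mono (by simp)),
      add_zero]
  have h3 : (X.satoOp k).der (d s) + X.satoOp k * (X.L ^ (s + 1)).pos =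
      (X.satoOp k * X.L ^ (s + 1)).pos := by
    conv_rhs => rw [← pos_add_neg (X.L ^ (s + 1))]
    rw [h2, mul_add, pos_add, ((X.isDiff_satoOp k).mul (isDiff_pos _)).pos_eq, add_comm]
  rw [satoValue, der_apply (hdd s 0), X.eigen, ← mul_apply (X.isDiff_satoOp k) (isDiff_pos _),
    ← PDO.add_apply, h3, pos_satoOp_mul_pow, PDO.add_apply, PDO.sum_apply]
  simp only [const_mul_apply]
  rfl

theorem derivation_W_coeff_flow (X : GhostKP d e) (s m : ℕ) : d s (X.W.coeff (-m)) =
    X.satoCoeff (s + 1) m + ∑ p ∈ Finset.HasAntidiagonal.antidiagonal s,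
      X.W.coeff (-((p.1 + 1 : ℕ) : ℤ)) * X.satoCoeff p.2 m -
        X.W.coeff (-((m + s + 1 : ℕ) : ℤ)) := by
  have h1 := sato_of_der_eq X.dressing (X.dressing_flow s)
  have h2 := congrArg (fun P => coeff P (-m)) h1
  simp only [coeff_add, coeff_mul_Dz, coeff_der, pow_pos_eq, add_mul, Finset.sum_mul, coeff_sum,
    mul_assoc, coeff_const_mul] at h2
  rw [show -((m + s + 1 : ℕ) : ℤ) = -m - (s + 1) by push_cast; ring]
  simp only [satoCoeff]
  linear_combination h2

end GhostKP

section Signs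

variable {A : Type u} [CommRing A]

theorem isUnit_prod_sign (n : ℕ) : IsUnit (∏ i ∈ Finset.range n, (-1 : A) ^ i) := by
  rw [Finset.prod_pow_eq_pow_sum]; exact isUnit_one.neg.pow _

/-- The factor `q` cancels, and the signs combine to `(-1)^{n+1} (-1)ⁿ = -1`, whatever the parity of
`n`. -/
theorem signed_kernel (a b : ℕ → A) (n : ℕ) (q : A) (hq : IsUnit q) (hb : ∀ n, IsUnit (b n))
    (h : ∀ n, a (n + 1) = (∏ i ∈ Finset.range n, (-1) ^ i) * (b n * q)) :
    a (n + 3) * a (n + 1) * Ring.inverse (a (n + 2)) ^ 2 =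
      -(b (n + 2) * b n * Ring.inverse (b (n + 1)) ^ 2) := by
  have hs : (∏ i ∈ Finset.range (n + 1), (-1 : A) ^ i) * ∏ i ∈ Finset.range (n + 1), (-1) ^ i = 1 := by
    rw [← Finset.prod_mul_distrib]
    exact Finset.prod_eq_one fun i _ => by rw [← mul_pow]; simp
  have hu : IsUnit (a (n + 2)) := by
    rw [h]; exact (isUnit_prod_sign _).mul ((hb _).mul hq)
  have h1 := Ring.mul_inverse_cancel _ hu
  have h2 := Ring.mul_inverse_cancel _ (hb (n + 1))
  have h3 : a (n + 3) * a (n + 1) * b (n + 1) ^ 2 = -(b (n + 2) * b n * a (n + 2) ^ 2) := by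
    have hp : (-1 : A) ^ (n + 1) = -(-1) ^ n := by rw [pow_succ]; ring
    rw [h, h, h, Finset.prod_range_succ _ (n + 1), Finset.prod_range_succ _ n, hp]
    have : (-1 : A) ^ n * (-1) ^ n = 1 := by rw [← mul_pow]; simp
    ring
  linear_combination (Ring.inverse (a (n + 2)) ^ 2 * Ring.inverse (b (n + 1)) ^ 2) * h3 -
    a (n + 3) * a (n + 1) * Ring.inverse (a (n + 2)) ^ 2 *
      (b (n + 1) * Ring.inverse (b (n + 1)) + 1) * h2 -
    b (n + 2) * b n * Ring.inverse (b (n + 1)) ^ 2 * (a (n + 2) * Ring.inverse (a (n + 2)) + 1) * h1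

end Signs

/-! ### Construction of the dual system. -/

namespace GhostKP

open PDO

variable {A : Type u} [CommRing A] [Algebra ℚ A] {d e : ℕ → Derivation ℚ A A}

/-- The dual eigenfunctions `Φ̄`. -/
noncomputable def dualΦ (X : GhostKP d e) (m : ℕ) : A := Ring.inverse (X.Φ 0) * X.W.coeff (-m)

/-- The coefficients of the operators `D̄⁻¹ Ψ̄_k W̄`. -/
noncomputable def dualRow (X : GhostKP d e) (k m : ℕ) : A :=
  X.satoValue (k + 1) m - X.satoValue (k + 1) 0 * (Ring.inverse (X.Φ 0) * X.Φ m)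

/-- The dual adjoint eigenfunctions `Ψ̄`. -/
noncomputable def dualΨ (X : GhostKP d e) (k : ℕ) : A := X.dualRow k 1

/-- The dual squared eigenfunction potentials. -/
noncomputable def dualS (X : GhostKP d e) (m k : ℕ) : A :=
  X.satoCoeff (k + 1) m - X.satoValue (k + 1) 0 * X.dualΦ m

theorem dualΦ_zero (X : GhostKP d e) : X.dualΦ 0 = Ring.inverse (X.Φ 0) := by
  rw [dualΦ, Nat.cast_zero, neg_zero, X.dressing_form.1, mul_one]

theorem isUnit_dualΦ (X : GhostKP d e) : IsUnit (X.dualΦ 0) := by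
  rw [dualΦ_zero]; exact X.isUnit_Φ.ringInverse

theorem inverse_dualΦ (X : GhostKP d e) : Ring.inverse (X.dualΦ 0) = X.Φ 0 := by
  rw [dualΦ_zero]
  have h1 := Ring.mul_inverse_cancel _ X.isUnit_Φ.ringInverse
  have h2 := Ring.mul_inverse_cancel _ X.isUnit_Φ
  linear_combination X.Φ 0 * h1 - Ring.inverse (Ring.inverse (X.Φ 0)) * h2

theorem dualRow_zero (X : GhostKP d e) (k : ℕ) : X.dualRow k 0 = 0 := by
  rw [dualRow, Ring.inverse_mul_cancel _ X.isUnit_Φ, mul_one, sub_self]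

theorem dualW_eq (X : GhostKP d e) : X.dualW = ofSeq fun m => Ring.inverse (X.Φ 0) * X.Φ m := by
  rw [dualW, ofSeq_mul]

theorem derivation_dualRow_ghost (X : GhostKP d e) (hde : ∀ m n a, d m (e n a) = e n (d m a))
    (k m : ℕ) : e 0 (X.dualRow k m) =
      X.dualΨ k * (Ring.inverse (X.Φ 0) * X.Φ m) - X.dualRow k (m + 1) := by
  obtain ⟨S, hS, hΦ, hΨ⟩ := X.ghost
  have hv : ∀ m, e 0 (X.satoValue (k + 1) m) =
      X.satoValue (k + 1) 0 * S m 0 - X.satoValue (k + 1) (m + 1) := fun m => by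
    simpa using X.derivation_satoValue_ghost hde hS hΦ 0 (k + 1) m
  have hΦ0 : ∀ m, e 0 (X.Φ m) = X.Φ 0 * S m 0 - X.Φ (m + 1) := fun m => by simpa using hΦ 0 m
  simp only [dualΨ, dualRow, map_sub, Derivation.leibniz, smul_eq_mul, hv, hΦ0,
    derivation_inverse X.isUnit_Φ, zero_add]
  have h := Ring.mul_inverse_cancel _ X.isUnit_Φ
  linear_combination (X.satoValue (k + 1) 0 * X.Φ m * Ring.inverse (X.Φ 0) * S 0 0 -
    X.satoValue (k + 1) 0 * S m 0) * h

/-- Coefficientwise this is the first ghost flow of `dualRow`; the vanishing at `m = 0` removes the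
term in `D̄`. -/
theorem ofSeq_dualRow (X : GhostKP d e) (hde : ∀ m n a, d m (e n a) = e n (d m a)) (k : ℕ) :
    D * ofSeq (X.dualRow k) = const (X.dualΨ k) * X.dualW := by
  have h1 := ofSeq_mul_Dz (d := e 0) (X.dualRow k) 0
  simp only [Finset.Nat.antidiagonal_zero, Finset.sum_singleton, Nat.cast_zero, zero_add,
    add_zero, dualRow_zero, const_zero, zero_mul] at h1
  rw [D_mul, h1, der_ofSeq, ← ofSeq_add, dualW_eq, ← ofSeq_mul]
  refine congrArg ofSeq (funext fun m => ?_)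
  rw [X.derivation_dualRow_ghost hde]; ring

theorem Dinv_mul_dualΨ_mul_dualW (X : GhostKP d e) (hde : ∀ m n a, d m (e n a) = e n (d m a))
    (k : ℕ) : Dinv * const (X.dualΨ k) * X.dualW = ofSeq (X.dualRow k) := by
  rw [mul_assoc, ← X.ofSeq_dualRow hde, ← mul_assoc, Dinv_mul_D, one_mul]

theorem derivation_ratio (X : GhostKP d e) (hdd : ∀ m n a, d m (d n a) = d n (d m a)) (s m : ℕ) :
    d s (Ring.inverse (X.Φ 0) * X.Φ m) =
      ∑ p ∈ Finset.HasAntidiagonal.antidiagonal s, X.dualΦ p.1 * X.dualRow p.2 m := by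
  have hv : ∀ m, d s (X.Φ m) = X.satoValue (s + 1) m +
      ∑ p ∈ Finset.HasAntidiagonal.antidiagonal s,
        X.W.coeff (-((p.1 + 1 : ℕ) : ℤ)) * X.satoValue p.2 m := fun m => by
    have := X.derivation_satoValue hdd s 0 m
    simpa only [satoValue_zero_left, satoCoeff_zero_left, zero_add] using this
  -- `dualRow i m` is `F (i + 1)`. Since `F 0 = 0`, the index can be shifted along the antidiagonal,
  -- which matches the sum containing `w_{a+1}`. The same device serves for the flows of `dualΦ` and
  -- `dualΨ`.
  let F : ℕ → A := fun i => X.satoValue i m - X.satoValue i 0 * (Ring.inverse (X.Φ 0) * X.Φ m)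
  have hF : F 0 = 0 := by
    simp only [F, satoValue_zero_left]
    rw [Ring.mul_inverse_cancel_left _ _ X.isUnit_Φ, sub_self]
  have h1 := sum_antidiagonal_shift X.dualΦ F hF s
  have h2 : ∑ p ∈ Finset.HasAntidiagonal.antidiagonal s, X.dualΦ p.1 * X.dualRow p.2 m =
      ∑ p ∈ Finset.HasAntidiagonal.antidiagonal s, X.dualΦ p.1 * F (p.2 + 1) := rfl
  rw [h2, h1, Derivation.leibniz, hv, derivation_inverse X.isUnit_Φ, hv, dualΦ_zero]
  simp only [F, dualΦ, smul_eq_mul, mul_sub, Finset.sum_sub_distrib, mul_add, add_mul,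
    Finset.mul_sum, Finset.sum_mul, mul_neg]
  have e1 : ∀ p : ℕ × ℕ, Ring.inverse (X.Φ 0) * (X.W.coeff (-((p.1 + 1 : ℕ) : ℤ)) *
      X.satoValue p.2 m) = Ring.inverse (X.Φ 0) * X.W.coeff (-((p.1 + 1 : ℕ) : ℤ)) *
      X.satoValue p.2 m := fun p => by ring
  have e2 : ∀ p : ℕ × ℕ, X.Φ m * (X.W.coeff (-((p.1 + 1 : ℕ) : ℤ)) * X.satoValue p.2 0 *
      Ring.inverse (X.Φ 0) * Ring.inverse (X.Φ 0)) =
      Ring.inverse (X.Φ 0) * X.W.coeff (-((p.1 + 1 : ℕ) : ℤ)) *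
        (X.satoValue p.2 0 * (Ring.inverse (X.Φ 0) * X.Φ m)) := fun p => by ring
  simp only [e1, e2]
  ring

theorem der_dualW_flow (X : GhostKP d e) (hdd : ∀ m n a, d m (d n a) = d n (d m a))
    (hde : ∀ m n a, d m (e n a) = e n (d m a)) (s : ℕ) :
    X.dualW.der (d s) = ghostGen (e 0) X.dualΦ X.dualΨ s * X.dualW := by
  rw [ghostGen, Finset.sum_mul]
  simp only [mul_assoc]
  simp only [← mul_assoc Dinv, X.Dinv_mul_dualΨ_mul_dualW hde, ← ofSeq_mul, ← ofSeq_sum]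
  rw [dualW_eq, der_ofSeq]
  exact congrArg ofSeq (funext fun m => X.derivation_ratio hdd s m)

theorem derivation_dualS (X : GhostKP d e) (hde : ∀ m n a, d m (e n a) = e n (d m a)) (m k : ℕ) :
    e 0 (X.dualS m k) = X.dualΦ m * X.dualΨ k := by
  obtain ⟨S, hS, hΦ, hΨ⟩ := X.ghost
  have hv : e 0 (X.satoValue (k + 1) 0) =
      X.satoValue (k + 1) 0 * S 0 0 - X.satoValue (k + 1) 1 := by
    simpa using X.derivation_satoValue_ghost hde hS hΦ 0 (k + 1) 0
  have hΦ0 : e 0 (X.Φ 0) = X.Φ 0 * S 0 0 - X.Φ 1 := by simpa using hΦ 0 0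
  have hw : e 0 (X.W.coeff (-m)) = X.Φ 0 * ghostRow X.W X.Ψ 0 m := by
    simpa using X.derivation_W_coeff 0 m
  simp only [dualS, dualΨ, dualRow, dualΦ, map_sub, Derivation.leibniz, smul_eq_mul, hv, hΦ0,
    hw, X.derivation_satoCoeff_ghost hde, derivation_inverse X.isUnit_Φ]
  have h := Ring.mul_inverse_cancel _ X.isUnit_Φ
  linear_combination (X.satoValue (k + 1) 0 * X.W.coeff (-m) * Ring.inverse (X.Φ 0) * S 0 0 -
    X.satoValue (k + 1) 0 * ghostRow X.W X.Ψ 0 m) * h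

theorem derivation_inverse_flow (X : GhostKP d e) (hdd : ∀ m n a, d m (d n a) = d n (d m a))
    (s : ℕ) : d s (Ring.inverse (X.Φ 0)) = -(Ring.inverse (X.Φ 0) * Ring.inverse (X.Φ 0) *
      (X.satoValue (s + 1) 0 + ∑ p ∈ Finset.HasAntidiagonal.antidiagonal s,
        X.W.coeff (-((p.1 + 1 : ℕ) : ℤ)) * X.satoValue p.2 0)) := by
  have := X.derivation_satoValue hdd s 0 0
  simp only [satoValue_zero_left, satoCoeff_zero_left, zero_add] at this
  rw [derivation_inverse X.isUnit_Φ, this]; ring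

theorem derivation_dualΦ_flow (X : GhostKP d e) (hdd : ∀ m n a, d m (d n a) = d n (d m a))
    (s k : ℕ) : d s (X.dualΦ k) = ∑ p ∈ Finset.HasAntidiagonal.antidiagonal s,
      X.dualΦ p.1 * X.dualS k p.2 - X.dualΦ (k + s + 1) := by
  let F : ℕ → A := fun i => X.satoCoeff i k - X.satoValue i 0 * X.dualΦ k
  have hF : F 0 = 0 := by
    simp only [F, satoValue_zero_left, satoCoeff_zero_left, dualΦ]
    rw [Ring.mul_inverse_cancel_left _ _ X.isUnit_Φ, sub_self]
  have h1 := sum_antidiagonal_shift X.dualΦ F hF s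
  have h2 : ∑ p ∈ Finset.HasAntidiagonal.antidiagonal s, X.dualΦ p.1 * X.dualS k p.2 =
      ∑ p ∈ Finset.HasAntidiagonal.antidiagonal s, X.dualΦ p.1 * F (p.2 + 1) := rfl
  rw [h2, h1, dualΦ_zero]
  simp only [F, dualΦ]
  rw [Derivation.leibniz, derivation_W_coeff_flow, X.derivation_inverse_flow hdd]
  simp only [smul_eq_mul, mul_sub, Finset.sum_sub_distrib, mul_add,
    Finset.mul_sum, mul_neg]
  have e1 : ∀ p : ℕ × ℕ, Ring.inverse (X.Φ 0) * (X.W.coeff (-((p.1 + 1 : ℕ) : ℤ)) *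
      X.satoCoeff p.2 k) = Ring.inverse (X.Φ 0) * X.W.coeff (-((p.1 + 1 : ℕ) : ℤ)) *
      X.satoCoeff p.2 k := fun p => by ring
  have e2 : ∀ p : ℕ × ℕ, X.W.coeff (-k) * (Ring.inverse (X.Φ 0) * Ring.inverse (X.Φ 0) *
      (X.W.coeff (-((p.1 + 1 : ℕ) : ℤ)) * X.satoValue p.2 0)) =
      Ring.inverse (X.Φ 0) * X.W.coeff (-((p.1 + 1 : ℕ) : ℤ)) *
        (X.satoValue p.2 0 * (Ring.inverse (X.Φ 0) * X.W.coeff (-k))) := fun p => by ring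
  simp only [e1, e2]
  ring

theorem derivation_dualΨ_flow (X : GhostKP d e) (hdd : ∀ m n a, d m (d n a) = d n (d m a))
    (s k : ℕ) : d s (X.dualΨ k) = ∑ p ∈ Finset.HasAntidiagonal.antidiagonal s,
      X.dualΨ p.2 * X.dualS p.1 k + X.dualΨ (k + s + 1) := by
  let F : ℕ → A := fun i => X.satoValue i 1 - X.satoValue i 0 * (Ring.inverse (X.Φ 0) * X.Φ 1)
  have hF : F 0 = 0 := by
    simp only [F, satoValue_zero_left]
    rw [Ring.mul_inverse_cancel_left _ _ X.isUnit_Φ, sub_self]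
  have h1 := sum_antidiagonal_shift (fun i => X.dualS i k) F hF s
  have h1' := sum_antidiagonal_shift X.dualΦ F hF s
  have h2 : ∑ p ∈ Finset.HasAntidiagonal.antidiagonal s, X.dualΨ p.2 * X.dualS p.1 k =
      ∑ p ∈ Finset.HasAntidiagonal.antidiagonal s, X.dualS p.1 k * F (p.2 + 1) :=
    Finset.sum_congr rfl fun p _ => mul_comm _ _
  have h3 : ∑ p ∈ Finset.HasAntidiagonal.antidiagonal s, X.dualΦ p.1 * X.dualRow p.2 1 =
      ∑ p ∈ Finset.HasAntidiagonal.antidiagonal s, X.dualΦ p.1 * F (p.2 + 1) := rfl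
  have h4 : X.dualΨ (k + s + 1) = F (k + 1 + s + 1) := by
    simp only [F, dualΨ, dualRow, show k + s + 1 + 1 = k + 1 + s + 1 by ring]
  have h5 : X.dualS 0 k = -(X.satoValue (k + 1) 0 * X.dualΦ 0) := by
    rw [dualS, satoCoeff_succ_zero, zero_sub]
  rw [h2, h1, h4, dualΨ, dualRow, map_sub, Derivation.leibniz, X.derivation_ratio hdd, h3, h1',
    X.derivation_satoValue hdd, X.derivation_satoValue hdd, h5]
  simp only [dualS, F, smul_eq_mul, mul_sub, sub_mul, Finset.sum_sub_distrib, mul_add,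
    Finset.mul_sum]
  have e1 : ∀ p : ℕ × ℕ, X.satoValue (k + 1) 0 * X.dualΦ (p.1 + 1) * X.satoValue p.2 1 =
      X.satoValue (k + 1) 0 * (X.dualΦ (p.1 + 1) * X.satoValue p.2 1) := fun p => by ring
  have e2 : ∀ p : ℕ × ℕ, X.satoValue (k + 1) 0 * X.dualΦ (p.1 + 1) *
      (X.satoValue p.2 0 * (Ring.inverse (X.Φ 0) * X.Φ 1)) = X.satoValue (k + 1) 0 *
      (X.dualΦ (p.1 + 1) * (X.satoValue p.2 0 * (Ring.inverse (X.Φ 0) * X.Φ 1))) :=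
    fun p => by ring
  have e3 : ∀ p : ℕ × ℕ, X.satoCoeff (k + 1) (p.1 + 1) *
      (X.satoValue p.2 0 * (Ring.inverse (X.Φ 0) * X.Φ 1)) =
      Ring.inverse (X.Φ 0) * X.Φ 1 * (X.satoCoeff (k + 1) (p.1 + 1) * X.satoValue p.2 0) :=
    fun p => by ring
  simp only [e1, e2, e3]
  ring

/-- For `G = D̄⁻¹ Ψ̄_k W̄`, the flow has the form `∂G + G D̄^{n+1} = Q W̄` with `Q` differential.
Applying `D̄` gives `D̄ Q = ∂Ψ̄_k + Ψ̄_k M̄_n`, and the adjoint of the left side kills constants. -/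
theorem dualΨ_adjoint (X : GhostKP d e) (hee : ∀ m n a, e m (e n a) = e n (e m a))
    (hde : ∀ m n a, d m (e n a) = e n (d m a)) (n k : ℕ) :
    e n (X.dualΨ k) = -(X.ghostZS n).adjoint.apply (X.dualΨ k) := by
  obtain ⟨S, hS, hΦ, hΨ⟩ := X.ghost
  have hflow := potential_flow hee (hde 0) X.indep hS hΦ hΨ
  have hop := ghostOp_mul_ofSeq X.isUnit_Φ (f := X.Φ) (S := S) (δ := e 0)
    (fun m => by simpa using hΦ 0 m) rfl (fun j k => by simpa using hflow 0 j k)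
  have hgen := der_ofSeq_add_mul_Dz (δ := e 0)
    (X.derivation_satoValue_ghost hde hS hΦ n (k + 1))
  obtain ⟨c, hc⟩ : ∃ c, c = X.satoValue (k + 1) 0 := ⟨_, rfl⟩
  obtain ⟨V, -, -, -, hV⟩ := exists_inverse X.dualW_coeff_zero X.dualW_ordLE
  have hG : ofSeq (X.dualRow k) = ofSeq (X.satoValue (k + 1)) - const c * X.dualW := by
    rw [dualW_eq, ← ofSeq_mul, ← ofSeq_sub, hc]
    rfl
  obtain ⟨Q, hQ, hQG⟩ : ∃ Q : PDO (e 0), Q.IsDiff ∧ (ofSeq (X.dualRow k)).der (e n) +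
      ofSeq (X.dualRow k) * Dz (n + 1) = Q * X.dualW := by
    -- `G` is the series of the values `P_{k+1}(Φ_m)` minus `c W̄`. The first part follows the ghost
    -- law of the `Φ_m`, the second the Sato equation of `W̄`.
    refine ⟨∑ p ∈ Finset.HasAntidiagonal.antidiagonal n, const (X.satoValue (k + 1) p.1) *
      ghostOp (e 0) (X.Φ 0) (S 0) p.2 - const (e n c) - const c * X.ghostZS n,
      ((IsDiff.sum fun p _ => (isDiff_const _).mul (isDiff_ghostOp _ _ _ _)).sub
        (isDiff_const _)).sub ((isDiff_const _).mul (X.isDiff_ghostZS n)), ?_⟩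
    rw [hG, der_sub, sub_mul (ofSeq _), sub_add_sub_comm, hgen, sub_mul, sub_mul, Finset.sum_mul,
      mul_assoc (const c), mul_assoc (const c), ← X.der_dualW hee hde, der_mul (hee n 0), der_const,
      mul_add]
    simp only [mul_assoc, ← hop, dualW]
    abel
  have hDQ : D * Q = const (e n (X.dualΨ k)) + const (X.dualΨ k) * X.ghostZS n := by
    refine eq_of_mul_right_eq hV ?_
    have h1 : (D * ofSeq (X.dualRow k) : PDO (e 0)).der (e n) =
        D * (ofSeq (X.dualRow k) : PDO (e 0)).der (e n) := by
      rw [der_mul (hee n 0), ← Dz_one, der_Dz, zero_mul, zero_add]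
    rw [mul_assoc, ← hQG, mul_add, ← h1, ← mul_assoc, X.ofSeq_dualRow hde, der_mul (hee n 0),
      der_const, add_mul, mul_assoc (const (X.dualΨ k)), mul_assoc (const (X.dualΨ k)),
      ← X.der_dualW hee hde]
    noncomm_ring
  -- The term of degree 0 of `(D̄ Q)* = -Q* D̄` is 0, while that of `(Ψ̄_k M̄_n)* = M̄_n* Ψ̄_k` is
  -- the value of `M̄_n*` on `Ψ̄_k`.
  have h2 := congrArg (fun P => (adjoint P).coeff 0) hDQ
  simp only [adjoint_mul, adjoint_add, adjoint_D, adjoint_const, mul_neg, coeff_neg, coeff_add,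
    hQ.adjoint.mul_D_coeff_zero, ← apply_eq, coeff_const, if_true] at h2
  linear_combination -h2

theorem Wr_dualΦ (X : GhostKP d e) (hde : ∀ m n a, d m (e n a) = e n (d m a)) (n : ℕ) :
    Wr (e 0) X.dualΦ (n + 1) = (∏ i ∈ Finset.range n, (-1) ^ i) *
      (Wr (d 0) X.Ψ n * Ring.inverse (X.Φ 0)) := by
  obtain ⟨S, hS, hΦ, hΨ⟩ := X.ghost
  exact Wr_dual (fun a => (hde 0 0 a).symm) X.dressing_form.1 X.W_ordLE X.isUnit_Φ (hS 0)
    X.der_W_zero (fun k => by simpa using hΨ 0 k) n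

/-- `Wr_dual` with the two families of times exchanged: the functions it then concerns, `w̄_m/Φ̄_0`,
are the original `Φ_m`. -/
theorem Wr_dualΨ (X : GhostKP d e) (hdd : ∀ m n a, d m (d n a) = d n (d m a))
    (hde : ∀ m n a, d m (e n a) = e n (d m a)) (n : ℕ) :
    Wr (d 0) X.Φ (n + 1) = (∏ i ∈ Finset.range n, (-1) ^ i) *
      (Wr (e 0) X.dualΨ n * X.Φ 0) := by
  have h1 := Wr_dual (δ := d 0) (hde 0 0) X.dualW_coeff_zero X.dualW_ordLE X.isUnit_dualΦ
    (X.derivation_dualS hde 0) (by simpa [ghostGen] using X.der_dualW_flow hdd hde 0)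
    (fun k => by simpa using X.derivation_dualΨ_flow hdd 0 k) n
  have h2 : (fun m : ℕ => Ring.inverse (X.dualΦ 0) * X.dualW.coeff (-m)) = X.Φ := by
    funext m
    rw [dualW_coeff, inverse_dualΦ, Ring.mul_inverse_cancel_left _ _ X.isUnit_Φ]
  rwa [h2, inverse_dualΦ] at h1

/-- The ghost system of a scalar KP system with ghost flows. -/
noncomputable def dual (X : GhostKP d e) (hdd : ∀ m n a, d m (d n a) = d n (d m a))
    (hee : ∀ m n a, e m (e n a) = e n (e m a)) (hde : ∀ m n a, d m (e n a) = e n (d m a)) :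
    GhostKP e d :=
  let V := (exists_inverse X.dualW_coeff_zero X.dualW_ordLE).choose
  have hV : V.OrdLE 0 ∧ V.coeff 0 = 1 ∧ V * X.dualW = 1 ∧ X.dualW * V = 1 :=
    (exists_inverse X.dualW_coeff_zero X.dualW_ordLE).choose_spec
  have hL : X.dualW * D * V * X.dualW = X.dualW * D := by
    rw [mul_assoc, hV.2.2.1, mul_one]
  have hB : ∀ n, ((X.dualW * D * V) ^ (n + 1)).pos = X.ghostZS n := fun n =>
    pow_pos_eq_of_sato X.dualW_coeff_zero X.dualW_ordLE hV.1 hV.2.2.2 hL (X.isDiff_ghostZS n)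
      (X.der_dualW hee hde n)
  { L := X.dualW * D * V
    W := X.dualW
    Φ := X.dualΦ
    Ψ := X.dualΨ
    lax_form := by
      have h := lax_sub_D X.dualW_coeff_zero X.dualW_ordLE hV.1 hV.2.2.2 hL
      have h' : ∀ n, -1 < n → (X.dualW * D * V).coeff n = if n = 1 then 1 else 0 := fun n hn => by
        rw [← coeff_Dz (d := e 0), Dz_one, ← sub_eq_zero, ← coeff_sub]; exact h n hn
      refine ⟨(h' 1 (by norm_num)).trans (if_pos rfl),
        (h' 0 (by norm_num)).trans (if_neg (by norm_num)), fun n hn => (h' n (by omega)).trans (if_neg (by omega))⟩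
    dressing_form := ⟨X.dualW_coeff_zero, X.dualW_ordLE⟩
    dressing := hL
    lax_flow := fun n => by
      rw [hB]
      exact der_lax_of_sato (hee n 0) hV.2.2.2 hL (X.der_dualW hee hde n)
    dressing_flow := fun n => der_eq_neg_mul_of_sato hL (X.der_dualW hee hde n) (hB n)
    eigen := fun n k => by
      rw [hB]
      exact X.derivation_dualΦ hde n k
    adj_eigen := fun n k => by
      rw [← adjoint_pow, pos_adjoint, hB]
      exact X.dualΨ_adjoint hee hde n k
    lax_ghost := fun s => der_lax_of_der_eq (fun a => hde s 0 a) hV.2.2.2 hL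
      (X.der_dualW_flow hdd hde s)
    dressing_ghost := X.der_dualW_flow hdd hde
    ghost := ⟨X.dualS, X.derivation_dualS hde, X.derivation_dualΦ_flow hdd,
      X.derivation_dualΨ_flow hdd⟩
    indep := fun k => by
      rcases k with _ | n
      · rw [Wr_zero]; exact isUnit_one
      · rw [X.Wr_dualΦ hde]
        exact (isUnit_prod_sign n).mul ((X.adj_indep n).mul X.isUnit_Φ.ringInverse)
    adj_indep := fun n => by
      -- One index higher: the Wronskian of `n` functions `Ψ̄` is a factor of that of `n + 1`
      -- functions `Φ`.
      have h := X.indep (n + 1)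
      rw [X.Wr_dualΨ hdd hde] at h
      exact isUnit_of_mul_isUnit_left (isUnit_of_mul_isUnit_right h) }

theorem ghostZS_eq_of_dual (X : GhostKP d e)
    (hee : ∀ m n a, e m (e n a) = e n (e m a)) (hde : ∀ m n a, d m (e n a) = e n (d m a))
    {Y : GhostKP e d} (hW : Y.W = X.dualW) (s : ℕ) : (Y.L ^ (s + 1)).pos = X.ghostZS s :=
  pow_pos_eq_of_sato Y.dressing_form.1 Y.W_ordLE Y.Winv_spec.1 Y.Winv_spec.2.2.2 Y.dressing
    (X.isDiff_ghostZS s) (by rw [hW]; exact X.der_dualW hee hde s)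

end GhostKP

/-! ### The ghost relation and uniqueness. -/

namespace GhostKP

open PDO

variable {A : Type u} [CommRing A] [Algebra ℚ A] {d e : ℕ → Derivation ℚ A A}

theorem dualΦ_dual (X : GhostKP d e) {Y : GhostKP e d} (hΦ : Y.Φ = X.dualΦ)
    (hW : Y.W = X.dualW) : Y.dualΦ = X.Φ := by
  funext m
  rw [dualΦ, hΦ, hW, dualW_coeff, inverse_dualΦ, Ring.mul_inverse_cancel_left _ _ X.isUnit_Φ]

theorem W_eq_dualW (X : GhostKP d e) {Y : GhostKP e d} (hΦ : Y.Φ = X.dualΦ) (hΦ' : X.Φ = Y.dualΦ) :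
    Y.W = X.dualW := by
  rw [eq_ofSeq Y.W_ordLE, dualW_eq]
  refine congrArg ofSeq (funext fun m => ?_)
  have h0 : Ring.inverse (X.Φ 0) = Y.Φ 0 := by rw [hΦ, dualΦ_zero]
  rw [h0, hΦ', dualΦ, Ring.mul_inverse_cancel_left _ _ Y.isUnit_Φ]

/-- Both integral formulas are the classical representation of `Φ̄` and `Ψ̄` by their own Wronskians
along `t̄₁`, rewritten by `Wr_dualΦ` for `X` and, in the case of `Ψ̄`, for `Y`. -/
theorem isGhostOf_of_dualΦ (X : GhostKP d e) (hee : ∀ m n a, e m (e n a) = e n (e m a))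
    (hde : ∀ m n a, d m (e n a) = e n (d m a)) {Y : GhostKP e d} (hΦ : Y.Φ = X.dualΦ)
    (hΦ' : X.Φ = Y.dualΦ) : X.IsGhostOf Y where
  lax := X.ghostZS_eq_of_dual hee hde (X.W_eq_dualW hΦ hΦ')
  Φ_one := by rw [hΦ, dualΦ_zero]
  Φ_int m := by
    have hWr : ∀ n, Wr (e 0) Y.Φ (n + 1) = (∏ i ∈ Finset.range n, (-1) ^ i) *
        (Wr (d 0) X.Ψ n * Ring.inverse (X.Φ 0)) := by rw [hΦ]; exact X.Wr_dualΦ hde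
    have hker := (signed_kernel _ _ · _ X.isUnit_Φ.ringInverse X.adj_indep hWr)
    obtain ⟨I, hI, hI'⟩ := exists_isIteratedIntegral_Wr Y.indep (m + 1)
    have h0 : Wr (e 0) Y.Φ 2 * Wr (e 0) Y.Φ 0 * Ring.inverse (Wr (e 0) Y.Φ 1) ^ 2 =
        X.kernelΦ 0 := by
      rw [hWr 1, Wr_zero, Wr_one, Wr_one, hΦ, inverse_dualΦ, kernelΦ]
      have := Ring.mul_inverse_cancel _ X.isUnit_Φ
      simp only [Finset.prod_range_one, pow_zero]
      linear_combination X.Ψ 0 * X.Φ 0 * this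
    have hI2 := hI.neg
    rw [List.length_map, List.length_range, List.range_succ_eq_map, List.map_cons, List.map_cons,
      List.map_map, List.map_map, h0] at hI2
    obtain ⟨g, hg, hg'⟩ := hI2
    -- Changing the sign of every kernel is right for all but the first, which already agrees with
    -- `kernelΦ 0`; the outer minus sign restores it.
    refine ⟨-((-1) ^ (m + 1) * I), ?_, ?_⟩
    · rw [List.range_succ_eq_map, List.map_cons, List.map_map]
      refine ⟨g, ?_, by rw [map_neg, hg', neg_mul, neg_neg]⟩
      convert hg using 2
      funext i
      exact (neg_eq_iff_eq_neg.mpr (hker i)).symm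
    · have h1 : (-1 : A) ^ (m + 1) * (-1) ^ (m + 1) = 1 := by rw [← mul_pow]; simp
      rw [hI', hΦ, dualΦ_zero, pow_succ _ (m + 1)]
      linear_combination -(Ring.inverse (X.Φ 0) * I) * h1
  Ψ_int m := by
    have hq : Ring.inverse (Y.Φ 0) = X.Φ 0 := by rw [hΦ, inverse_dualΦ]
    have hWr : ∀ n, Wr (d 0) X.Φ (n + 1) = (∏ i ∈ Finset.range n, (-1) ^ i) *
        (Wr (e 0) Y.Ψ n * X.Φ 0) := by
      rw [← hq, hΦ']; exact Y.Wr_dualΦ fun m n a => (hde n m a).symm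
    have hker := (signed_kernel _ _ · _ X.isUnit_Φ Y.adj_indep hWr)
    obtain ⟨I, hI, hI'⟩ := exists_isIteratedIntegral_Wr Y.adj_indep m
    have hI2 := hI.neg
    rw [List.length_map, List.length_range, List.map_map] at hI2
    refine ⟨(-1) ^ m * I, ?_, ?_⟩
    · convert hI2 using 2
      funext i
      exact hker i
    · have h1 : (-1 : A) ^ m * (-1) ^ m = 1 := by rw [← mul_pow]; simp
      have h2 := Ring.mul_inverse_cancel _ X.isUnit_Φ
      rw [hI', hWr 1, Wr_one]
      simp only [Finset.prod_range_one, pow_zero]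
      linear_combination -(Y.Ψ 0 * I * X.Φ 0 * Ring.inverse (X.Φ 0)) * h1 - Y.Ψ 0 * I * h2
  normal m := by rw [hΦ, dualΦ_zero]; rfl

theorem IsGhostOf.Φ_eq {X : GhostKP d e} {Y : GhostKP e d} (h : X.IsGhostOf Y) : Y.Φ = X.dualΦ := by
  funext m
  rw [h.normal, h.Φ_one, dualΦ]

/-- `L` is `W D W⁻¹`. The flow `e s` of the coefficient `w_1` is `∑ Φ_{s-j} Ψ_j`, which determines
`Ψ_s` from the earlier ones because `Φ_0` is invertible. -/
theorem ext_of_Φ_of_W {X Y : GhostKP d e} (hΦ : X.Φ = Y.Φ) (hW : X.W = Y.W) : X = Y := by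
  have hL : X.L = Y.L := eq_of_mul_right_eq X.Winv_spec.2.2.2 <| by
    rw [X.dressing, hW, Y.dressing]
  have hrow : ∀ (Z : GhostKP d e) k, ghostRow Z.W Z.Ψ k 1 = Z.Ψ k := fun Z k => by
    rw [ghostRow_succ Z.W_ordLE, Finset.sum_range_one, ghostUpper_self Z.dressing_form.1 Z.W_ordLE,
      pow_zero, mul_one]
    rfl
  have hsum : ∀ s, ∑ p ∈ Finset.HasAntidiagonal.antidiagonal s, Y.Φ p.1 * X.Ψ p.2 =
      ∑ p ∈ Finset.HasAntidiagonal.antidiagonal s, Y.Φ p.1 * Y.Ψ p.2 := fun s => by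
    have h1 := X.derivation_W_coeff s 1
    have h2 := Y.derivation_W_coeff s 1
    simp only [hrow] at h1 h2
    rw [← h2, ← hW, h1, hΦ]
  have hΨ : X.Ψ = Y.Ψ := by
    funext s
    induction s using Nat.strong_induction_on with
    | _ s ih =>
      have hr : ∀ f : ℕ → A, ∑ p ∈ Finset.HasAntidiagonal.antidiagonal s, Y.Φ p.1 * f p.2 =
          ∑ i ∈ Finset.range s, Y.Φ (s - i) * f i + Y.Φ 0 * f s := fun f => by
        rw [← Finset.Nat.sum_antidiagonal_swap]
        simp only [Prod.fst_swap, Prod.snd_swap]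
        rw [Finset.Nat.sum_antidiagonal_eq_sum_range_succ (fun a b => Y.Φ b * f a),
          Finset.sum_range_succ, Nat.sub_self]
      have h := hsum s
      rw [hr, hr, Finset.sum_congr rfl fun i hi => by rw [ih i (Finset.mem_range.1 hi)]] at h
      have h' := add_left_cancel h
      exact Y.isUnit_Φ.mul_left_cancel h'
  cases X
  cases Y
  simp only at hΦ hW hL hΨ
  subst hΦ hW hL hΨ
  rfl

/-- Each ghost relation fixes one sequence of eigenfunctions through the other dressing operator;
together they prescribe `Φ̄` and `W̄`, hence the whole of `Y`. -/
theorem isGhostOf_dual_iff (X : GhostKP d e) (hdd : ∀ m n a, d m (d n a) = d n (d m a))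
    (hee : ∀ m n a, e m (e n a) = e n (e m a)) (hde : ∀ m n a, d m (e n a) = e n (d m a))
    (Y : GhostKP e d) : X.dual hdd hee hde = Y ↔ X.IsGhostOf Y ∧ Y.IsGhostOf X := by
  constructor
  · rintro rfl
    have h : X.Φ = (X.dual hdd hee hde).dualΦ := (X.dualΦ_dual rfl rfl).symm
    exact ⟨X.isGhostOf_of_dualΦ hee hde rfl h,
      (X.dual hdd hee hde).isGhostOf_of_dualΦ hdd (fun m n a => (hde n m a).symm) h rfl⟩
  · rintro ⟨h1, h2⟩
    exact ext_of_Φ_of_W h1.Φ_eq.symm (X.W_eq_dualW h1.Φ_eq h2.Φ_eq).symm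

end GhostKP

theorem mainTheorem9 {A : Type u} [CommRing A] [Algebra ℚ A]
    (d e : ℕ → Derivation ℚ A A)
    (hdd : ∀ m n a, d m (d n a) = d n (d m a))
    (hee : ∀ m n a, e m (e n a) = e n (e m a))
    (hde : ∀ m n a, d m (e n a) = e n (d m a)) :
    ∃ 𝔇 : GhostKP d e ≃ GhostKP e d,
      ∀ (X : GhostKP d e) (Y : GhostKP e d),
        𝔇 X = Y ↔ X.IsGhostOf Y ∧ Y.IsGhostOf X := by
  have hed : ∀ m n a, e m (d n a) = d n (e m a) := fun m n a => (hde n m a).symm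
  refine ⟨⟨fun X => X.dual hdd hee hde, fun Y => Y.dual hee hdd hed, fun X => ?_, fun Y => ?_⟩,
    fun X Y => X.isGhostOf_dual_iff hdd hee hde Y⟩
  -- Being ghosts of each other is symmetric, so the characterisation of the dual, read from the
  -- other side, shows that the two dualisations are mutually inverse.
  · exact (GhostKP.isGhostOf_dual_iff _ hee hdd hed X).2
      ((X.isGhostOf_dual_iff hdd hee hde _).1 rfl).symm
  · exact (GhostKP.isGhostOf_dual_iff _ hdd hee hde Y).2
      ((Y.isGhostOf_dual_iff hee hdd hed _).1 rfl).symm
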